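/- **Setting (hypermultiplet base).** Let $D\subset\mathbb C^n$ be a connected open set and $\Omega:D\to\mathbb C^{2n+2}$ a holomorphic symplectic section of a special Kähler manifold (of the local type) covered by one chart: with $\mathbb C=\begin{pmatrix}0&1\\-1&0\end{pmatrix}$, $i\,\Omega^T\mathbb C\bar\Omega>0$, $\Omega^T\mathbb C\,\partial_i\Omega=0$, and $g_{ij^*}=\partial_i\partial_{j^*}\mathcal K$ is positive definite, where $\mathcal K=-\log(i\,\Omega^T\mathbb C\bar\Omega)$. Put $V=e^{\mathcal K/2}\Omega=(L^\Lambda,M_\Lambda)$, $U_i=(\partial_i+\tfrac12\partial_i\mathcal K)V=(f_i^\Lambda,h_{\Lambda i})$, let the period matrix $\mathcal N$ be defined by $\bar M=\mathcal N\bar L$, $h_i=\mathcal N f_i$, and let $$\mathcal M_4^{-1}=\begin{pmatrix}\mathrm{Im}\mathcal N+\mathrm{Re}\mathcal N\,\mathrm{Im}\mathcal N^{-1}\mathrm{Re}\mathcal N&-\mathrm{Re}\mathcal N\,\mathrm{Im}\mathcal N^{-1}\\-\mathrm{Im}\mathcal N^{-1}\mathrm{Re}\mathcal N&\mathrm{Im}\mathcal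 N^{-1}\end{pmatrix}.$$ **The $c$-map image.** It is $\mathcal{QM}=\{(U,a,z,\mathbf Z)\}=\mathbb R\times\mathbb R\times D\times\mathbb R^{2n+2}$ with $\Phi=da+\mathbf Z^T\mathbb C\,d\mathbf Z$, metric $$h=\tfrac14\left(dU^2+4g_{ij^*}dz^id\bar z^{j^*}+e^{-2U}\Phi^2-2e^{-U}d\mathbf Z^T\mathcal M_4^{-1}d\mathbf Z\right)$$ and $\mathfrak{su}(2)$-connection $$\omega=\begin{pmatrix}-\frac i2\mathcal Q-\frac i4e^{-U}\Phi&e^{-U/2}V^T\mathbb C\,d\mathbf Z\\-e^{-U/2}\bar V^T\mathbb C\,d\mathbf Z&\frac i2\mathcal Q+\frac i4e^{-U}\Phi\end{pmatrix},\qquad \mathcal Q=\tfrac i2(\partial_i\mathcal K\,dz^i-\partial_{i^*}\mathcal K\,d\bar z^{i^*}),$$ with curvature $\mathbf K=d\omega+\omega\wedge\omega$. Assume that $(\mathcal{QM},h)$ is a Riemannian globally symmetric space. **The gauged generator.** Let $L_+=-\partial_a$ and $L_0=-(\partial_U+a\,\partial_a+\tfrac12\mathbf Z^\alpha\partial_\alpha)$.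 A Killing vector field $L_-$ of $(\mathcal{QM},h)$ is called an Ehlers lowering generator if $[L_0,L_-]=-L_-$ and $[L_+,L_-]=2L_0$ (Lie brackets of vector fields; $[L_0,L_+]=L_+$ holds identically). Given one, put $\mathfrak S=L_+-L_-$, the compact Ehlers generator. Let $\mathfrak N_+$ be a nilpotent isometry of the base: a holomorphic vector field $k$ on $D$, a holomorphic function $f$ and a nilpotent real matrix $\mathfrak T$ with $\mathfrak T^T\mathbb C+\mathbb C\mathfrak T=0$ such that $k^i\partial_i\Omega=\mathfrak T\Omega+f\,\Omega$; it acts on $\mathcal{QM}$ by $k^i\partial_i+\bar k^{i}\partial_{i^*}+(\mathfrak T\mathbf Z)^\alpha\partial_\alpha$ and has Kähler moment map $$\mathcal P_{\mathfrak N_+}=-\tfrac i2\left(k^i\partial_i\mathcal K-\bar k^{i}\partial_{i^*}\mathcal K\right)+\mathrm{Im}f .$$ For $\kappa\in\mathbb R$ let $\mathfrak p=\mathfrak N_++\kappa\,\mathfrak S$. **The potential.** A tri-holomorphic moment map of $\mathfrak p$ is a smooth $\mathfrak{su}(2)$-valued function $\mathfrak P$ on $\mathcal{QM}$ with $\mathbf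 i_{\mathfrak p}\mathbf K=d\mathfrak P+[\omega,\mathfrak P]$; write $\mathfrak P=\tfrac{i}{\sqrt2}\sum_x\mathcal P^x\gamma_x$, where $\sqrt2\,\gamma_1,\sqrt2\,\gamma_2,\sqrt2\,\gamma_3$ are the Pauli matrices $\sigma_3,\sigma_2,\sigma_1$. Gauge $\mathfrak p$ with the vector of one minimally coupled vector multiplet $w$, $|w|<1$, of Kähler potential $\hat{\mathcal K}=-\log[2(1-|w|^2)]$ and $\hat V^1=e^{\hat{\mathcal K}/2}w$. The scalar potential is $$\mathcal V(w,q)=4\,h(\mathfrak p,\mathfrak p)\,|\hat V^1|^2+\left(\hat g^{w\bar w}|\nabla_w\hat V^1|^2-3|\hat V^1|^2\right)\sum_x(\mathcal P^x)^2 .$$ **Claim.** An Ehlers lowering generator $L_-$ exists. For every such $L_-$, every nilpotent isometry $\mathfrak N_+$, every $\kappa\in\mathbb R$ and every tri-holomorphic moment map $\mathfrak P$ of $\mathfrak p$: 1. the $w$-derivatives of $\mathcal V$ vanish at $w=0$, and $\mathcal V(0,q)=-\mathrm{Tr}(\mathfrak P\cdot\mathfrak P)$. For every real constant $c$ the potential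 $V_{gauging}=c\,\mathrm{Tr}(\mathfrak P\cdot\mathfrak P)$ (so $c=-1$ in item 1) satisfies: 2. $\partial V_{gauging}/\partial\mathbf Z^\alpha=0$ at $\mathbf Z=0$, and $\mathbf Z=0$ is a consistent truncation, that is, the components of the field equations $\Box\phi+\Gamma(\partial\phi,\partial\phi)+\mathrm{grad}\,V=0$ normal to the locus hold identically for fields in the locus; 3. $V_{eff}(U,a,z,\bar z)=V_{gauging}|_{\mathbf Z=0}=-\frac c2\left[\mathcal P_{\mathfrak N_+}+\frac\kappa2\,e^{-U}\left(1+a^2+e^{2U}\right)\right]^2$; 4. $\partial_UV_{eff}=\partial_aV_{eff}=0$ at $U=a=0$, the locus $\mathbf Z=0$, $U=a=0$ is again a consistent truncation, and there the potential is $-\frac c2\left(\mathcal P_{\mathfrak N_+}+\kappa\right)^2$ (so exactly $(\mathcal P_{\mathfrak N_+}+\kappa)^2$ for $c=-2$). -/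

import Mathlib

open scoped ContDiff Matrix ComplexConjugate

noncomputable section

namespace CMap

/-! ### Local special Kähler geometry of a holomorphic symplectic section -/

/-- Index set of the `2n+2` components of a symplectic section (upper block, lower block). -/
abbrev SympIdx (n : ℕ) : Type := Fin (n + 1) ⊕ Fin (n + 1)

/-- The antisymmetric symplectic matrix `ℂ = (0, 1; -1, 0)`. -/
def sympC (n : ℕ) (R : Type) [CommRing R] : Matrix (SympIdx n) (SympIdx n) R :=
  Matrix.fromBlocks 0 1 (-1) 0

/-- The symplectic product `Aᵀ ℂ B`. -/
def symp {n : ℕ} {R : Type} [CommRing R] (A B : SympIdx n → R) : R :=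
  A ⬝ᵥ (sympC n R *ᵥ B)

/-- The Wirtinger derivative `∂F/∂zⁱ`. -/
def wirtinger {n : ℕ} (F : (Fin n → ℂ) → ℂ) (i : Fin n) (z : Fin n → ℂ) : ℂ :=
  (1 / 2) * (fderiv ℝ F z (Pi.single i 1) - Complex.I * fderiv ℝ F z (Pi.single i Complex.I))

/-- The Wirtinger derivative `∂F/∂z̄ⁱ`. -/
def wirtingerBar {n : ℕ} (F : (Fin n → ℂ) → ℂ) (i : Fin n) (z : Fin n → ℂ) : ℂ :=
  (1 / 2) * (fderiv ℝ F z (Pi.single i 1) + Complex.I * fderiv ℝ F z (Pi.single i Complex.I))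

section Section

variable {n : ℕ} (Ω : (Fin n → ℂ) → SympIdx n → ℂ)

/-- `i ⟨Ω | Ω̄⟩ = i Ωᵀ ℂ Ω̄` (a real number). -/
def hermNorm (z : Fin n → ℂ) : ℝ :=
  (Complex.I * symp (Ω z) (fun α => conj (Ω z α))).re

/-- The Kähler potential `𝒦 = - log (i ⟨Ω | Ω̄⟩)`. -/
def kahlerPotential (z : Fin n → ℂ) : ℝ := -Real.log (hermNorm Ω z)

/-- The derivative `∂_i 𝒦`. -/
def dKahler (i : Fin n) (z : Fin n → ℂ) : ℂ :=
  wirtinger (fun w => (kahlerPotential Ω w : ℂ)) i z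

/-- The Kähler metric `g_{i j*} = ∂_i ∂_{j*} 𝒦`. -/
def kahlerMetric (z : Fin n → ℂ) : Matrix (Fin n) (Fin n) ℂ :=
  Matrix.of fun i j =>
    wirtinger (fun w => wirtingerBar (fun w' => (kahlerPotential Ω w' : ℂ)) j w) i z

/-- The covariantly holomorphic section `V = e^{𝒦/2} Ω`. -/
def secV (z : Fin n → ℂ) (α : SympIdx n) : ℂ :=
  (Real.exp (kahlerPotential Ω z / 2) : ℂ) * Ω z α

/-- `U_i = ∇_i V = (∂_i + ½ ∂_i 𝒦) V`. -/
def secU (i : Fin n) (z : Fin n → ℂ) (α : SympIdx n) : ℂ :=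
  wirtinger (fun w => secV Ω w α) i z + (1 / 2) * dKahler Ω i z * secV Ω z α

/-- The matrix `f^Λ_I = (f^Λ_i, L̄^Λ)`, or `h_{Λ I} = (h_{Λ i}, M̄_Λ)`, according to the block
of the symplectic index that is selected. -/
def periodBlock (b : Fin (n + 1) → SympIdx n) (z : Fin n → ℂ) :
    Matrix (Fin (n + 1)) (Fin (n + 1)) ℂ :=
  Matrix.of fun Λ I =>
    Fin.lastCases (motive := fun _ => ℂ) (conj (secV Ω z (b Λ))) (fun i => secU Ω i z (b Λ)) I

/-- The period matrix `𝒩 = h f⁻¹`. -/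
def periodMatrix (z : Fin n → ℂ) : Matrix (Fin (n + 1)) (Fin (n + 1)) ℂ :=
  periodBlock Ω Sum.inr z * (periodBlock Ω Sum.inl z)⁻¹

/-- The real symmetric matrix `ℳ₄⁻¹`. -/
def matM4inv (z : Fin n → ℂ) : Matrix (SympIdx n) (SympIdx n) ℝ :=
  let R := (periodMatrix Ω z).map Complex.re
  let J := (periodMatrix Ω z).map Complex.im
  Matrix.fromBlocks (J + R * J⁻¹ * R) (-(R * J⁻¹)) (-(J⁻¹ * R)) J⁻¹

/-- The `U(1)` connection `𝒬 = (i/2) (∂_i 𝒦 dzⁱ - ∂_{i*} 𝒦 dz̄ⁱ) = - Im (∂_i 𝒦 dzⁱ)` on `v`. -/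
def connQ (z v : Fin n → ℂ) : ℝ := -(∑ i, dKahler Ω i z * v i).im

end Section

/-- A special Kähler manifold (of the local type) of complex dimension `n`, covered by one
holomorphic chart over which the flat symplectic bundle and the line bundle are trivial:
`Ω` is the holomorphic symplectic section, `i⟨Ω|Ω̄⟩` is positive, `⟨Ω|∂_i Ω⟩ = 0`, and the
metric `∂_i ∂_{j*} 𝒦` is positive definite. -/
structure SpecialKahler (n : ℕ) where
  D : Set (Fin n → ℂ)
  isOpen_D : IsOpen D
  isConnected_D : IsConnected D
  Ω : (Fin n → ℂ) → SympIdx n → ℂ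
  holomorphic : DifferentiableOn ℂ Ω D
  hermNorm_pos : ∀ z ∈ D, 0 < hermNorm Ω z
  legendre : ∀ z ∈ D, ∀ v : Fin n → ℂ, symp (Ω z) (fderiv ℂ Ω z v) = 0
  metric_pos : ∀ z ∈ D, ∀ v : Fin n → ℂ, v ≠ 0 →
    0 < (∑ i, ∑ j, kahlerMetric Ω z i j * v i * conj (v j)).re

/-! ### The c-map image -/

/-- The coordinates `(U, a, z, 𝐙)`; also the tangent vectors of the c-map image. -/
abbrev QSpace (n : ℕ) : Type := ℝ × ℝ × (Fin n → ℂ) × (SympIdx n → ℝ)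

/-- The one-form `Φ = da + 𝐙ᵀ ℂ d𝐙`. -/
def formPhi {n : ℕ} (q v : QSpace n) : ℝ := v.2.1 + symp q.2.2.2 v.2.2.2

/-- Entrywise directional derivative of a matrix-valued function. -/
def matDeriv {n : ℕ} (F : QSpace n → Matrix (Fin 2) (Fin 2) ℂ) (q v : QSpace n) :
    Matrix (Fin 2) (Fin 2) ℂ :=
  Matrix.of fun i j => fderiv ℝ (fun x => F x i j) q v

/-- The `2 × 2` matrices `γ_x`. -/
def gammaMat (x : Fin 3) : Matrix (Fin 2) (Fin 2) ℂ :=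
  ((1 / Real.sqrt 2 : ℝ) : ℂ) •
    (![!![1, 0; 0, -1], !![0, -Complex.I; Complex.I, 0], !![0, 1; 1, 0]] x)

/-- The triplet `𝒫^x` of an `su(2)`-matrix `𝔓 = (i/√2) ∑ₓ 𝒫^x γₓ`. -/
def triplet (𝔓 : Matrix (Fin 2) (Fin 2) ℂ) (x : Fin 3) : ℝ :=
  (-Complex.I * (Real.sqrt 2 : ℂ) * (gammaMat x * 𝔓).trace).re

/-- The symplectic section `(1, ω | i, -i ω)` of the minimal coupling special geometry
`SU(1,1)/U(1)` with one vector multiplet; its Kähler potential is `- log (2 (1 - |ω|²))`. -/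
def minimalSection (w : Fin 1 → ℂ) : SympIdx 1 → ℂ :=
  Sum.elim ![1, w 0] ![Complex.I, -Complex.I * w 0]

/-- The potential `const · Tr (𝔓 · 𝔓)`. -/
def gaugingPotential {n : ℕ} (c : ℝ) (𝔓 : QSpace n → Matrix (Fin 2) (Fin 2) ℂ)
    (q : QSpace n) : ℝ :=
  c * (𝔓 q * 𝔓 q).trace.re

/-- The locus `𝐙 = 0`. -/
def locusZ (n : ℕ) : Submodule ℝ (QSpace n) where
  carrier := {q | q.2.2.2 = 0}
  add_mem' := by
    intro p q hp hq
    simp only [Set.mem_ofPred_eq] at hp hq ⊢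
    simp [hp, hq]
  zero_mem' := rfl
  smul_mem' := by
    intro c q hq
    simp only [Set.mem_ofPred_eq] at hq ⊢
    simp [hq]

/-- The locus `U = a = 0`, `𝐙 = 0`. -/
def locusUaZ (n : ℕ) : Submodule ℝ (QSpace n) where
  carrier := {q | q.1 = 0 ∧ q.2.1 = 0 ∧ q.2.2.2 = 0}
  add_mem' := by
    rintro p q ⟨h1, h2, h3⟩ ⟨k1, k2, k3⟩
    simp [h1, h2, h3, k1, k2, k3]
  zero_mem' := ⟨rfl, rfl, rfl⟩
  smul_mem' := by
    rintro c q ⟨h1, h2, h3⟩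
    simp [h1, h2, h3]

/-- The universal Heisenberg central generator `L₊`, acting as `-∂/∂a`. -/
def ehlersPlus (n : ℕ) (_ : QSpace n) : QSpace n := (0, -1, 0, 0)

/-- The Ehlers grading generator `L₀ = -(∂_U + a ∂_a + ½ 𝐙^α ∂_α)`. -/
def ehlersZero (n : ℕ) (q : QSpace n) : QSpace n :=
  (-1, -q.2.1, 0, -(1 / 2 : ℝ) • q.2.2.2)

namespace SpecialKahler

variable {n : ℕ} (S : SpecialKahler n)

/-- The underlying set of the c-map image, `ℝ_U × ℝ_a × D × ℝ^{2n+2}`. -/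
def carrier : Set (QSpace n) := {q | q.2.2.1 ∈ S.D}

/-- The metric
`¼ (dU² + 4 g_{ij*} dzⁱ dz̄ʲ + e^{-2U} Φ² - 2 e^{-U} d𝐙ᵀ ℳ₄⁻¹ d𝐙)` as a bilinear form. -/
def metric (q v w : QSpace n) : ℝ :=
  (1 / 4) * (v.1 * w.1
    + 4 * (∑ i, ∑ j, kahlerMetric S.Ω q.2.2.1 i j * v.2.2.1 i * conj (w.2.2.1 j)).re
    + Real.exp (-2 * q.1) * (formPhi q v * formPhi q w)
    - 2 * Real.exp (-q.1) * (v.2.2.2 ⬝ᵥ (matM4inv S.Ω q.2.2.1 *ᵥ w.2.2.2)))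

/-- The `su(2)` connection one-form `ω`. -/
def omega (q v : QSpace n) : Matrix (Fin 2) (Fin 2) ℂ :=
  let d : ℂ := -(Complex.I / 2) * (connQ S.Ω q.2.2.1 v.2.2.1 : ℂ)
    - (Complex.I / 4) * ((Real.exp (-q.1) * formPhi q v : ℝ) : ℂ)
  let s : ℂ := (Real.exp (-q.1 / 2) : ℂ)
    * symp (secV S.Ω q.2.2.1) (fun α => (v.2.2.2 α : ℂ))
  !![d, s; -(conj s), -d]

/-- The curvature (HyperKähler) two-form `𝐊 = dω + ω ∧ ω`. -/
def curvature (q v w : QSpace n) : Matrix (Fin 2) (Fin 2) ℂ :=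
  matDeriv (fun x => S.omega x w) q v - matDeriv (fun x => S.omega x v) q w
    + (S.omega q v * S.omega q w - S.omega q w * S.omega q v)

/-- The c-map image is a Riemannian (globally) symmetric space: every point `p` is fixed by an
involutive isometry whose differential at `p` is `-1`. -/
def IsSymmetric : Prop :=
  ∀ p ∈ S.carrier, ∃ σ : QSpace n → QSpace n,
    Set.MapsTo σ S.carrier S.carrier ∧ ContDiffOn ℝ ∞ σ S.carrier ∧
    (∀ x ∈ S.carrier, σ (σ x) = x) ∧ σ p = p ∧ (∀ v, fderiv ℝ σ p v = -v) ∧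
    ∀ x ∈ S.carrier, ∀ v w,
      S.metric (σ x) (fderiv ℝ σ x v) (fderiv ℝ σ x w) = S.metric x v w

/-- `X` is a smooth Killing vector field of the c-map image: `ℒ_X h = 0`. -/
def IsKilling (X : QSpace n → QSpace n) : Prop :=
  ContDiffOn ℝ ∞ X S.carrier ∧
  ∀ q ∈ S.carrier, ∀ v w,
    fderiv ℝ (fun x => S.metric x v w) q (X q)
      + S.metric q (fderiv ℝ X q v) w + S.metric q v (fderiv ℝ X q w) = 0

/-- `L₋` is the lowering generator of the Ehlers algebra `sl(2,ℝ)_E`: a Killing vector field with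
`[L₀, L₋] = -L₋` and `[L₊, L₋] = 2 L₀`. (The relation `[L₀, L₊] = L₊` holds identically.) -/
def IsEhlersMinus (L : QSpace n → QSpace n) : Prop :=
  S.IsKilling L ∧
  (∀ q ∈ S.carrier, VectorField.lieBracket ℝ (ehlersZero n) L q = -L q) ∧
  (∀ q ∈ S.carrier,
    VectorField.lieBracket ℝ (ehlersPlus n) L q = (2 : ℝ) • ehlersZero n q)

/-- A nilpotent isometry of the special Kähler base: a holomorphic vector field `k`, acting on the
symplectic section through a nilpotent `𝔗 ∈ sp(2n+2,ℝ)` up to the holomorphic compensator `f`,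
`kⁱ ∂_i Ω = 𝔗 Ω + f Ω`. -/
structure NilpotentIsometry where
  k : (Fin n → ℂ) → (Fin n → ℂ)
  f : (Fin n → ℂ) → ℂ
  T : Matrix (SympIdx n) (SympIdx n) ℝ
  holomorphic_k : DifferentiableOn ℂ k S.D
  holomorphic_f : DifferentiableOn ℂ f S.D
  symplectic_T : Tᵀ * sympC n ℝ + sympC n ℝ * T = 0
  nilpotent_T : IsNilpotent T
  action : ∀ z ∈ S.D,
    fderiv ℂ S.Ω z (k z) = (T.map Complex.ofReal) *ᵥ S.Ω z + f z • S.Ω z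

variable {S}

/-- The Kähler moment map
`𝒫 = -(i/2) (kⁱ ∂_i 𝒦 - k^{i*} ∂_{i*} 𝒦) + Im f = Im (kⁱ ∂_i 𝒦) + Im f`. -/
def NilpotentIsometry.momentMap (N : S.NilpotentIsometry) (z : Fin n → ℂ) : ℝ :=
  (∑ i, N.k z i * dKahler S.Ω i z).im + (N.f z).im

/-- The isometry `kⁱ ∂_i + k^{i*} ∂_{i*} + (𝔗 𝐙)^α ∂_α` of the c-map image. -/
def NilpotentIsometry.lift (N : S.NilpotentIsometry) (q : QSpace n) : QSpace n :=
  (0, 0, N.k q.2.2.1, N.T *ᵥ q.2.2.2)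

/-- The gauged generator `𝔭 = 𝔑₊ + κ 𝔖`, `𝔖 = L₊ - L₋`. -/
def NilpotentIsometry.gauged (N : S.NilpotentIsometry) (κ : ℝ) (Lm : QSpace n → QSpace n)
    (q : QSpace n) : QSpace n :=
  N.lift q + κ • (ehlersPlus n q - Lm q)

variable (S)

/-- `𝔓` is a tri-holomorphic moment map of `X`: smooth, `su(2)`-valued, and
`𝐢_X 𝐊 = d𝔓 + [ω, 𝔓]`. -/
def IsMomentMap (X : QSpace n → QSpace n) (𝔓 : QSpace n → Matrix (Fin 2) (Fin 2) ℂ) : Prop :=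
  (∀ i j, ContDiffOn ℝ ∞ (fun q => 𝔓 q i j) S.carrier) ∧
  (∀ q ∈ S.carrier, (𝔓 q)ᴴ = -𝔓 q ∧ (𝔓 q).trace = 0) ∧
  ∀ q ∈ S.carrier, ∀ v,
    S.curvature q (X q) v = matDeriv 𝔓 q v + (S.omega q v * 𝔓 q - 𝔓 q * S.omega q v)

/-- The scalar potential
`4 k^u k^v h_{uv} |V̂¹|² + (ĝ^{ij*} ∇_i V̂¹ ∇_{j*} V̂̄¹ - 3 |V̂¹|²) ∑ₓ 𝒫^x 𝒫^x`
of the theory where the vector of one minimally coupled vector multiplet (with scalar `w`)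
gauges the isometry `X` with tri-holomorphic moment map `𝔓`. -/
def scalarPotential (X : QSpace n → QSpace n) (𝔓 : QSpace n → Matrix (Fin 2) (Fin 2) ℂ)
    (w : Fin 1 → ℂ) (q : QSpace n) : ℝ :=
  4 * S.metric q (X q) (X q) * Complex.normSq (secV minimalSection w (Sum.inl 1))
  + ((∑ i, ∑ j, (kahlerMetric minimalSection w)⁻¹ i j
        * secU minimalSection i w (Sum.inl 1)
        * conj (secU minimalSection j w (Sum.inl 1))).re
      - 3 * Complex.normSq (secV minimalSection w (Sum.inl 1)))
    * ∑ x, triplet (𝔓 q) x ^ 2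

/-- Restricting the σ-model fields to the coordinate locus `L` is a consistent truncation for the
potential `V`: on the locus, the components of the field equations
`□φ + Γ(∂φ, ∂φ) + grad V = 0` normal to the locus hold identically. With lowered index these are
`h(w, □φ) = 0` (automatic), `∂_v h(v, w) - ½ ∂_w h(v, v) = 0` and `∂_w V = 0`, for `v` tangent
and `w` normal. -/
def IsConsistentTruncation (V : QSpace n → ℝ) (L : Submodule ℝ (QSpace n)) : Prop :=
  ∀ q ∈ S.carrier, q ∈ L → ∀ w, (∀ u ∈ L, S.metric q w u = 0) →
    HasLineDerivAt ℝ V 0 q w ∧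
    ∀ v ∈ L, fderiv ℝ (fun x => S.metric x v w) q v
      - (1 / 2) * fderiv ℝ (fun x => S.metric x v v) q w = 0

end SpecialKahler

end CMap

end

/-! Two rigidity facts drive the theorem. A Killing field on a connected Riemannian domain is
determined by its 1-jet at one point, which yields existence of L₋. And near 𝐙 = 0 the brackets, the
Killing equation and the moment map equation determine every L₋ and every 𝔓 as far as the claims
need them, so neither has to be known globally.

Existence (`exists_lowering`). Let σ be the symmetry at p = (0, 0, z₀, 0). The metric does not
depend on a, so L₊ is a constant Killing field e. The Killing field L₀ has ∇L₀ = 0 at p, hence σ^*L₀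
+ L₀ has zero 1-jet and vanishes. Reflecting [L₀, e] = e gives [L₀, σ^*e] = −σ^*e. The Killing field
[e, σ^*e] + 2L₀ vanishes at p and is reversed by σ, which again forces a zero 1-jet; so it is zero
and L₋ = −σ^*e works. This needs h smooth and positive definite: the span of the U_i and V̄ is
Lagrangian and negative for the Hermitian product, so 𝒩 is well defined and symmetric with Im 𝒩 < 0,
and ℳ₄⁻¹ is negative definite.

Rigidity of L₋. The bracket relations give ∂_a L₋ and, at 𝐙 = 0, express ∂_U L₋ through L₋; the
Killing equation in the direction ∂_U then gives L₋ = (2a, a² − e^{2U}, 0, 0) on the locus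
(`eq_of_locus`). To first order in 𝐙, the 𝐙-component of L₋ is aζ + e^U η with η undetermined
(`fderiv_dirZ_of_locus`).

Rigidity of 𝔓. At 𝐙 = 0 the entry 𝔓₀₁ is constant in U while ∂_a 𝔓₀₁ = (i/2) e^{-U} 𝔓₀₁, so 𝔓₀₁ = 0
(`off_eq_zero`). Integrating in U gives 𝔓₀₀ up to a constant c. The constant is found one order off
the locus: D_ζ 𝔓₀₁ is algebraic in 𝔓₀₀, and its U-derivative is also given by the mixed second
derivative. Comparing powers of e^U removes η, and k^i ∂_i Ω = 𝔗Ω + fΩ turns what remains into the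
Kähler moment map (`diag_eq`).

The potential is c Tr 𝔓² with 𝔓₀₁ = 0 on the locus, so its values and gradients there come from 𝔓₀₀
alone. The truncations further use that both loci are totally geodesic. For the vector multiplet,
the potential depends on w only through |w|². -/

set_option maxSynthPendingDepth 3

/-! ### Smoothness of holomorphic functions of several variables -/

section Holomorphic

open Metric

variable {E F : Type*} [NormedAddCommGroup E] [NormedSpace ℂ E]
  [NormedAddCommGroup F] [NormedSpace ℂ F]

theorem differentiableOn_comp_line {f : E → F} {s : Set E} (hf : DifferentiableOn ℂ f s)
    (x v : E) {t : Set ℂ} (ht : ∀ c ∈ t, x + c • v ∈ s) :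
    DifferentiableOn ℂ (fun c : ℂ => f (x + c • v)) t :=
  hf.comp (by fun_prop) ht

theorem deriv_line_eq_fderiv {f : E → F} {x : E} (hf : DifferentiableAt ℂ f x) (v : E) :
    deriv (fun c : ℂ => f (x + c • v)) 0 = fderiv ℂ f x v := by
  have h1 : HasDerivAt (fun c : ℂ => x + c • v) v 0 := by
    simpa using ((hasDerivAt_id (0 : ℂ)).smul_const v).const_add x
  have h2 : HasFDerivAt f (fderiv ℂ f x) (x + (0 : ℂ) • v) := by simpa using hf.hasFDerivAt
  exact (h2.comp_hasDerivAt (0 : ℂ) h1).deriv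

/-- Cauchy's estimate on the slice `c ↦ f (x + c • w)` over a disc of radius `r / ‖w‖`, which stays
inside the ball of radius `2 * r`. -/
theorem norm_fderiv_le_of_bound {f : E → F} {x : E} {r C : ℝ} (hr : 0 < r)
    (hf : DifferentiableOn ℂ f (ball x (2 * r))) (hC : ∀ y ∈ ball x (2 * r), ‖f y‖ ≤ C) :
    ‖fderiv ℂ f x‖ ≤ C / r := by
  have hx : x ∈ ball x (2 * r) := mem_ball_self (by positivity)
  have hC0 : 0 ≤ C := (norm_nonneg _).trans (hC x hx)
  refine ContinuousLinearMap.opNorm_le_bound _ (by positivity) fun w => ?_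
  rcases eq_or_ne w 0 with rfl | hw
  · simp
  have hw' : 0 < ‖w‖ := norm_pos_iff.2 hw
  rw [← deriv_line_eq_fderiv ((hf x hx).differentiableAt (isOpen_ball.mem_nhds hx))]
  have hmem : ∀ c ∈ closedBall (0 : ℂ) (r / ‖w‖), x + c • w ∈ ball x (2 * r) := by
    intro c hc
    rw [mem_closedBall_zero_iff, le_div_iff₀ hw'] at hc
    simp only [mem_ball, dist_self_add_left, norm_smul]
    linarith
  have := Complex.norm_deriv_le_of_forall_mem_sphere_norm_le (f := fun c : ℂ => f (x + c • w))
    (c := 0) (R := r / ‖w‖) (C := C) (by positivity)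
    ((differentiableOn_comp_line hf x w hmem).diffContOnCl_ball subset_rfl)
    (fun c hc => hC _ (hmem c (sphere_subset_closedBall hc)))
  refine this.trans (le_of_eq ?_)
  field_simp

variable [FiniteDimensional ℂ E] [FiniteDimensional ℂ F]

/-- Cauchy's formula writes the directional derivative as a circle integral of `f (x + c • v)`.
Differentiating under the integral uses only the first derivative of `f`: it is locally bounded by
Cauchy's estimate, and it is measurable although its continuity is not yet known. -/
theorem differentiableOn_fderiv_apply {f : E → F} {s : Set E} (hs : IsOpen s)
    (hf : DifferentiableOn ℂ f s) (v : E) :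
    DifferentiableOn ℂ (fun x => fderiv ℂ f x v) s := by
  intro x₀ hx₀
  refine DifferentiableAt.differentiableWithinAt ?_
  have : ProperSpace E := FiniteDimensional.proper ℂ E
  have : ProperSpace (E →L[ℂ] F) := FiniteDimensional.proper ℂ _
  obtain ⟨R, hR, hRs⟩ := Metric.isOpen_iff.1 hs x₀ hx₀
  -- Base points range over radius `r`, their circle translates over `3 * r`, and the Cauchy
  -- estimate needs `2 * r` more; the total `5 * r` is below `R`.
  set r := R / 6 with hr_def
  have hr : 0 < r := by positivity
  have hsub : closedBall x₀ (5 * r) ⊆ s :=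
    (closedBall_subset_ball (by rw [hr_def]; linarith)).trans hRs
  obtain ⟨C, hC⟩ := (isCompact_closedBall x₀ (5 * r)).exists_bound_of_continuousOn
    (hf.continuousOn.mono hsub)
  -- The `+ 1` keeps the circle nondegenerate when `v = 0`.
  set ρ := r / (‖v‖ + 1) with hρ_def
  have hv1 : 0 < ‖v‖ + 1 := by positivity
  have hρ : 0 < ρ := by positivity
  have hρv : ∀ c ∈ closedBall (0 : ℂ) ρ, ‖c • v‖ ≤ r := by
    intro c hc
    rw [mem_closedBall_zero_iff] at hc
    rw [norm_smul]
    calc ‖c‖ * ‖v‖ ≤ ρ * (‖v‖ + 1) := by gcongr; linarith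
      _ = r := by rw [hρ_def]; field_simp
  have hin : ∀ x ∈ ball x₀ r, ∀ c ∈ closedBall (0 : ℂ) ρ, x + c • v ∈ ball x₀ (3 * r) := by
    intro x hx c hc
    rw [mem_ball] at hx ⊢
    calc dist (x + c • v) x₀ ≤ dist (x + c • v) x + dist x x₀ := dist_triangle _ _ _
      _ < 3 * r := by
        have := hρv c hc
        rw [dist_self_add_left]; linarith
  have h3s : ball x₀ (3 * r) ⊆ s :=
    (ball_subset_closedBall.trans (closedBall_subset_closedBall (by linarith))).trans hsub
  have hbd : ∀ y ∈ ball x₀ (3 * r), ‖fderiv ℂ f y‖ ≤ C / r := by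
    intro y hy
    have hyb : ball y (2 * r) ⊆ closedBall x₀ (5 * r) := by
      intro w hw
      rw [mem_ball] at hw hy
      rw [mem_closedBall]
      linarith [dist_triangle w y x₀]
    exact norm_fderiv_le_of_bound hr (hf.mono (hyb.trans hsub)) fun w hw => hC w (hyb hw)
  have hcm : ∀ θ : ℝ, circleMap 0 ρ θ ∈ closedBall (0 : ℂ) ρ :=
    fun θ => circleMap_mem_closedBall 0 hρ.le θ
  set k : ℝ → ℂ := fun θ => deriv (circleMap 0 ρ) θ * (1 / (circleMap 0 ρ θ - 0) ^ 2) with hk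
  have hkc : Continuous k := by
    have h0 : ∀ θ, (circleMap 0 ρ θ - 0) ^ 2 ≠ 0 := fun θ => by
      simp [hρ.ne']
    simp only [hk, deriv_circleMap]
    exact (by fun_prop : Continuous fun θ => circleMap 0 ρ θ * Complex.I).mul
      (continuous_const.div (by fun_prop) h0)
  set G : E → ℝ → F := fun x θ => k θ • f (x + circleMap 0 ρ θ • v) with hG
  set G' : E → ℝ → E →L[ℂ] F := fun x θ => k θ • fderiv ℂ f (x + circleMap 0 ρ θ • v) with hG'
  have hGc : ∀ x ∈ ball x₀ r, Continuous (G x) := by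
    intro x hx
    refine hkc.smul (hf.continuousOn.comp_continuous (by fun_prop) fun θ => ?_)
    exact h3s (hin x hx _ (hcm θ))
  have key : HasFDerivAt (fun x => ∫ θ in (0 : ℝ)..(2 * Real.pi), G x θ)
      (∫ θ in (0 : ℝ)..(2 * Real.pi), G' x₀ θ) x₀ := by
    refine intervalIntegral.hasFDerivAt_integral_of_dominated_of_fderiv_le
      (μ := MeasureTheory.volume) (F' := G') (bound := fun θ => ‖k θ‖ * (C / r))
      (ball_mem_nhds x₀ hr) ?_ ?_ ?_ ?_ ?_ ?_
    · filter_upwards [ball_mem_nhds x₀ hr] with x hx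
      exact (hGc x hx).aestronglyMeasurable
    · exact (hGc x₀ (mem_ball_self hr)).intervalIntegrable _ _
    · borelize E
      borelize F
      refine hkc.aestronglyMeasurable.smul ?_
      have h1 : Measurable fun θ : ℝ => x₀ + circleMap 0 ρ θ • v :=
        (by fun_prop : Continuous fun θ : ℝ => x₀ + circleMap 0 ρ θ • v).measurable
      exact ((measurable_fderiv ℂ f).comp h1).aestronglyMeasurable
    · refine Filter.Eventually.of_forall fun θ _ x hx => ?_
      rw [hG', norm_smul]
      gcongr
      exact hbd _ (hin x hx _ (hcm θ))
    · exact (by fun_prop : Continuous fun θ => ‖k θ‖ * (C / r)).intervalIntegrable _ _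
    · refine Filter.Eventually.of_forall fun θ _ x hx => ?_
      have hy := h3s (hin x hx _ (hcm θ))
      have h1 : HasFDerivAt f (fderiv ℂ f (x + circleMap 0 ρ θ • v))
          (x + circleMap 0 ρ θ • v) :=
        ((hf _ hy).differentiableAt (hs.mem_nhds hy)).hasFDerivAt
      have h2 : HasFDerivAt (fun x => x + circleMap 0 ρ θ • v) (ContinuousLinearMap.id ℂ E) x :=
        (hasFDerivAt_id x).add_const _
      have h3 := (h1.comp x h2).const_smul (k θ)
      rw [ContinuousLinearMap.comp_id] at h3
      exact h3
  have hrep : ∀ x ∈ ball x₀ r, fderiv ℂ f x v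
      = (2 * Real.pi * Complex.I : ℂ)⁻¹ • ∫ θ in (0 : ℝ)..(2 * Real.pi), G x θ := by
    intro x hx
    have hxs : x ∈ s := h3s (ball_subset_ball (by linarith) hx)
    have hd : DifferentiableOn ℂ (fun c : ℂ => f (x + c • v)) (closedBall 0 ρ) :=
      differentiableOn_comp_line hf x v fun c hc => h3s (hin x hx c hc)
    have := (hd.diffContOnCl_ball subset_rfl).deriv_eq_smul_circleIntegral hρ
    rw [deriv_line_eq_fderiv ((hf x hxs).differentiableAt (hs.mem_nhds hxs))] at this
    rw [eq_inv_smul_iff₀ (by simp [Real.pi_ne_zero]), ← this, circleIntegral]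
    simp only [hG, hk, smul_smul]
  exact ((key.differentiableAt.const_smul _).congr_of_eventuallyEq
    (Filter.eventuallyEq_of_mem (ball_mem_nhds x₀ hr) hrep))

theorem contDiffOn_infty_of_differentiableOn {f : E → F} {s : Set E} (hs : IsOpen s)
    (hf : DifferentiableOn ℂ f s) : ContDiffOn ℂ ∞ f s := by
  rw [contDiffOn_infty]
  intro m
  induction m generalizing f with
  | zero => exact contDiffOn_zero.2 hf.continuousOn
  | succ m ih =>
    push_cast
    refine contDiffOn_succ_of_fderiv_apply hf (by simp) fun v => ?_
    exact (ih (differentiableOn_fderiv_apply hs hf v)).congr fun x hx => by rw [fderivWithin_of_isOpen hs hx]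

end Holomorphic

/-! ### Killing fields of a Riemannian metric on an open subset of a vector space -/

section Killing

open Metric

variable {E : Type*} [NormedAddCommGroup E] [NormedSpace ℝ E]

/-- `X` is a smooth Killing field on `s` of the metric `h`. -/
def KillingOn (h : E → E →L[ℝ] E →L[ℝ] ℝ) (s : Set E) (X : E → E) : Prop :=
  ContDiffOn ℝ ∞ X s ∧ ∀ q ∈ s, ∀ v w,
    fderiv ℝ h q (X q) v w + h q (fderiv ℝ X q v) w + h q v (fderiv ℝ X q w) = 0

/-- `h` is a smooth Riemannian metric on the open set `s`. -/
structure RiemannianOn (h : E → E →L[ℝ] E →L[ℝ] ℝ) (s : Set E) : Prop where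
  isOpen : IsOpen s
  contDiffOn : ContDiffOn ℝ ∞ h s
  symm : ∀ x ∈ s, ∀ v w, h x v w = h x w v
  pos : ∀ x ∈ s, ∀ v, v ≠ 0 → 0 < h x v v

/-- `σ` is an involutive isometry of `s`. -/
structure IsometricInvolutionOn (h : E → E →L[ℝ] E →L[ℝ] ℝ) (s : Set E) (σ : E → E) : Prop where
  mapsTo : Set.MapsTo σ s s
  contDiffOn : ContDiffOn ℝ ∞ σ s
  involutive : ∀ x ∈ s, σ (σ x) = x
  isometric : ∀ x ∈ s, ∀ v w, h (σ x) (fderiv ℝ σ x v) (fderiv ℝ σ x w) = h x v w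

variable {h : E → E →L[ℝ] E →L[ℝ] ℝ} {s : Set E}

section smooth

theorem two_le_infty : (2 : ℕ∞ω) ≤ ∞ := WithTop.coe_le_coe.2 (le_top : (2 : ℕ∞) ≤ ⊤)

variable {F : Type*} [NormedAddCommGroup F] [NormedSpace ℝ F] {f : E → F}

theorem ContDiffOn.hasFDerivAt_of_isOpen (hf : ContDiffOn ℝ ∞ f s) (hs : IsOpen s) {x : E}
    (hx : x ∈ s) : HasFDerivAt f (fderiv ℝ f x) x :=
  ((hf.contDiffAt (hs.mem_nhds hx)).differentiableAt (by simp)).hasFDerivAt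

theorem ContDiffOn.fderiv_infty (hf : ContDiffOn ℝ ∞ f s) (hs : IsOpen s) :
    ContDiffOn ℝ ∞ (fderiv ℝ f) s :=
  hf.fderiv_of_isOpen hs (by simp)

theorem ContDiffOn.fderiv_fderiv_comm (hf : ContDiffOn ℝ ∞ f s) (hs : IsOpen s) {x : E}
    (hx : x ∈ s) (u v : E) :
    fderiv ℝ (fderiv ℝ f) x u v = fderiv ℝ (fderiv ℝ f) x v u :=
  (hf.contDiffAt (hs.mem_nhds hx)).isSymmSndFDerivAt
    (minSmoothness_of_isRCLikeNormedField.trans_le two_le_infty) u v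

end smooth

theorem HasFDerivAt.bilin_apply {h : E → E →L[ℝ] E →L[ℝ] ℝ} {h' : E →L[ℝ] E →L[ℝ] E →L[ℝ] ℝ}
    {A B : E → E} {A' B' : E →L[ℝ] E} {x : E} (hh : HasFDerivAt h h' x)
    (hA : HasFDerivAt A A' x) (hB : HasFDerivAt B B' x) (u : E) :
    HasLineDerivAt ℝ (fun y => h y (A y) (B y))
      (h' u (A x) (B x) + h x (A' u) (B x) + h x (A x) (B' u)) x u := by
  have := ((hh.clm_apply hA).clm_apply hB).hasLineDerivAt u
  convert this using 1
  simp
  ring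

/-- The device by which identities valid on an open set, such as the Killing equation, the isometry
condition or the Legendre condition, are differentiated. -/
theorem HasLineDerivAt.eq_of_eqOn {F : Type*} [NormedAddCommGroup F] [NormedSpace ℝ F]
    {f g : E → F} {f' g' : F} {x u : E}
    (hs : IsOpen s) (hx : x ∈ s) (hfg : ∀ y ∈ s, f y = g y)
    (hf : HasLineDerivAt ℝ f f' x u) (hg : HasLineDerivAt ℝ g g' x u) : f' = g' := by
  refine HasLineDerivAt.unique hf (hg.congr_of_eventuallyEq ?_)
  exact Filter.eventuallyEq_of_mem (hs.mem_nhds hx) hfg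

theorem fderiv_metric_symm (H : RiemannianOn h s) {x : E} (hx : x ∈ s) (u v w : E) :
    fderiv ℝ h x u v w = fderiv ℝ h x u w v := by
  have h1 := H.contDiffOn.hasFDerivAt_of_isOpen H.isOpen hx
  have a := h1.bilin_apply (hasFDerivAt_const v x) (hasFDerivAt_const w x) u
  have b := h1.bilin_apply (hasFDerivAt_const w x) (hasFDerivAt_const v x) u
  simpa using HasLineDerivAt.eq_of_eqOn H.isOpen hx (fun y hy => H.symm y hy v w) a b

namespace KillingOn

theorem add {X Y : E → E} (hs : IsOpen s) (hX : KillingOn h s X) (hY : KillingOn h s Y) :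
    KillingOn h s (X + Y) := by
  refine ⟨hX.1.add hY.1, fun q hq v w => ?_⟩
  have := ((hX.1.hasFDerivAt_of_isOpen hs hq).add (hY.1.hasFDerivAt_of_isOpen hs hq)).fderiv
  rw [this]
  simp only [Pi.add_apply, map_add, _root_.add_apply]
  linarith [hX.2 q hq v w, hY.2 q hq v w]

theorem const_smul {X : E → E} (hs : IsOpen s) (c : ℝ) (hX : KillingOn h s X) :
    KillingOn h s (c • X) := by
  refine ⟨hX.1.const_smul c, fun q hq v w => ?_⟩
  have := ((hX.1.hasFDerivAt_of_isOpen hs hq).const_smul c).fderiv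
  rw [this]
  simp only [Pi.smul_apply, map_smul, _root_.smul_apply, smul_eq_mul]
  linear_combination c * hX.2 q hq v w

/-- The differentiated Killing equation. -/
theorem fderiv_eq {X : E → E} (hs : IsOpen s) (hh : ContDiffOn ℝ ∞ h s) (hX : KillingOn h s X)
    {q : E} (hq : q ∈ s) (u v w : E) :
    fderiv ℝ (fderiv ℝ h) q u (X q) v w + fderiv ℝ h q (fderiv ℝ X q u) v w
      + fderiv ℝ h q u (fderiv ℝ X q v) w + fderiv ℝ h q u v (fderiv ℝ X q w)
      + h q (fderiv ℝ (fderiv ℝ X) q u v) w + h q v (fderiv ℝ (fderiv ℝ X) q u w) = 0 := by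
  have h0 := hh.hasFDerivAt_of_isOpen hs hq
  have h1 := (hh.fderiv_infty hs).hasFDerivAt_of_isOpen hs hq
  have x0 := hX.1.hasFDerivAt_of_isOpen hs hq
  have x1 := (hX.1.fderiv_infty hs).hasFDerivAt_of_isOpen hs hq
  have cst : ∀ a : E, HasFDerivAt (fun _ : E => a) (0 : E →L[ℝ] E) q :=
    fun a => hasFDerivAt_const a q
  have a1 := (((h1.clm_apply x0).clm_apply (cst v)).clm_apply (cst w)).hasLineDerivAt u
  have a2 := h0.bilin_apply (x1.clm_apply (cst v)) (cst w) u
  have a3 := h0.bilin_apply (cst v) (x1.clm_apply (cst w)) u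
  have := HasLineDerivAt.eq_of_eqOn hs hq (fun y hy => hX.2 y hy v w) ((a1.add a2).add a3)
    (hasFDerivAt_const (0 : ℝ) q |>.hasLineDerivAt u)
  simp at this
  linarith

/-- If `h` does not depend on the direction `e`, the derivative of a Killing field along `e` is
again a Killing field. -/
theorem fderiv_apply {X : E → E} (hs : IsOpen s) (hh : ContDiffOn ℝ ∞ h s) (hX : KillingOn h s X)
    {e : E} (he : ∀ x ∈ s, fderiv ℝ h x e = 0) : KillingOn h s (fun x => fderiv ℝ X x e) := by
  refine ⟨(hX.1.fderiv_infty hs).clm_apply contDiffOn_const, fun q hq v w => ?_⟩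
  have x1 := (hX.1.fderiv_infty hs).hasFDerivAt_of_isOpen hs hq
  have h1 := (hh.fderiv_infty hs).hasFDerivAt_of_isOpen hs hq
  have e1 := (x1.clm_apply (hasFDerivAt_const e q)).fderiv
  have e2 : fderiv ℝ (fderiv ℝ h) q (X q) e = 0 := by
    have a := (h1.clm_apply (hasFDerivAt_const e q)).hasLineDerivAt (X q)
    simpa using HasLineDerivAt.eq_of_eqOn hs hq he a
      (hasFDerivAt_const (0 : E →L[ℝ] E →L[ℝ] ℝ) q |>.hasLineDerivAt (X q))
  have key := hX.fderiv_eq hs hh hq e v w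
  rw [hh.fderiv_fderiv_comm hs hq e (X q), e2, he q hq,
    hX.1.fderiv_fderiv_comm hs hq e v, hX.1.fderiv_fderiv_comm hs hq e w] at key
  rw [e1]
  simpa using key

end KillingOn

/-- Koszul's trick: symmetry in the first two slots lets `T` be recovered from its symmetrization in
the last two, as a signed sum of three cyclic values. -/
theorem koszul_bound {V : Type*} [NormedAddCommGroup V] {T R : V → V → V → ℝ} (hT : ∀ u v w, T u v w = T v u w)
    (hR : ∀ u v w, T u v w + T u w v = R u v w) {M : ℝ}
    (hM : ∀ u v w, |R u v w| ≤ M * (‖u‖ * ‖v‖ * ‖w‖)) (u v w : V) :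
    2 * T u v w ≤ 3 * M * (‖u‖ * ‖v‖ * ‖w‖) := by
  have h1 := (abs_le.1 (hM u v w)).2
  have h2 := (abs_le.1 (hM v w u)).2
  have h3 := (abs_le.1 (hM w u v)).1
  have : 2 * T u v w = R u v w + R v w u - R w u v := by
    rw [← hR, ← hR, ← hR, hT v w u, hT w u v, hT v u w]; ring
  nlinarith

theorem RiemannianOn.exists_lower_bound [FiniteDimensional ℝ E] (H : RiemannianOn h s) {K : Set E}
    (hK : IsCompact K) (hKs : K ⊆ s) :
    ∃ c > 0, ∀ x ∈ K, ∀ y, c * ‖y‖ ^ 2 ≤ h x y y := by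
  have : ProperSpace E := FiniteDimensional.proper ℝ E
  have hc : ContinuousOn (fun z : E × E => h z.1 z.2 z.2) (K ×ˢ sphere 0 1) := by
    have h1 : ContinuousOn (fun z : E × E => h z.1) (K ×ˢ sphere 0 1) :=
      (H.contDiffOn.continuousOn.mono hKs).comp continuousOn_fst fun z hz => hz.1
    exact (h1.clm_apply continuousOn_snd).clm_apply continuousOn_snd
  obtain ⟨c, hc0, hc⟩ := (hK.prod (isCompact_sphere (0 : E) 1)).exists_forall_le' hc (a := 0)
    (fun z hz => H.pos z.1 (hKs hz.1) z.2 (by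
      rintro h0
      have := hz.2
      simp [h0] at this))
  refine ⟨c, hc0, fun x hx y => ?_⟩
  rcases eq_or_ne y 0 with rfl | hy
  · simp
  have hy' : 0 < ‖y‖ := norm_pos_iff.2 hy
  have := hc (x, ‖y‖⁻¹ • y) ⟨hx, by simp [norm_smul, hy'.ne']⟩
  simp only [map_smul, _root_.smul_apply, smul_eq_mul] at this
  calc c * ‖y‖ ^ 2 ≤ (‖y‖⁻¹ * (‖y‖⁻¹ * h x y y)) * ‖y‖ ^ 2 := by gcongr
    _ = h x y y := by field_simp

/-- The differentiated Killing equation expresses the symmetrization of h(D²X(u,v), w) in v, w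
through the 1-jet of X, and D²X is symmetric, so Koszul's trick applies. Four terms of size B · N
and the factor 3/2 produce the constant 6B. -/
theorem KillingOn.norm_fderiv_fderiv_le {X : E → E} (H : RiemannianOn h s) (hX : KillingOn h s X)
    {q : E} (hq : q ∈ s) {B c : ℝ} (hB : 0 ≤ B) (h1 : ‖fderiv ℝ h q‖ ≤ B)
    (h2 : ‖fderiv ℝ (fderiv ℝ h) q‖ ≤ B) (hc : 0 < c) (hlow : ∀ y, c * ‖y‖ ^ 2 ≤ h q y y) (u : E) :
    ‖fderiv ℝ (fderiv ℝ X) q u‖ ≤ 6 * B / c * ‖(X q, fderiv ℝ X q)‖ * ‖u‖ := by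
  set N := ‖(X q, fderiv ℝ X q)‖ with hN
  have hN0 : 0 ≤ N := norm_nonneg _
  have n0 : ‖X q‖ ≤ N := norm_fst_le (X q, fderiv ℝ X q)
  have n1 : ‖fderiv ℝ X q‖ ≤ N := norm_snd_le (X q, fderiv ℝ X q)
  have t1 : ∀ a v w, |fderiv ℝ h q a v w| ≤ B * ‖a‖ * ‖v‖ * ‖w‖ := fun a v w =>
    ((fderiv ℝ h q a).le_opNorm₂ v w).trans (by
      gcongr
      exact (ContinuousLinearMap.le_opNorm _ _).trans (by gcongr))
  have t2 : ∀ u v w, |fderiv ℝ (fderiv ℝ h) q u (X q) v w| ≤ B * ‖u‖ * N * ‖v‖ * ‖w‖ :=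
    fun u v w => ((fderiv ℝ (fderiv ℝ h) q u (X q)).le_opNorm₂ v w).trans (by
      gcongr
      exact ((fderiv ℝ (fderiv ℝ h) q).le_opNorm₂ _ _).trans (by gcongr))
  have t3 : ∀ a, ‖fderiv ℝ X q a‖ ≤ N * ‖a‖ := fun a =>
    (ContinuousLinearMap.le_opNorm _ _).trans (by gcongr)
  have key := koszul_bound (T := fun u v w => h q (fderiv ℝ (fderiv ℝ X) q u v) w)
    (R := fun u v w => -(fderiv ℝ (fderiv ℝ h) q u (X q) v w + fderiv ℝ h q (fderiv ℝ X q u) v w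
      + fderiv ℝ h q u (fderiv ℝ X q v) w + fderiv ℝ h q u v (fderiv ℝ X q w)))
    (fun u v w => by rw [hX.1.fderiv_fderiv_comm H.isOpen hq])
    (fun u v w => by
      have := hX.fderiv_eq H.isOpen H.contDiffOn hq u v w
      rw [H.symm q hq _ v]
      linarith) (M := 4 * B * N) (fun u v w => by
      rw [abs_neg]
      have b1 := t2 u v w
      have b2 : |fderiv ℝ h q (fderiv ℝ X q u) v w| ≤ B * (N * ‖u‖) * ‖v‖ * ‖w‖ :=
        (t1 _ v w).trans (by gcongr; exact t3 u)
      have b3 : |fderiv ℝ h q u (fderiv ℝ X q v) w| ≤ B * ‖u‖ * (N * ‖v‖) * ‖w‖ :=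
        (t1 u _ w).trans (by gcongr; exact t3 v)
      have b4 : |fderiv ℝ h q u v (fderiv ℝ X q w)| ≤ B * ‖u‖ * ‖v‖ * (N * ‖w‖) :=
        (t1 u v _).trans (by gcongr; exact t3 w)
      refine (abs_add_le _ _).trans ((add_le_add_left ((abs_add_le _ _).trans
        (add_le_add_left (abs_add_le _ _) _)) _).trans ?_)
      linarith)
  refine ContinuousLinearMap.opNorm_le_bound _ (by positivity) fun v => ?_
  -- Testing against the vector itself, so that the lower bound on the metric bounds its norm.
  set y := fderiv ℝ (fderiv ℝ X) q u v with hy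
  rcases eq_or_ne y 0 with h0 | h0
  · rw [h0, norm_zero]; positivity
  have hy0 : 0 < ‖y‖ := norm_pos_iff.2 h0
  have k1 := key u v y
  have k2 := hlow y
  simp only [← hy] at k1
  have k3 : c * ‖y‖ * ‖y‖ ≤ (6 * B * N * ‖u‖ * ‖v‖) * ‖y‖ := by nlinarith
  have k4 := le_of_mul_le_mul_right k3 hy0
  rw [show 6 * B / c * N * ‖u‖ * ‖v‖ = (6 * B * N * ‖u‖ * ‖v‖) / c by ring, le_div_iff₀ hc]
  linarith

/-- A Killing field on a connected open set is determined by its 1-jet at a point. -/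
theorem KillingOn.eq_zero_of_jet_eq_zero [FiniteDimensional ℝ E] {X : E → E}
    (H : RiemannianOn h s) (hconn : IsPreconnected s) (hX : KillingOn h s X) {p : E} (hp : p ∈ s)
    (h0 : X p = 0) (h1 : fderiv ℝ X p = 0) : ∀ x ∈ s, X x = 0 := by
  have : ProperSpace E := FiniteDimensional.proper ℝ E
  set Z : Set E := {x | x ∈ s ∧ (X x, fderiv ℝ X x) = 0} with hZ
  have hXc := hX.1.continuousOn
  have hX1 := hX.1.fderiv_infty H.isOpen
  have hh1 := H.contDiffOn.fderiv_infty H.isOpen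
  suffices hsub : s ⊆ Z from fun x hx => (Prod.mk_eq_zero.1 (hsub hx).2).1
  refine hconn.subset_of_closure_inter_subset ?_ ⟨p, hp, hp, by simp [h0, h1]⟩ ?_
  -- Openness of the zero set of the jet: along a segment from `x₀` the jet satisfies a linear
  -- differential inequality with zero initial value, so Grönwall's lemma applies.
  · rw [Metric.isOpen_iff]
    rintro x₀ ⟨hx₀, hz⟩
    obtain ⟨R, hR, hRs⟩ := Metric.isOpen_iff.1 H.isOpen x₀ hx₀
    have hsub : closedBall x₀ (R / 2) ⊆ s := (closedBall_subset_ball (by linarith)).trans hRs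
    have hcpt := isCompact_closedBall x₀ (R / 2)
    obtain ⟨c, hc, hlow⟩ := H.exists_lower_bound hcpt hsub
    obtain ⟨B₁, hB₁⟩ := hcpt.exists_bound_of_continuousOn (hh1.continuousOn.mono hsub)
    obtain ⟨B₂, hB₂⟩ := hcpt.exists_bound_of_continuousOn
      ((hh1.fderiv_infty H.isOpen).continuousOn.mono hsub)
    set B := max B₁ B₂
    have hB : 0 ≤ B :=
      ((norm_nonneg _).trans (hB₁ x₀ (mem_closedBall_self (by positivity)))).trans (le_max_left _ _)
    refine ⟨R / 2, by positivity, fun x hx => ?_⟩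
    have hγ : ∀ t ∈ Set.Icc (0 : ℝ) 1, x₀ + t • (x - x₀) ∈ closedBall x₀ (R / 2) := by
      intro t ht
      rw [mem_closedBall, dist_self_add_left, norm_smul, Real.norm_of_nonneg ht.1]
      rw [mem_ball, dist_eq_norm] at hx
      nlinarith [norm_nonneg (x - x₀), ht.2]
    have hd : ∀ t ∈ Set.Icc (0 : ℝ) 1,
        HasDerivAt (fun t : ℝ => (X (x₀ + t • (x - x₀)), fderiv ℝ X (x₀ + t • (x - x₀))))
          (fderiv ℝ X (x₀ + t • (x - x₀)) (x - x₀),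
            fderiv ℝ (fderiv ℝ X) (x₀ + t • (x - x₀)) (x - x₀)) t := by
      intro t ht
      have hy := hsub (hγ t ht)
      have l : HasDerivAt (fun t : ℝ => x₀ + t • (x - x₀)) (x - x₀) t := by
        simpa using ((hasDerivAt_id t).smul_const (x - x₀)).const_add x₀
      exact ((hX.1.hasFDerivAt_of_isOpen H.isOpen hy).comp_hasDerivAt t l).prodMk
        ((hX1.hasFDerivAt_of_isOpen H.isOpen hy).comp_hasDerivAt t l)
    have := eq_zero_of_abs_deriv_le_mul_abs_self_of_eq_zero_right
      -- The two entries of the maximum bound the two components of the derivative of the jet: `1`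
      -- for that of `X`, the other for that of `fderiv ℝ X`.
      (K := max 1 (6 * B / c) * ‖x - x₀‖)
      (fun t ht => (hd t ht).continuousAt.continuousWithinAt)
      (fun t ht => (hd t ⟨ht.1, ht.2.le⟩).hasDerivWithinAt) (by simpa using hz)
      (fun t ht => by
        have ht' : t ∈ Set.Icc (0 : ℝ) 1 := ⟨ht.1, ht.2.le⟩
        have hb := hγ t ht'
        set y := x₀ + t • (x - x₀)
        have e2 := hX.norm_fderiv_fderiv_le H (hsub hb) hB ((hB₁ y hb).trans (le_max_left _ _))
          ((hB₂ y hb).trans (le_max_right _ _)) hc (hlow y hb) (x - x₀)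
        have e1 : ‖fderiv ℝ X y (x - x₀)‖ ≤ ‖(X y, fderiv ℝ X y)‖ * ‖x - x₀‖ :=
          (ContinuousLinearMap.le_opNorm _ _).trans
            (by gcongr; exact norm_snd_le (X y, fderiv ℝ X y))
        rw [Prod.norm_mk, max_le_iff]
        refine ⟨e1.trans ?_, e2.trans ?_⟩
        · have := le_max_left 1 (6 * B / c)
          have h3 : 0 ≤ ‖(X y, fderiv ℝ X y)‖ * ‖x - x₀‖ := by positivity
          nlinarith
        · rw [mul_right_comm _ ‖x - x₀‖]
          gcongr
          exact le_max_right _ _) 1 (by simp)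
    simp only [one_smul, add_sub_cancel] at this
    exact ⟨hRs (ball_subset_ball (by linarith) hx), this⟩
  · rintro x ⟨hxc, hxs⟩
    refine ⟨hxs, ?_⟩
    have hcont : ContinuousAt (fun x => (X x, fderiv ℝ X x)) x :=
      ((hXc.prodMk hX1.continuousOn).continuousAt (H.isOpen.mem_nhds hxs))
    have hcl : IsClosed ({0} : Set (E × (E →L[ℝ] E))) := isClosed_singleton
    exact hcl.mem_of_frequently_of_tendsto
      ((mem_closure_iff_frequently.1 hxc).mono fun y hy => hy.2) hcont

end Killing

/-! ### Reflecting Killing fields at the fixed point of a symmetry -/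

section Involution

open VectorField

variable {E : Type*} [NormedAddCommGroup E] [NormedSpace ℝ E]
  {h : E → E →L[ℝ] E →L[ℝ] ℝ} {s : Set E} {σ : E → E}

namespace IsometricInvolutionOn

theorem fderiv_comp_fderiv (hs : IsOpen s) (I : IsometricInvolutionOn h s σ) {x : E} (hx : x ∈ s)
    (v : E) : fderiv ℝ σ (σ x) (fderiv ℝ σ x v) = v := by
  have h1 := I.contDiffOn.hasFDerivAt_of_isOpen hs hx
  have h2 := I.contDiffOn.hasFDerivAt_of_isOpen hs (I.mapsTo hx)
  simpa using HasLineDerivAt.eq_of_eqOn hs hx I.involutive ((h2.comp x h1).hasLineDerivAt v)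
    ((hasFDerivAt_id x).hasLineDerivAt v)

theorem fderiv_comp_fderiv' (hs : IsOpen s) (I : IsometricInvolutionOn h s σ) {x : E} (hx : x ∈ s)
    (v : E) : fderiv ℝ σ x (fderiv ℝ σ (σ x) v) = v := by
  simpa [I.involutive x hx] using I.fderiv_comp_fderiv hs (I.mapsTo hx) v

/-- For an involution, the inverse of dσ at `x` that occurs in `pullback` is dσ at `σ x`. -/
theorem pullback_eq (hs : IsOpen s) (I : IsometricInvolutionOn h s σ) (X : E → E) {x : E}
    (hx : x ∈ s) : pullback ℝ σ X x = fderiv ℝ σ (σ x) (X (σ x)) := by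
  rw [pullback, ContinuousLinearMap.inverse_eq (g := fderiv ℝ σ (σ x))]
  · ext v; exact I.fderiv_comp_fderiv' hs hx v
  · ext v; exact I.fderiv_comp_fderiv hs hx v

theorem contDiffOn_pullback (hs : IsOpen s) (I : IsometricInvolutionOn h s σ) {X : E → E}
    (hX : ContDiffOn ℝ ∞ X s) : ContDiffOn ℝ ∞ (pullback ℝ σ X) s := by
  have h1 := (I.contDiffOn.fderiv_infty hs).comp I.contDiffOn I.mapsTo
  exact (h1.clm_apply (hX.comp I.contDiffOn I.mapsTo)).congr fun x hx => I.pullback_eq hs X hx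

/-- The derivative of the relation `dσ (σ^* X) = X ∘ σ`. -/
theorem fderiv_pullback (hs : IsOpen s) (I : IsometricInvolutionOn h s σ) {X : E → E}
    (hX : ContDiffOn ℝ ∞ X s) {x : E} (hx : x ∈ s) (u : E) :
    fderiv ℝ (fderiv ℝ σ) x u (pullback ℝ σ X x) + fderiv ℝ σ x (fderiv ℝ (pullback ℝ σ X) x u)
      = fderiv ℝ X (σ x) (fderiv ℝ σ x u) := by
  have s0 := I.contDiffOn.hasFDerivAt_of_isOpen hs hx
  have s1 := (I.contDiffOn.fderiv_infty hs).hasFDerivAt_of_isOpen hs hx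
  have y0 := (I.contDiffOn_pullback hs hX).hasFDerivAt_of_isOpen hs hx
  have x0 := hX.hasFDerivAt_of_isOpen hs (I.mapsTo hx)
  have := HasLineDerivAt.eq_of_eqOn hs hx (fun y hy => by
    rw [I.pullback_eq hs X hy]; exact I.fderiv_comp_fderiv' hs hy (X (σ y)))
    ((s1.clm_apply y0).hasLineDerivAt u) ((x0.comp x s0).hasLineDerivAt u)
  simp at this
  rw [← this, add_comm]

/-- The derivative of the isometry condition. -/
theorem fderiv_isometric (H : RiemannianOn h s) (I : IsometricInvolutionOn h s σ) {x : E}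
    (hx : x ∈ s) (u v w : E) :
    fderiv ℝ h (σ x) (fderiv ℝ σ x u) (fderiv ℝ σ x v) (fderiv ℝ σ x w)
      + h (σ x) (fderiv ℝ (fderiv ℝ σ) x u v) (fderiv ℝ σ x w)
      + h (σ x) (fderiv ℝ σ x v) (fderiv ℝ (fderiv ℝ σ) x u w) = fderiv ℝ h x u v w := by
  have hs := H.isOpen
  have s0 := I.contDiffOn.hasFDerivAt_of_isOpen hs hx
  have s1 := (I.contDiffOn.fderiv_infty hs).hasFDerivAt_of_isOpen hs hx
  have h0 := H.contDiffOn.hasFDerivAt_of_isOpen hs hx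
  have h1 := H.contDiffOn.hasFDerivAt_of_isOpen hs (I.mapsTo hx)
  have cst : ∀ a : E, HasFDerivAt (fun _ : E => a) (0 : E →L[ℝ] E) x :=
    fun a => hasFDerivAt_const a x
  have a1 := (h1.comp x s0).bilin_apply (s1.clm_apply (cst v)) (s1.clm_apply (cst w)) u
  have a2 := h0.bilin_apply (cst v) (cst w) u
  have := HasLineDerivAt.eq_of_eqOn hs hx (fun y hy => I.isometric y hy v w) a1 a2
  simpa using this

/-- The Killing equation for `X` at `σ x`, on vectors pushed forward by dσ, combines with the
differentiated isometry condition; symmetry of D²σ makes its contributions match. -/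
theorem killingOn_pullback (H : RiemannianOn h s) (I : IsometricInvolutionOn h s σ) {X : E → E}
    (hX : KillingOn h s X) : KillingOn h s (pullback ℝ σ X) := by
  have hs := H.isOpen
  refine ⟨I.contDiffOn_pullback hs hX.1, fun x hx v w => ?_⟩
  have e0 : fderiv ℝ σ x (pullback ℝ σ X x) = X (σ x) := by
    rw [I.pullback_eq hs X hx]; exact I.fderiv_comp_fderiv' hs hx _
  have e1 := I.fderiv_isometric H hx (pullback ℝ σ X x) v w
  have ev := I.fderiv_pullback hs hX.1 hx v
  have ew := I.fderiv_pullback hs hX.1 hx w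
  have k := hX.2 (σ x) (I.mapsTo hx) (fderiv ℝ σ x v) (fderiv ℝ σ x w)
  rw [← I.isometric x hx _ w, ← I.isometric x hx v, ← e1]
  rw [← ev, ← ew] at k
  rw [I.contDiffOn.fderiv_fderiv_comm hs hx _ v, I.contDiffOn.fderiv_fderiv_comm hs hx _ w, e0]
  simp only [map_add, _root_.add_apply] at k
  linarith

variable {p : E}

/-- At a fixed point where `dσ = -1`, the second derivative of `σ` is minus twice the
Levi-Civita connection. -/
theorem fderiv_fderiv_at_fixed (H : RiemannianOn h s) (I : IsometricInvolutionOn h s σ) (hp : p ∈ s)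
    (hfix : σ p = p) (hd : ∀ v, fderiv ℝ σ p v = -v) (u v w : E) :
    h p (fderiv ℝ (fderiv ℝ σ) p u v) w
      = fderiv ℝ h p w u v - fderiv ℝ h p u v w - fderiv ℝ h p v w u := by
  have k := fun u v w => I.fderiv_isometric H hp u v w
  simp only [hfix, hd, map_neg, _root_.neg_apply, neg_neg] at k
  -- With dσ = −1 the differentiated isometry condition reads h(D²σ(u,v), w) + h(v, D²σ(u,w)) = −2
  -- (D_u h)(v,w). Three cyclic copies solve it, as in the Koszul formula.
  have k1 := k u v w
  have k2 := k v w u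
  have k3 := k w u v
  have c := fun u v => I.contDiffOn.fderiv_fderiv_comm H.isOpen hp u v
  rw [H.symm p hp v] at k1
  rw [H.symm p hp w, c v w, c v u] at k2
  rw [H.symm p hp u, c w u] at k3
  linarith

/-- The hypothesis `hclosed` says that the one-form h(X, ·) is closed at p. Since ∇X is skew for a
Killing field, this means ∇X = 0 at p. As D²σ = −2Γ there, σ^*X + X has derivative 2∇X at p, so its
1-jet vanishes. -/
theorem pullback_eq_neg [FiniteDimensional ℝ E] (H : RiemannianOn h s) (hconn : IsPreconnected s)
    (I : IsometricInvolutionOn h s σ) (hp : p ∈ s)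
    (hfix : σ p = p) (hd : ∀ v, fderiv ℝ σ p v = -v) {X : E → E} (hX : KillingOn h s X)
    (hclosed : ∀ v w, h p (fderiv ℝ X p v) w - h p v (fderiv ℝ X p w)
      + fderiv ℝ h p v (X p) w - fderiv ℝ h p w (X p) v = 0) :
    ∀ x ∈ s, pullback ℝ σ X x = -X x := by
  have hs := H.isOpen
  have hY := I.killingOn_pullback H hX
  have e0 : pullback ℝ σ X p = -X p := by rw [I.pullback_eq hs X hp, hfix, hd]
  have hW := hY.add hs hX
  have e1 := fun v => I.fderiv_pullback hs hX.1 hp v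
  simp only [hfix, hd, e0, map_neg] at e1
  have d := ((hY.1.hasFDerivAt_of_isOpen hs hp).add (hX.1.hasFDerivAt_of_isOpen hs hp)).fderiv
  have := hW.eq_zero_of_jet_eq_zero H hconn hp (by simp [e0]) (by
    ext u
    by_contra hne
    have pos := H.pos p hp _ hne
    set w := fderiv ℝ (pullback ℝ σ X + X) p u with hw
    have hwe : w = (2 : ℝ) • fderiv ℝ X p u - fderiv ℝ (fderiv ℝ σ) p u (X p) := by
      rw [hw, d, _root_.add_apply, two_smul]
      have := e1 u
      have : fderiv ℝ (pullback ℝ σ X) p u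
          = fderiv ℝ X p u - fderiv ℝ (fderiv ℝ σ) p u (X p) := by
        have h2 := congrArg Neg.neg this
        rw [neg_add, neg_neg, neg_neg, neg_neg] at h2
        rw [← h2]; abel
      rw [this]; abel
    refine absurd ?_ pos.ne'
    nth_rewrite 1 [hwe]
    rw [map_sub, map_smul, _root_.sub_apply, _root_.smul_apply, smul_eq_mul,
      I.fderiv_fderiv_at_fixed H hp hfix hd]
    have c := hclosed u w
    have k := hX.2 p hp w u
    rw [H.symm p hp u] at c
    have f1 := fderiv_metric_symm H hp w (X p) u
    have f2 := fderiv_metric_symm H hp (X p) w u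
    have f3 := H.symm p hp w (fderiv ℝ X p u)
    linarith)
  intro x hx
  exact eq_neg_of_add_eq_zero_left (this x hx)

/-- Once X vanishes at p, conjugating DX by dσ = −1 leaves it unchanged, while σ^*X = −X reverses
it. So DX = 0 at p and the 1-jet vanishes. -/
theorem eq_zero_of_pullback_eq_neg [FiniteDimensional ℝ E] (H : RiemannianOn h s)
    (hconn : IsPreconnected s) (I : IsometricInvolutionOn h s σ) (hp : p ∈ s)
    (hfix : σ p = p) (hd : ∀ v, fderiv ℝ σ p v = -v) {X : E → E} (hX : KillingOn h s X)
    (h0 : X p = 0) (hneg : ∀ x ∈ s, pullback ℝ σ X x = -X x) : ∀ x ∈ s, X x = 0 := by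
  refine hX.eq_zero_of_jet_eq_zero H hconn hp h0 ?_
  ext u
  have e1 := I.fderiv_pullback H.isOpen hX.1 hp u
  have e2 : fderiv ℝ (pullback ℝ σ X) p u = -fderiv ℝ X p u := by
    have y0 := (I.contDiffOn_pullback H.isOpen hX.1).hasFDerivAt_of_isOpen H.isOpen hp
    have x0 := hX.1.hasFDerivAt_of_isOpen H.isOpen hp
    simpa using HasLineDerivAt.eq_of_eqOn H.isOpen hp hneg (y0.hasLineDerivAt u)
      (x0.neg.hasLineDerivAt u)
  simp only [e2, hneg p hp, h0, hfix, hd, map_neg, map_zero, neg_zero, zero_add, neg_neg] at e1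
  have e3 : (2 : ℝ) • fderiv ℝ X p u = 0 := by
    rw [two_smul]
    nth_rewrite 1 [e1]
    simp
  simpa using e3

/-- Reflecting a Killing field `e` of weight one under a transvection `L₀` at the fixed point of the
involution yields a field of weight minus one. -/
theorem exists_lowering [FiniteDimensional ℝ E] (H : RiemannianOn h s)
    (hconn : IsPreconnected s) (I : IsometricInvolutionOn h s σ) (hp : p ∈ s)
    (hfix : σ p = p) (hd : ∀ v, fderiv ℝ σ p v = -v) {e : E} (he : ∀ x ∈ s, fderiv ℝ h x e = 0)
    {L₀ : E → E} (hL₀ : KillingOn h s L₀)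
    (hclosed : ∀ v w, h p (fderiv ℝ L₀ p v) w - h p v (fderiv ℝ L₀ p w)
      + fderiv ℝ h p v (L₀ p) w - fderiv ℝ h p w (L₀ p) v = 0)
    (hweight : ∀ x ∈ s, lieBracket ℝ L₀ (fun _ => e) x = e)
    (hgrad : ∀ w, fderiv ℝ h p w e e = 2 * h p (L₀ p) w) :
    ∃ L : E → E, KillingOn h s L ∧ (∀ q ∈ s, lieBracket ℝ L₀ L q = -L q) ∧
      ∀ q ∈ s, lieBracket ℝ (fun _ => e) L q = (2 : ℝ) • L₀ q := by
  have hs := H.isOpen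
  set c : E → E := fun _ => e with hc
  have hck : KillingOn h s c := ⟨contDiffOn_const, fun q hq v w => by simp [hc, he q hq]⟩
  -- The reflected raising field; the lowering field will be `-X`.
  set X := pullback ℝ σ c with hX
  have hXk : KillingOn h s X := I.killingOn_pullback H hck
  have hXd : ∀ x ∈ s, DifferentiableAt ℝ X x :=
    fun x hx => (hXk.1.hasFDerivAt_of_isOpen hs hx).differentiableAt
  have hLd : ∀ x ∈ s, DifferentiableAt ℝ L₀ x :=
    fun x hx => (hL₀.1.hasFDerivAt_of_isOpen hs hx).differentiableAt
  have hinv : ∀ x ∈ s, pullback ℝ σ X x = e := by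
    intro x hx
    rw [I.pullback_eq hs X hx, hX, I.pullback_eq hs c (I.mapsTo hx), I.involutive x hx]
    exact I.fderiv_comp_fderiv hs hx e
  have hL₀neg := I.pullback_eq_neg H hconn hp hfix hd hL₀ hclosed
  have hsm : ∀ x ∈ s, ContDiffAt ℝ ∞ σ x := fun x hx => I.contDiffOn.contDiffAt (hs.mem_nhds hx)
  have hmin : minSmoothness ℝ 2 ≤ (∞ : ℕ∞ω) :=
    minSmoothness_of_isRCLikeNormedField.trans_le two_le_infty
  have nb : ∀ {x} (_ : x ∈ s) {f g : E → E}, (∀ y ∈ s, f y = g y) → f =ᶠ[nhds x] g :=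
    fun hx _ _ hfg => Filter.eventuallyEq_of_mem (hs.mem_nhds hx) hfg
  have b0 : ∀ x ∈ s, lieBracket ℝ L₀ X x = -X x := by
    intro x hx
    have h1 := pullback_lieBracket (V := L₀) (W := c) hmin (hsm x hx) (hLd _ (I.mapsTo hx))
      (differentiableAt_const e)
    have h2 : pullback ℝ σ (lieBracket ℝ L₀ c) x = X x := by
      rw [I.pullback_eq hs _ hx, hweight _ (I.mapsTo hx), hX, I.pullback_eq hs _ hx]
    have h3 := (nb hx hL₀neg).lieBracket_vectorField_eq (Filter.EventuallyEq.refl _ X) (𝕜 := ℝ)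
    rw [h2, h3] at h1
    rw [h1]
    simp [lieBracket_eq, fderiv_fun_neg]
    abel
  -- Since `e` is constant, the first summand is [e, X]. The field vanishes at p by `hgrad`, and σ
  -- reverses it because σ exchanges e with X and reverses L₀; hence it is zero.
  set Y : E → E := (fun x => fderiv ℝ X x e) + (2 : ℝ) • L₀ with hYdef
  have hY : KillingOn h s Y :=
    (hXk.fderiv_apply hs H.contDiffOn he).add hs (hL₀.const_smul hs 2)
  have hbr : lieBracket ℝ c X = fun x => fderiv ℝ X x e := by
    ext x; simp [lieBracket_eq, hc]
  have hY0 : Y p = 0 := by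
    by_contra hne
    have hXp : fderiv ℝ X p e = -fderiv ℝ (fderiv ℝ σ) p e e := by
      have e1 := I.fderiv_pullback hs hck.1 hp e
      rw [← hX, hd] at e1
      have : X p = -e := by rw [hX, I.pullback_eq hs c hp, hfix, hd]
      rw [this] at e1
      simp only [hc, fderiv_fun_const, map_neg, Pi.zero_apply, _root_.zero_apply] at e1
      have e2 := congrArg Neg.neg e1
      rw [neg_add, neg_neg, neg_neg, neg_zero] at e2
      exact eq_neg_of_add_eq_zero_right e2
    have pos := H.pos p hp _ hne
    refine absurd ?_ pos.ne'
    have : Y p = (2 : ℝ) • L₀ p - fderiv ℝ (fderiv ℝ σ) p e e := by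
      simp only [hYdef, Pi.add_apply, Pi.smul_apply, hXp]; abel
    nth_rewrite 1 [this]
    rw [map_sub, map_smul, _root_.sub_apply, _root_.smul_apply, smul_eq_mul,
      I.fderiv_fderiv_at_fixed H hp hfix hd, hgrad, fderiv_metric_symm H hp e _ e, he p hp]
    simp
  have hYneg : ∀ x ∈ s, pullback ℝ σ Y x = -Y x := by
    intro x hx
    have h1 := pullback_lieBracket (V := c) (W := X) hmin (hsm x hx) (differentiableAt_const e)
      (hXd _ (I.mapsTo hx))
    have h3 := (Filter.EventuallyEq.refl (nhds x) X).lieBracket_vectorField_eq (nb hx hinv)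
      (𝕜 := ℝ)
    rw [hbr, h3] at h1
    have h4 : lieBracket ℝ X (fun _ => e) x = -fderiv ℝ X x e := by simp [lieBracket_eq]
    have h5 : pullback ℝ σ Y x
        = pullback ℝ σ (fun x => fderiv ℝ X x e) x + (2 : ℝ) • pullback ℝ σ L₀ x := by
      simp [pullback, hYdef]
    rw [h5, h1, h4, hL₀neg x hx]
    simp [hYdef]
    abel
  have hYz := I.eq_zero_of_pullback_eq_neg H hconn hp hfix hd hY hY0 hYneg
  refine ⟨(-1 : ℝ) • X, hXk.const_smul hs _, fun q hq => ?_, fun q hq => ?_⟩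
  · rw [lieBracket_const_smul_right (hXd q hq), b0 q hq]; simp
  · rw [lieBracket_const_smul_right (hXd q hq), hbr]
    have := hYz q hq
    simp only [hYdef, Pi.add_apply, Pi.smul_apply] at this
    simp [eq_neg_of_add_eq_zero_left this]

end IsometricInvolutionOn

end Involution

namespace CMap

variable {n : ℕ}

/-! ### The symplectic and the Hermitian product -/

theorem symp_eq {R : Type} [CommRing R] (A B : SympIdx n → R) :
    symp A B = ∑ i, (A (Sum.inl i) * B (Sum.inr i) - A (Sum.inr i) * B (Sum.inl i)) := by
  simp only [symp, sympC, dotProduct, Matrix.mulVec, Fintype.sum_sum_type, Matrix.fromBlocks_apply₁₁,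
    Matrix.fromBlocks_apply₁₂, Matrix.fromBlocks_apply₂₁, Matrix.fromBlocks_apply₂₂,
    Matrix.zero_apply, Matrix.neg_apply, Matrix.one_apply]
  simp [Finset.sum_add_distrib, sub_eq_add_neg]

section

variable {R : Type} [CommRing R] (A B C : SympIdx n → R) (c : R)

theorem symp_add_left : symp (A + B) C = symp A C + symp B C := by
  simp only [symp_eq, ← Finset.sum_add_distrib, Pi.add_apply]
  exact Finset.sum_congr rfl fun i _ => by ring

theorem symp_add_right : symp A (B + C) = symp A B + symp A C := by
  simp only [symp_eq, ← Finset.sum_add_distrib, Pi.add_apply]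
  exact Finset.sum_congr rfl fun i _ => by ring

theorem symp_smul_left : symp (c • A) B = c * symp A B := by
  simp only [symp_eq, Finset.mul_sum, Pi.smul_apply, smul_eq_mul]
  exact Finset.sum_congr rfl fun i _ => by ring

theorem symp_smul_right : symp A (c • B) = c * symp A B := by
  simp only [symp_eq, Finset.mul_sum, Pi.smul_apply, smul_eq_mul]
  exact Finset.sum_congr rfl fun i _ => by ring

theorem symp_swap : symp A B = -symp B A := by
  simp only [symp_eq, ← Finset.sum_neg_distrib]
  exact Finset.sum_congr rfl fun i _ => by ring

@[simp] theorem symp_zero_left : symp (0 : SympIdx n → R) B = 0 := by simp [symp_eq]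

@[simp] theorem symp_zero_right : symp A (0 : SympIdx n → R) = 0 := by simp [symp_eq]

end

/-- The Hermitian product `i ⟨A | B̄⟩`. -/
noncomputable def herm (A B : SympIdx n → ℂ) : ℂ :=
  Complex.I * symp A (fun α => conj (B α))

section

variable (A B C : SympIdx n → ℂ) (c : ℂ)

theorem conj_symp : conj (symp A B) = symp (fun α => conj (A α)) (fun α => conj (B α)) := by
  simp [symp_eq]

theorem conj_herm : conj (herm A B) = herm B A := by
  rw [herm, herm, map_mul, conj_symp, symp_swap]
  simp

theorem herm_add_left : herm (A + B) C = herm A C + herm B C := by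
  simp only [herm, symp_add_left]; ring

theorem herm_smul_left : herm (c • A) B = c * herm A B := by
  simp only [herm, symp_smul_left]; ring

theorem herm_add_right : herm A (B + C) = herm A B + herm A C := by
  rw [← conj_herm, herm_add_left, map_add, conj_herm, conj_herm]

theorem herm_smul_right : herm A (c • B) = conj c * herm A B := by
  rw [← conj_herm, herm_smul_left, map_mul, conj_herm]

theorem herm_conj_right : herm A (fun α => conj (B α)) = Complex.I * symp A B := by
  simp [herm]

theorem symp_conj_right : symp A (fun α => conj (B α)) = -Complex.I * herm A B := by
  rw [herm, ← mul_assoc]; simp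

theorem herm_self_conj : herm (fun α => conj (A α)) (fun α => conj (A α)) = -herm A A := by
  rw [herm_conj_right, herm, symp_swap]; ring

theorem herm_self_eq_re : herm A A = ((herm A A).re : ℂ) :=
  (Complex.conj_eq_iff_re.1 (conj_herm A A)).symm

end

/-! ### Differentiating symplectic and Hermitian products -/

section derivatives

variable {E : Type*} [NormedAddCommGroup E] [NormedSpace ℝ E]

theorem _root_.HasLineDerivAt.symp {A B : E → SympIdx n → ℂ} {A' B' : SympIdx n → ℂ} {x v : E}
    (hA : HasLineDerivAt ℝ A A' x v) (hB : HasLineDerivAt ℝ B B' x v) :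
    HasLineDerivAt ℝ (fun y => symp (A y) (B y)) (symp A' (B x) + symp (A x) B') x v := by
  have a := hasDerivAt_pi.1 hA
  have b := hasDerivAt_pi.1 hB
  have := HasDerivAt.fun_sum (u := Finset.univ) fun i _ =>
    ((a (Sum.inl i)).mul (b (Sum.inr i))).sub ((a (Sum.inr i)).mul (b (Sum.inl i)))
  simp only [HasLineDerivAt, symp_eq]
  refine HasDerivAt.congr_deriv this ?_
  rw [← Finset.sum_add_distrib]
  refine Finset.sum_congr rfl fun i _ => ?_
  rw [zero_smul, add_zero]
  ring

theorem _root_.HasLineDerivAt.div_complex {f g : E → ℂ} {f' g' : ℂ} {x v : E}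
    (hf : HasLineDerivAt ℝ f f' x v) (hg : HasLineDerivAt ℝ g g' x v) (h0 : g x ≠ 0) :
    HasLineDerivAt ℝ (fun y => f y / g y) ((f' * g x - f x * g') / g x ^ 2) x v := by
  have := HasDerivAt.div hf hg (by simpa using h0)
  simp only [zero_smul, add_zero] at this
  exact this

theorem _root_.HasLineDerivAt.conj_pi {A : E → SympIdx n → ℂ} {A' : SympIdx n → ℂ} {x v : E}
    (hA : HasLineDerivAt ℝ A A' x v) :
    HasLineDerivAt ℝ (fun y α => conj (A y α)) (fun α => conj (A' α)) x v :=
  hasDerivAt_pi.2 fun α =>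
    (Complex.conjCLE.toContinuousLinearMap.hasFDerivAt.comp_hasDerivAt _ (hasDerivAt_pi.1 hA α))

theorem _root_.HasLineDerivAt.herm {A B : E → SympIdx n → ℂ} {A' B' : SympIdx n → ℂ} {x v : E}
    (hA : HasLineDerivAt ℝ A A' x v) (hB : HasLineDerivAt ℝ B B' x v) :
    HasLineDerivAt ℝ (fun y => herm (A y) (B y)) (herm A' (B x) + herm (A x) B') x v := by
  have := HasDerivAt.const_mul Complex.I (hA.symp hB.conj_pi)
  rw [mul_add] at this
  exact this

theorem _root_.ContDiffOn.symp {A B : E → SympIdx n → ℂ} {s : Set E}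
    (hA : ContDiffOn ℝ ∞ A s) (hB : ContDiffOn ℝ ∞ B s) :
    ContDiffOn ℝ ∞ (fun y => symp (A y) (B y)) s := by
  simp only [symp_eq]
  exact ContDiffOn.sum fun i _ => ((contDiffOn_pi.1 hA _).mul (contDiffOn_pi.1 hB _)).sub
    ((contDiffOn_pi.1 hA _).mul (contDiffOn_pi.1 hB _))

theorem _root_.ContDiffOn.conj {A : E → ℂ} {s : Set E} (hA : ContDiffOn ℝ ∞ A s) :
    ContDiffOn ℝ ∞ (fun y => conj (A y)) s :=
  Complex.conjCLE.contDiff.comp_contDiffOn hA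

theorem _root_.ContDiffOn.div_complex {f g : E → ℂ} {s : Set E} (hf : ContDiffOn ℝ ∞ f s)
    (hg : ContDiffOn ℝ ∞ g s) (h0 : ∀ x ∈ s, g x ≠ 0) : ContDiffOn ℝ ∞ (fun x => f x / g x) s := by
  simp only [div_eq_mul_inv]
  exact hf.mul (hg.inv h0)

theorem _root_.ContDiffOn.herm {A B : E → SympIdx n → ℂ} {s : Set E}
    (hA : ContDiffOn ℝ ∞ A s) (hB : ContDiffOn ℝ ∞ B s) :
    ContDiffOn ℝ ∞ (fun y => herm (A y) (B y)) s :=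
  contDiffOn_const.mul (hA.symp (contDiffOn_pi.2 fun α => (contDiffOn_pi.1 hB α).conj))

theorem _root_.ContDiffOn.hasLineDerivAt {F : Type*} [NormedAddCommGroup F] [NormedSpace ℝ F]
    {f : E → F} {s : Set E} (hf : ContDiffOn ℝ ∞ f s) (hs : IsOpen s) {x : E} (hx : x ∈ s) (v : E) :
    HasLineDerivAt ℝ f (fderiv ℝ f x v) x v :=
  (hf.hasFDerivAt_of_isOpen hs hx).hasLineDerivAt v

theorem fderiv_apply_eq_of_hasLineDerivAt {F : Type*} [NormedAddCommGroup F] [NormedSpace ℝ F]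
    {f : E → F} {s : Set E} (hf : ContDiffOn ℝ ∞ f s) (hs : IsOpen s) {x : E} (hx : x ∈ s) {v : E}
    {f' : F} (h : HasLineDerivAt ℝ f f' x v) : fderiv ℝ f x v = f' :=
  (hf.hasLineDerivAt hs hx v).unique h

end derivatives

/-! ### Wirtinger derivatives -/

theorem single_I (i : Fin n) :
    (Pi.single i Complex.I : Fin n → ℂ) = Complex.I • (Pi.single i 1 : Fin n → ℂ) := by
  rw [← Pi.single_smul, smul_eq_mul, mul_one]

section wirtinger

variable {F : (Fin n → ℂ) → ℂ} {z : Fin n → ℂ} {P Q : (Fin n → ℂ) → ℂ}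

/-- Replacing v by iv separates the complex-linear part `P` of a real differential from its
antilinear part `Q`; the Wirtinger derivative sees only `P`. The Kähler computations below start
from such a splitting. -/
theorem wirtinger_eq (h : ∀ v, fderiv ℝ F z v = P v + Q v)
    (hP : ∀ v, P (Complex.I • v) = Complex.I * P v)
    (hQ : ∀ v, Q (Complex.I • v) = -Complex.I * Q v) (i : Fin n) :
    wirtinger F i z = P (Pi.single i 1) := by
  rw [wirtinger, single_I, h, h, hP, hQ]
  linear_combination (1 / 2 : ℂ) * (Q (Pi.single i 1) - P (Pi.single i 1)) * Complex.I_mul_I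

theorem wirtingerBar_eq (h : ∀ v, fderiv ℝ F z v = P v + Q v)
    (hP : ∀ v, P (Complex.I • v) = Complex.I * P v)
    (hQ : ∀ v, Q (Complex.I • v) = -Complex.I * Q v) (i : Fin n) :
    wirtingerBar F i z = Q (Pi.single i 1) := by
  rw [wirtingerBar, single_I, h, h, hP, hQ]
  linear_combination (1 / 2 : ℂ) * (P (Pi.single i 1) - Q (Pi.single i 1)) * Complex.I_mul_I

theorem wirtinger_congr {F G : (Fin n → ℂ) → ℂ} {s : Set (Fin n → ℂ)} (hs : IsOpen s) (hz : z ∈ s)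
    (h : ∀ w ∈ s, F w = G w) (i : Fin n) : wirtinger F i z = wirtinger G i z := by
  rw [wirtinger, wirtinger,
    (Filter.eventuallyEq_of_mem (hs.mem_nhds hz) h : F =ᶠ[nhds z] G).fderiv_eq]

end wirtinger

namespace SpecialKahler

variable (S : SpecialKahler n)

/-! ### The derivatives of the symplectic section and of the Kähler potential -/

/-- The holomorphic derivative of the section along `v`. -/
noncomputable def dΩ (z v : Fin n → ℂ) : SympIdx n → ℂ := fderiv ℂ S.Ω z v

theorem dΩ_add (z v w : Fin n → ℂ) : S.dΩ z (v + w) = S.dΩ z v + S.dΩ z w := map_add _ _ _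

theorem dΩ_smul (z : Fin n → ℂ) (c : ℂ) (v : Fin n → ℂ) : S.dΩ z (c • v) = c • S.dΩ z v :=
  map_smul _ _ _

theorem contDiffOn_Ω : ContDiffOn ℝ ∞ S.Ω S.D :=
  (contDiffOn_infty_of_differentiableOn S.isOpen_D S.holomorphic).restrict_scalars ℝ

theorem differentiableOn_dΩ (v : Fin n → ℂ) : DifferentiableOn ℂ (fun z => S.dΩ z v) S.D :=
  differentiableOn_fderiv_apply S.isOpen_D S.holomorphic v

theorem contDiffOn_dΩ (v : Fin n → ℂ) : ContDiffOn ℝ ∞ (fun z => S.dΩ z v) S.D :=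
  (contDiffOn_infty_of_differentiableOn S.isOpen_D (S.differentiableOn_dΩ v)).restrict_scalars ℝ

variable {S} {z : Fin n → ℂ}

theorem hasLineDerivAt_Ω (hz : z ∈ S.D) (v : Fin n → ℂ) :
    HasLineDerivAt ℝ S.Ω (S.dΩ z v) z v :=
  (((S.holomorphic z hz).differentiableAt (S.isOpen_D.mem_nhds hz)).hasFDerivAt.restrictScalars
    ℝ).hasLineDerivAt v

theorem hasLineDerivAt_dΩ (hz : z ∈ S.D) (u v : Fin n → ℂ) :
    HasLineDerivAt ℝ (fun w => S.dΩ w u) (fderiv ℂ (fun w => S.dΩ w u) z v) z v :=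
  (((S.differentiableOn_dΩ u z hz).differentiableAt
    (S.isOpen_D.mem_nhds hz)).hasFDerivAt.restrictScalars ℝ).hasLineDerivAt v

theorem fderiv_dΩ_comm (hz : z ∈ S.D) (u v : Fin n → ℂ) :
    fderiv ℂ (fun w => S.dΩ w u) z v = fderiv ℂ (fun w => S.dΩ w v) z u := by
  have hc := contDiffOn_infty_of_differentiableOn S.isOpen_D S.holomorphic
  have h1 := (hc.contDiffAt (S.isOpen_D.mem_nhds hz)).isSymmSndFDerivAt
    (minSmoothness_of_isRCLikeNormedField.trans_le two_le_infty) u v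
  have hd : DifferentiableAt ℂ (fderiv ℂ S.Ω) z :=
    ((hc.fderiv_of_isOpen (m := ∞) S.isOpen_D (by simp)).contDiffAt
      (S.isOpen_D.mem_nhds hz)).differentiableAt (by simp)
  have e : ∀ u v, fderiv ℂ (fun w => S.dΩ w u) z v = fderiv ℂ (fderiv ℂ S.Ω) z v u := by
    intro u v
    have := (hd.hasFDerivAt.clm_apply (hasFDerivAt_const u z)).fderiv
    simp only [dΩ, this]
    simp
  rw [e, e, h1]

theorem symp_Ω_dΩ (hz : z ∈ S.D) (v : Fin n → ℂ) : symp (S.Ω z) (S.dΩ z v) = 0 := S.legendre z hz v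

/-- Differentiating ⟨Ω|∂_vΩ⟩ = 0 along u gives ⟨∂_uΩ|∂_vΩ⟩ + ⟨Ω|∂_u∂_vΩ⟩ = 0. The first term is
antisymmetric and the second symmetric in u, v, so each vanishes. -/
theorem symp_dΩ_dΩ (hz : z ∈ S.D) (u v : Fin n → ℂ) : symp (S.dΩ z u) (S.dΩ z v) = 0 := by
  have key : ∀ u v, symp (S.dΩ z u) (S.dΩ z v)
      + symp (S.Ω z) (fderiv ℂ (fun w => S.dΩ w v) z u) = 0 := fun u v =>
    HasLineDerivAt.eq_of_eqOn S.isOpen_D hz (fun w hw => S.legendre w hw v)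
      ((hasLineDerivAt_Ω hz u).symp (hasLineDerivAt_dΩ hz v u))
      ((hasFDerivAt_const (0 : ℂ) z).hasLineDerivAt u)
  have h1 := key u v
  have h2 := key v u
  rw [fderiv_dΩ_comm hz u v, symp_swap] at h2
  linear_combination (1 / 2 : ℂ) * (h1 - h2)

variable (S) in
/-- `i ⟨dΩ(v) | Ω̄⟩`. -/
noncomputable def dY (z v : Fin n → ℂ) : ℂ := herm (S.dΩ z v) (S.Ω z)

theorem dY_add (v w : Fin n → ℂ) : S.dY z (v + w) = S.dY z v + S.dY z w := by
  rw [dY, dΩ_add, herm_add_left, dY, dY]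

theorem dY_smul (c : ℂ) (v : Fin n → ℂ) : S.dY z (c • v) = c * S.dY z v := by
  rw [dY, dΩ_smul, herm_smul_left, dY]

theorem herm_Ω_dΩ (v : Fin n → ℂ) : herm (S.Ω z) (S.dΩ z v) = conj (S.dY z v) := by
  rw [dY, conj_herm]

theorem hermNorm_eq (z : Fin n → ℂ) : (hermNorm S.Ω z : ℂ) = herm (S.Ω z) (S.Ω z) :=
  (herm_self_eq_re _).symm

theorem hermNorm_ne (hz : z ∈ S.D) : (hermNorm S.Ω z : ℂ) ≠ 0 :=
  Complex.ofReal_ne_zero.2 (S.hermNorm_pos z hz).ne'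

variable (S) in
theorem contDiffOn_hermNorm : ContDiffOn ℝ ∞ (hermNorm S.Ω) S.D :=
  Complex.reCLM.contDiff.comp_contDiffOn (S.contDiffOn_Ω.herm S.contDiffOn_Ω)

variable (S) in
theorem contDiffOn_kahlerPotential : ContDiffOn ℝ ∞ (kahlerPotential S.Ω) S.D :=
  (S.contDiffOn_hermNorm.log fun z hz => (S.hermNorm_pos z hz).ne').neg

theorem hasLineDerivAt_hermNorm (hz : z ∈ S.D) (v : Fin n → ℂ) :
    HasLineDerivAt ℝ (hermNorm S.Ω) (2 * (S.dY z v).re) z v := by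
  have h := Complex.reCLM.hasFDerivAt.comp_hasDerivAt _
    ((hasLineDerivAt_Ω hz v).herm (hasLineDerivAt_Ω hz v))
  have e : Complex.reCLM (herm (S.dΩ z v) (S.Ω z) + herm (S.Ω z) (S.dΩ z v))
      = 2 * (S.dY z v).re := by
    rw [herm_Ω_dΩ, ← dY]; simp; ring
  rw [e] at h
  exact h

theorem hasLineDerivAt_kahlerPotential (hz : z ∈ S.D) (v : Fin n → ℂ) :
    HasLineDerivAt ℝ (kahlerPotential S.Ω) (-(2 * (S.dY z v).re / hermNorm S.Ω z)) z v := by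
  have h := hasLineDerivAt_hermNorm hz v
  have := (HasDerivAt.log (f := fun t : ℝ => hermNorm S.Ω (z + t • v)) (x := 0) h
    (by simpa using (S.hermNorm_pos z hz).ne')).neg
  simp only [zero_smul, add_zero] at this
  exact this

theorem fderiv_kahlerPotential (hz : z ∈ S.D) (v : Fin n → ℂ) :
    fderiv ℝ (fun w => (kahlerPotential S.Ω w : ℂ)) z v
      = -(S.dY z v / hermNorm S.Ω z) + -(conj (S.dY z v) / hermNorm S.Ω z) := by
  have hc : ContDiffOn ℝ ∞ (fun w => (kahlerPotential S.Ω w : ℂ)) S.D :=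
    Complex.ofRealCLM.contDiff.comp_contDiffOn S.contDiffOn_kahlerPotential
  rw [fderiv_apply_eq_of_hasLineDerivAt hc S.isOpen_D hz
    (HasDerivAt.ofReal_comp (hasLineDerivAt_kahlerPotential hz v))]
  rw [← neg_add, ← add_div, Complex.add_conj]
  push_cast
  ring

theorem dKahler_eq (hz : z ∈ S.D) (i : Fin n) :
    dKahler S.Ω i z = -(S.dY z (Pi.single i 1) / hermNorm S.Ω z) :=
  wirtinger_eq (P := fun v => -(S.dY z v / hermNorm S.Ω z))
    (Q := fun v => -(conj (S.dY z v) / hermNorm S.Ω z)) (fderiv_kahlerPotential hz)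
    (fun v => by simp only [dY_smul]; ring)
    (fun v => by simp only [dY_smul, map_mul, Complex.conj_I]; ring) i

theorem wirtingerBar_kahlerPotential (hz : z ∈ S.D) (i : Fin n) :
    wirtingerBar (fun w => (kahlerPotential S.Ω w : ℂ)) i z
      = -(herm (S.Ω z) (S.dΩ z (Pi.single i 1)) / herm (S.Ω z) (S.Ω z)) := by
  rw [← hermNorm_eq, herm_Ω_dΩ]
  exact wirtingerBar_eq (P := fun v => -(S.dY z v / hermNorm S.Ω z))
    (Q := fun v => -(conj (S.dY z v) / hermNorm S.Ω z)) (fderiv_kahlerPotential hz)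
    (fun v => by simp only [dY_smul]; ring)
    (fun v => by simp only [dY_smul, map_mul, Complex.conj_I]; ring) i

theorem sum_mul_single {M : Type*} [AddCommMonoid M] [Module ℂ M] {f : (Fin n → ℂ) → M}
    (hadd : ∀ v w, f (v + w) = f v + f w) (hsmul : ∀ (c : ℂ) v, f (c • v) = c • f v)
    (v : Fin n → ℂ) : ∑ i, v i • f (Pi.single i 1) = f v := by
  let L : (Fin n → ℂ) →ₗ[ℂ] M := { toFun := f, map_add' := hadd, map_smul' := hsmul }
  have := L.pi_apply_eq_sum_univ v
  simp only [L, LinearMap.coe_mk, AddHom.coe_mk] at this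
  rw [this]
  refine Finset.sum_congr rfl fun i _ => ?_
  congr 2
  ext j
  simp [Pi.single_apply, eq_comm]

theorem sum_dKahler_mul (hz : z ∈ S.D) (v : Fin n → ℂ) :
    ∑ i, dKahler S.Ω i z * v i = -(S.dY z v / hermNorm S.Ω z) := by
  rw [← sum_mul_single (f := fun v => -(S.dY z v / hermNorm S.Ω z))
    (fun v w => by simp only [dY_add]; ring) (fun c v => by simp only [dY_smul, smul_eq_mul]; ring)]
  exact Finset.sum_congr rfl fun i _ => by rw [dKahler_eq hz, smul_eq_mul, mul_comm]

/-! ### The Kähler metric -/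

theorem kahlerMetric_eq (hz : z ∈ S.D) (i j : Fin n) :
    kahlerMetric S.Ω z i j
      = -(herm (S.dΩ z (Pi.single i 1)) (S.dΩ z (Pi.single j 1)) / hermNorm S.Ω z)
        + S.dY z (Pi.single i 1) * conj (S.dY z (Pi.single j 1)) / hermNorm S.Ω z ^ 2 := by
  set e : Fin n → ℂ := Pi.single j 1
  have h0 := hermNorm_ne hz
  -- The second derivative of Ω sits in the antilinear slot of `herm`, hence in the antiholomorphic
  -- bracket, and drops out of the Wirtinger derivative.
  have hd : ∀ v, fderiv ℝ (fun w => -(herm (S.Ω w) (S.dΩ w e) / herm (S.Ω w) (S.Ω w))) z v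
      = (-(herm (S.dΩ z v) (S.dΩ z e) / hermNorm S.Ω z)
          + S.dY z v * conj (S.dY z e) / hermNorm S.Ω z ^ 2)
        + (-(herm (S.Ω z) (fderiv ℂ (fun w => S.dΩ w e) z v) / hermNorm S.Ω z)
          + conj (S.dY z v) * conj (S.dY z e) / hermNorm S.Ω z ^ 2) := by
    intro v
    have hΩ := hasLineDerivAt_Ω hz v
    have hc : ContDiffOn ℝ ∞ (fun w => -(herm (S.Ω w) (S.dΩ w e) / herm (S.Ω w) (S.Ω w))) S.D :=
      ((S.contDiffOn_Ω.herm (S.contDiffOn_dΩ e)).div_complex (S.contDiffOn_Ω.herm S.contDiffOn_Ω)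
        fun w hw => by rw [← hermNorm_eq]; exact hermNorm_ne hw).neg
    have h3 := (hΩ.herm (hasLineDerivAt_dΩ hz e v)).div_complex (hΩ.herm hΩ)
      (by rwa [← hermNorm_eq])
    rw [fderiv_apply_eq_of_hasLineDerivAt hc S.isOpen_D hz (HasDerivAt.neg h3)]
    simp only [← hermNorm_eq, herm_Ω_dΩ]
    rw [← dY]
    field_simp
    ring
  rw [kahlerMetric, Matrix.of_apply, wirtinger_congr S.isOpen_D hz
    (fun w hw => wirtingerBar_kahlerPotential hw j),
    wirtinger_eq hd (fun v => by simp only [dΩ_smul, herm_smul_left, dY_smul]; ring)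
      (fun v => by
        rw [map_smul, herm_smul_right]; simp only [dY_smul, map_mul, Complex.conj_I]; ring)]

theorem sum_kahlerMetric (hz : z ∈ S.D) (v w : Fin n → ℂ) :
    ∑ i, ∑ j, kahlerMetric S.Ω z i j * v i * conj (w j)
      = -(herm (S.dΩ z v) (S.dΩ z w) / hermNorm S.Ω z)
        + S.dY z v * conj (S.dY z w) / hermNorm S.Ω z ^ 2 := by
  have h1 : ∀ i, ∑ j, kahlerMetric S.Ω z i j * v i * conj (w j)
      = v i * (-(herm (S.dΩ z (Pi.single i 1)) (S.dΩ z w) / hermNorm S.Ω z)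
        + S.dY z (Pi.single i 1) * conj (S.dY z w) / hermNorm S.Ω z ^ 2) := by
    intro i
    -- The dependence on w is antilinear, so the expansion in coordinates is applied to the
    -- conjugate.
    have := congrArg conj (sum_mul_single (f := fun w =>
      conj (v i * (-(herm (S.dΩ z (Pi.single i 1)) (S.dΩ z w) / hermNorm S.Ω z)
        + S.dY z (Pi.single i 1) * conj (S.dY z w) / hermNorm S.Ω z ^ 2)))
      (fun a b => by
        rw [← map_add]; congr 1; simp only [dΩ_add, herm_add_right, dY_add, map_add]; ring)
      (fun c a => by
        rw [smul_eq_mul, ← Complex.conj_conj c, ← map_mul]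
        congr 1
        simp only [Complex.conj_conj, dΩ_smul, herm_smul_right, dY_smul, map_mul]; ring) w)
    rw [Complex.conj_conj] at this
    rw [← this, map_sum]
    refine Finset.sum_congr rfl fun j _ => ?_
    rw [kahlerMetric_eq hz, smul_eq_mul, map_mul, Complex.conj_conj]
    ring
  simp only [h1]
  exact sum_mul_single (f := fun v => -(herm (S.dΩ z v) (S.dΩ z w) / hermNorm S.Ω z)
        + S.dY z v * conj (S.dY z w) / hermNorm S.Ω z ^ 2)
    (fun a b => by simp only [dΩ_add, herm_add_left, dY_add]; ring)
    (fun c a => by simp only [dΩ_smul, herm_smul_left, dY_smul, smul_eq_mul]; ring) v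

variable (S) in
/-- The Hermitian form `g_{ij*} vⁱ w̄ʲ`. -/
noncomputable def kahlerForm (z v w : Fin n → ℂ) : ℂ :=
  ∑ i, ∑ j, kahlerMetric S.Ω z i j * v i * conj (w j)

theorem kahlerForm_conj (hz : z ∈ S.D) (v w : Fin n → ℂ) :
    conj (S.kahlerForm z v w) = S.kahlerForm z w v := by
  rw [kahlerForm, kahlerForm, sum_kahlerMetric hz, sum_kahlerMetric hz]
  simp only [map_add, map_neg, map_mul, map_div₀, conj_herm, Complex.conj_conj, map_pow,
    Complex.conj_ofReal]
  ring

variable (S) in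
theorem contDiffOn_kahlerForm (v w : Fin n → ℂ) :
    ContDiffOn ℝ ∞ (fun z => S.kahlerForm z v w) S.D := by
  have hY : ContDiffOn ℝ ∞ (fun z => (hermNorm S.Ω z : ℂ)) S.D :=
    Complex.ofRealCLM.contDiff.comp_contDiffOn S.contDiffOn_hermNorm
  have hdY : ∀ v, ContDiffOn ℝ ∞ (fun z => S.dY z v) S.D :=
    fun v => (S.contDiffOn_dΩ v).herm S.contDiffOn_Ω
  refine ContDiffOn.congr (f := fun z => -(herm (S.dΩ z v) (S.dΩ z w) / hermNorm S.Ω z)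
        + S.dY z v * conj (S.dY z w) / hermNorm S.Ω z ^ 2) ?_ fun z hz => sum_kahlerMetric hz v w
  exact (((S.contDiffOn_dΩ v).herm (S.contDiffOn_dΩ w)).div_complex hY fun z hz => hermNorm_ne hz).neg.add
    (((hdY v).mul (hdY w).conj).div_complex (hY.pow 2) fun z hz => pow_ne_zero 2 (hermNorm_ne hz))

end SpecialKahler

end CMap

/-! ### Smoothness of matrix products, determinants and inverses -/

section MatrixInverse

variable {E : Type*} [NormedAddCommGroup E] [NormedSpace ℝ E] {m : Type*} [Fintype m]
  {𝕜 : Type*} [NormedField 𝕜] [NormedAlgebra ℝ 𝕜] {s : Set E}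

theorem contDiffOn_matrix_mul {A B : E → Matrix m m 𝕜}
    (hA : ∀ i j, ContDiffOn ℝ ∞ (fun x => A x i j) s)
    (hB : ∀ i j, ContDiffOn ℝ ∞ (fun x => B x i j) s) (i j : m) :
    ContDiffOn ℝ ∞ (fun x => (A x * B x) i j) s := by
  simp only [Matrix.mul_apply]
  exact ContDiffOn.sum fun k _ => (hA i k).mul (hB k j)

variable [DecidableEq m]

theorem contDiffOn_matrix_det {A : E → Matrix m m 𝕜}
    (hA : ∀ i j, ContDiffOn ℝ ∞ (fun x => A x i j) s) : ContDiffOn ℝ ∞ (fun x => (A x).det) s := by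
  simp only [Matrix.det_apply']
  exact ContDiffOn.sum fun σ _ => contDiffOn_const.mul (contDiffOn_prod fun i _ => hA _ _)

/-- The inverse is the adjugate divided by the determinant. -/
theorem contDiffOn_matrix_inv {A : E → Matrix m m 𝕜}
    (hA : ∀ i j, ContDiffOn ℝ ∞ (fun x => A x i j) s) (h0 : ∀ x ∈ s, (A x).det ≠ 0) (i j : m) :
    ContDiffOn ℝ ∞ (fun x => (A x)⁻¹ i j) s := by
  simp only [Matrix.inv_def, Ring.inverse_eq_inv', Matrix.smul_apply, smul_eq_mul,
    Matrix.adjugate_apply]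
  refine ((contDiffOn_matrix_det hA).inv h0).mul (contDiffOn_matrix_det fun k l => ?_)
  simp only [Matrix.updateRow_apply]
  split_ifs
  · exact contDiffOn_const
  · exact hA k l

end MatrixInverse

/-! ### The sections V and U_i, the period matrix and ℳ₄⁻¹ -/

namespace CMap

namespace SpecialKahler

variable {n : ℕ} {S : SpecialKahler n} {z : Fin n → ℂ}

variable (S) in
theorem contDiffOn_exp_kahlerPotential :
    ContDiffOn ℝ ∞ (fun z => (Real.exp (kahlerPotential S.Ω z / 2) : ℂ)) S.D :=
  Complex.ofRealCLM.contDiff.comp_contDiffOn (S.contDiffOn_kahlerPotential.div_const 2).exp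

variable (S) in
theorem contDiffOn_secV (α : SympIdx n) : ContDiffOn ℝ ∞ (fun z => secV S.Ω z α) S.D :=
  S.contDiffOn_exp_kahlerPotential.mul (contDiffOn_pi.1 S.contDiffOn_Ω α)

theorem secV_eq (z : Fin n → ℂ) :
    secV S.Ω z = (Real.exp (kahlerPotential S.Ω z / 2) : ℂ) • S.Ω z := rfl

theorem hasLineDerivAt_secV (hz : z ∈ S.D) (v : Fin n → ℂ) :
    HasLineDerivAt ℝ (secV S.Ω) ((Real.exp (kahlerPotential S.Ω z / 2) : ℂ) •
      (S.dΩ z v - ((S.dY z v).re / hermNorm S.Ω z : ℂ) • S.Ω z)) z v := by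
  have h1 := (HasDerivAt.div_const (hasLineDerivAt_kahlerPotential hz v) 2).exp.ofReal_comp
  have := HasDerivAt.smul h1 (hasLineDerivAt_Ω hz v)
  refine HasDerivAt.congr_deriv this ?_
  ext α
  simp
  ring

theorem exp_kahlerPotential_sq (hz : z ∈ S.D) :
    (Real.exp (kahlerPotential S.Ω z / 2) : ℂ) ^ 2 = (hermNorm S.Ω z : ℂ)⁻¹ := by
  rw [← Complex.ofReal_pow, ← Complex.ofReal_inv, ← Real.exp_nat_mul, kahlerPotential]
  congr 1
  rw [show ((2 : ℕ) : ℝ) * (-Real.log (hermNorm S.Ω z) / 2) = -Real.log (hermNorm S.Ω z) by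
    push_cast; ring, Real.exp_neg, Real.exp_log (S.hermNorm_pos z hz)]

/-- The term ½ ∂_i𝒦 V doubles the holomorphic half of the derivative of the prefactor. What results
is the component of ∂_iΩ that is Hermitian-orthogonal to Ω, rescaled. -/
theorem secU_eq (hz : z ∈ S.D) (i : Fin n) (α : SympIdx n) :
    secU S.Ω i z α = (Real.exp (kahlerPotential S.Ω z / 2) : ℂ)
      * (S.dΩ z (Pi.single i 1) α - S.dY z (Pi.single i 1) / hermNorm S.Ω z * S.Ω z α) := by
  set ε : ℂ := (Real.exp (kahlerPotential S.Ω z / 2) : ℂ) with hε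
  have hd : ∀ v, fderiv ℝ (fun w => secV S.Ω w α) z v
      = ε * (S.dΩ z v α - 1 / 2 * S.dY z v / hermNorm S.Ω z * S.Ω z α)
        + ε * (-(1 / 2 * conj (S.dY z v) / hermNorm S.Ω z * S.Ω z α)) := by
    intro v
    rw [fderiv_apply_eq_of_hasLineDerivAt (S.contDiffOn_secV α) S.isOpen_D hz
      (hasDerivAt_pi.1 (hasLineDerivAt_secV hz v) α)]
    have : ((S.dY z v).re : ℂ) = 1 / 2 * S.dY z v + 1 / 2 * conj (S.dY z v) := by
      rw [← mul_add, Complex.add_conj]; push_cast; ring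
    simp only [Pi.smul_apply, Pi.sub_apply, smul_eq_mul, this]
    ring
  rw [secU, wirtinger_eq hd
    (fun v => by simp only [dΩ_smul, dY_smul, Pi.smul_apply, smul_eq_mul]; ring)
    (fun v => by simp only [dY_smul, map_mul, Complex.conj_I]; ring), dKahler_eq hz, secV]
  ring

variable (S) in
/-- The combination `vⁱ U_i`. -/
noncomputable def secUVec (z v : Fin n → ℂ) : SympIdx n → ℂ :=
  (Real.exp (kahlerPotential S.Ω z / 2) : ℂ) •
    (S.dΩ z v - (S.dY z v / hermNorm S.Ω z) • S.Ω z)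

theorem sum_secU (hz : z ∈ S.D) (v : Fin n → ℂ) (α : SympIdx n) :
    ∑ i, secU S.Ω i z α * v i = S.secUVec z v α := by
  rw [← sum_mul_single (f := fun v => S.secUVec z v α)
    (fun v w => by
      simp only [secUVec, dΩ_add, dY_add, Pi.smul_apply, Pi.sub_apply, Pi.add_apply, smul_eq_mul]
      ring)
    (fun c v => by
      simp only [secUVec, dΩ_smul, dY_smul, Pi.smul_apply, Pi.sub_apply, smul_eq_mul]; ring)]
  refine Finset.sum_congr rfl fun i _ => ?_
  rw [secU_eq hz]
  simp only [secUVec, Pi.smul_apply, Pi.sub_apply, smul_eq_mul]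
  ring

theorem sub_eq_add_neg_smul (A B : SympIdx n → ℂ) (c : ℂ) : A - c • B = A + (-c) • B := by
  rw [neg_smul, sub_eq_add_neg]

/-- The product is thus negative on the U_i, while it equals 1 on V. Replacing V by V̄ flips the
latter sign, so the span of the U_i and V̄ is negative definite. -/
theorem herm_secUVec_self (hz : z ∈ S.D) (v : Fin n → ℂ) :
    herm (S.secUVec z v) (S.secUVec z v) = -S.kahlerForm z v v := by
  have h0 := hermNorm_ne hz
  rw [kahlerForm, sum_kahlerMetric hz, secUVec, sub_eq_add_neg_smul]
  simp only [herm_smul_left, herm_smul_right, herm_add_left, herm_add_right, herm_Ω_dΩ,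
    ← hermNorm_eq, map_neg, map_div₀, Complex.conj_ofReal]
  rw [← dY]
  set ε : ℂ := (Real.exp (kahlerPotential S.Ω z / 2) : ℂ) with hε
  trans ε ^ 2 * (herm (S.dΩ z v) (S.dΩ z v) - S.dY z v * conj (S.dY z v) / hermNorm S.Ω z)
  · field_simp
    ring
  · rw [hε, exp_kahlerPotential_sq hz]
    field_simp
    ring

theorem herm_secUVec_secV (hz : z ∈ S.D) (v : Fin n → ℂ) :
    herm (S.secUVec z v) (secV S.Ω z) = 0 := by
  have h0 := hermNorm_ne hz
  rw [secUVec, sub_eq_add_neg_smul, secV_eq]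
  simp only [herm_smul_left, herm_smul_right, herm_add_left, ← hermNorm_eq]
  rw [← dY]
  field_simp
  simp

theorem herm_secV_secV (hz : z ∈ S.D) : herm (secV S.Ω z) (secV S.Ω z) = 1 := by
  have h0 := hermNorm_ne hz
  rw [secV_eq, herm_smul_left, herm_smul_right, ← hermNorm_eq, Complex.conj_ofReal, ← mul_assoc,
    ← sq, exp_kahlerPotential_sq hz, inv_mul_cancel₀ h0]

theorem symp_secUVec (hz : z ∈ S.D) (v w : Fin n → ℂ) :
    symp (S.secUVec z v) (S.secUVec z w) = 0 := by
  have h2 := symp_swap (S.dΩ z v) (S.Ω z)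
  rw [symp_Ω_dΩ hz] at h2
  have h3 : symp (S.Ω z) (S.Ω z) = 0 := by simp [symp_eq, mul_comm]
  rw [secUVec, secUVec, sub_eq_add_neg_smul, sub_eq_add_neg_smul]
  simp only [symp_smul_left, symp_smul_right, symp_add_left, symp_add_right, symp_Ω_dΩ hz,
    symp_dΩ_dΩ hz, h2, h3]
  ring

theorem symp_secV_secUVec (hz : z ∈ S.D) (v : Fin n → ℂ) :
    symp (S.secUVec z v) (secV S.Ω z) = 0 := by
  have h2 := symp_swap (S.dΩ z v) (S.Ω z)
  rw [symp_Ω_dΩ hz] at h2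
  have h3 : symp (S.Ω z) (S.Ω z) = 0 := by simp [symp_eq, mul_comm]
  rw [secUVec, secV_eq, sub_eq_add_neg_smul]
  simp only [symp_smul_left, symp_smul_right, symp_add_left, h2, h3]
  ring

/-! ### The period matrix -/

variable (S) in
/-- The combination `xⁱ U_i + x⁰ V̄`. -/
noncomputable def periodVec (z : Fin n → ℂ) (x : Fin (n + 1) → ℂ) : SympIdx n → ℂ :=
  S.secUVec z (fun i => x i.castSucc) + x (Fin.last n) • fun α => conj (secV S.Ω z α)

theorem periodBlock_mulVec (hz : z ∈ S.D) (b : Fin (n + 1) → SympIdx n) (x : Fin (n + 1) → ℂ) :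
    periodBlock S.Ω b z *ᵥ x = fun Λ => S.periodVec z x (b Λ) := by
  ext Λ
  simp only [Matrix.mulVec, dotProduct, periodBlock, Matrix.of_apply, Fin.sum_univ_castSucc,
    Fin.lastCases_castSucc, Fin.lastCases_last, periodVec, Pi.add_apply, Pi.smul_apply, smul_eq_mul]
  rw [sum_secU hz (fun i => x i.castSucc), mul_comm (x (Fin.last n))]

/-- The span of the U_i and V̄ is Lagrangian. It is the graph of the period matrix over the upper
block, and its isotropy is the symmetry of 𝒩. -/
theorem symp_periodVec (hz : z ∈ S.D) (x y : Fin (n + 1) → ℂ) :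
    symp (S.periodVec z x) (S.periodVec z y) = 0 := by
  have h1 : ∀ v, symp (S.secUVec z v) (fun α => conj (secV S.Ω z α)) = 0 := fun v => by
    rw [symp_conj_right, herm_secUVec_secV hz, mul_zero]
  have h2 : ∀ v, symp (fun α => conj (secV S.Ω z α)) (S.secUVec z v) = 0 := fun v => by
    rw [symp_swap, h1, neg_zero]
  have h3 : ∀ A : SympIdx n → ℂ, symp A A = 0 := fun A => by simp [symp_eq, mul_comm]
  rw [periodVec, periodVec]
  simp only [symp_add_left, symp_add_right, symp_smul_left, symp_smul_right, h1, h2, h3,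
    symp_secUVec hz]
  ring

theorem herm_periodVec_neg (hz : z ∈ S.D) {x : Fin (n + 1) → ℂ} (hx : x ≠ 0) :
    (herm (S.periodVec z x) (S.periodVec z x)).re < 0 := by
  set v : Fin n → ℂ := fun i => x i.castSucc
  set b := x (Fin.last n)
  have h1 : herm (S.secUVec z v) (fun α => conj (secV S.Ω z α)) = 0 := by
    rw [herm_conj_right, symp_secV_secUVec hz, mul_zero]
  have h2 : herm (fun α => conj (secV S.Ω z α)) (S.secUVec z v) = 0 := by
    rw [← conj_herm, h1, map_zero]
  have e : herm (S.periodVec z x) (S.periodVec z x)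
      = -(S.kahlerForm z v v) - (Complex.normSq b : ℂ) := by
    rw [periodVec]
    simp only [herm_add_left, herm_add_right, herm_smul_left, herm_smul_right]
    rw [h1, h2, herm_secUVec_self hz, herm_self_conj, herm_secV_secV hz, Complex.normSq_eq_conj_mul_self]
    ring
  rw [e, Complex.sub_re, Complex.neg_re, Complex.ofReal_re]
  by_cases hv : v = 0
  · have hb : b ≠ 0 := by
      rintro hb
      refine hx (funext fun i => ?_)
      refine Fin.lastCases hb (fun j => congrFun hv j) i
    have : S.kahlerForm z v v = 0 := by simp [kahlerForm, hv]
    rw [this]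
    simpa using hb
  · have := S.metric_pos z hz v hv
    rw [← kahlerForm] at this
    linarith [Complex.normSq_nonneg b]

/-- A vector with vanishing upper half has Hermitian norm zero, which negativity excludes; so the
Lagrangian subspace really is a graph. -/
theorem det_periodBlock_ne (hz : z ∈ S.D) : (periodBlock S.Ω Sum.inl z).det ≠ 0 := by
  intro h
  obtain ⟨x, hx, h0⟩ := Matrix.exists_mulVec_eq_zero_iff.2 h
  rw [periodBlock_mulVec hz] at h0
  have := herm_periodVec_neg hz hx
  have h1 : ∀ i, S.periodVec z x (Sum.inl i) = 0 := fun i => congrFun h0 i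
  simp [herm, symp_eq, h1] at this

theorem exists_periodVec (hz : z ∈ S.D) (a : Fin (n + 1) → ℂ) :
    ∃ x, (∀ i, S.periodVec z x (Sum.inl i) = a i) ∧
      (∀ i, S.periodVec z x (Sum.inr i) = (periodMatrix S.Ω z *ᵥ a) i) := by
  have hu : IsUnit (periodBlock S.Ω Sum.inl z).det := (det_periodBlock_ne hz).isUnit
  refine ⟨(periodBlock S.Ω Sum.inl z)⁻¹ *ᵥ a, fun i => ?_, fun i => ?_⟩
  · have := congrFun (periodBlock_mulVec hz Sum.inl ((periodBlock S.Ω Sum.inl z)⁻¹ *ᵥ a)) i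
    rw [← this, Matrix.mulVec_mulVec, Matrix.mul_nonsing_inv _ hu, Matrix.one_mulVec]
  · have := congrFun (periodBlock_mulVec hz Sum.inr ((periodBlock S.Ω Sum.inl z)⁻¹ *ᵥ a)) i
    rw [← this, Matrix.mulVec_mulVec, periodMatrix]

theorem periodMatrix_transpose (hz : z ∈ S.D) :
    (periodMatrix S.Ω z)ᵀ = periodMatrix S.Ω z := by
  ext i j
  obtain ⟨x, hx1, hx2⟩ := exists_periodVec hz (Pi.single i 1)
  obtain ⟨y, hy1, hy2⟩ := exists_periodVec hz (Pi.single j 1)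
  have := symp_periodVec hz x y
  simp only [symp_eq, hx1, hx2, hy1, hy2, Finset.sum_sub_distrib] at this
  simpa [Pi.single_apply, sub_eq_zero, eq_comm] using this

variable (S) in
/-- The real part of the period matrix. -/
noncomputable def periodRe (z : Fin n → ℂ) : Matrix (Fin (n + 1)) (Fin (n + 1)) ℝ :=
  (periodMatrix S.Ω z).map Complex.re

variable (S) in
/-- The imaginary part of the period matrix. -/
noncomputable def periodIm (z : Fin n → ℂ) : Matrix (Fin (n + 1)) (Fin (n + 1)) ℝ :=
  (periodMatrix S.Ω z).map Complex.im

theorem periodRe_transpose (hz : z ∈ S.D) : (S.periodRe z)ᵀ = S.periodRe z := by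
  rw [periodRe, ← Matrix.transpose_map, periodMatrix_transpose hz]

theorem periodIm_transpose (hz : z ∈ S.D) : (S.periodIm z)ᵀ = S.periodIm z := by
  rw [periodIm, ← Matrix.transpose_map, periodMatrix_transpose hz]

/-- The vector with real upper half a and lower half 𝒩a has Hermitian norm 2 aᵀ (Im 𝒩) a. -/
theorem periodIm_neg (hz : z ∈ S.D) {a : Fin (n + 1) → ℝ} (ha : a ≠ 0) :
    a ⬝ᵥ (S.periodIm z *ᵥ a) < 0 := by
  obtain ⟨x, hx1, hx2⟩ := exists_periodVec hz (fun i => (a i : ℂ))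
  have hx : x ≠ 0 := by
    rintro rfl
    refine ha (funext fun i => ?_)
    have := hx1 i
    have e : S.periodVec z 0 = 0 := by
      ext α
      simp [periodVec, ← sum_secU hz]
    rw [e] at this
    simpa using this.symm
  have h1 := herm_periodVec_neg hz hx
  have e : ∀ i, ((periodMatrix S.Ω z *ᵥ fun j => (a j : ℂ)) i).im = (S.periodIm z *ᵥ a) i := by
    intro i
    simp [Matrix.mulVec, dotProduct, periodIm, Complex.im_sum]
  have : (herm (S.periodVec z x) (S.periodVec z x)).re = 2 * (a ⬝ᵥ (S.periodIm z *ᵥ a)) := by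
    simp only [herm, symp_eq, hx1, hx2, Complex.conj_ofReal, dotProduct, ← e, Finset.mul_sum,
      Complex.re_sum]
    refine Finset.sum_congr rfl fun i _ => ?_
    simp
    ring
  linarith

theorem det_periodIm_ne (hz : z ∈ S.D) : (S.periodIm z).det ≠ 0 := by
  intro h
  obtain ⟨x, hx, h0⟩ := Matrix.exists_mulVec_eq_zero_iff.2 h
  have := periodIm_neg hz hx
  simp [h0] at this

theorem periodIm_inv_neg (hz : z ∈ S.D) {b : Fin (n + 1) → ℝ} (hb : b ≠ 0) :
    b ⬝ᵥ ((S.periodIm z)⁻¹ *ᵥ b) < 0 := by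
  have hu : IsUnit (S.periodIm z).det := (det_periodIm_ne hz).isUnit
  have e : S.periodIm z *ᵥ ((S.periodIm z)⁻¹ *ᵥ b) = b := by
    rw [Matrix.mulVec_mulVec, Matrix.mul_nonsing_inv _ hu, Matrix.one_mulVec]
  have h1 := periodIm_neg hz (a := (S.periodIm z)⁻¹ *ᵥ b) (by
    intro h0
    rw [h0, Matrix.mulVec_zero] at e
    exact hb e.symm)
  rwa [e, dotProduct_comm] at h1

/-! ### The matrix `ℳ₄⁻¹` -/

theorem matM4inv_eq (z : Fin n → ℂ) : matM4inv S.Ω z = Matrix.fromBlocks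
    (S.periodIm z + S.periodRe z * (S.periodIm z)⁻¹ * S.periodRe z)
    (-(S.periodRe z * (S.periodIm z)⁻¹)) (-((S.periodIm z)⁻¹ * S.periodRe z))
    (S.periodIm z)⁻¹ := rfl

theorem matM4inv_transpose (hz : z ∈ S.D) : (matM4inv S.Ω z)ᵀ = matM4inv S.Ω z := by
  rw [matM4inv_eq, Matrix.fromBlocks_transpose]
  simp only [Matrix.transpose_add, Matrix.transpose_mul, Matrix.transpose_neg,
    Matrix.transpose_nonsing_inv, periodRe_transpose hz, periodIm_transpose hz, Matrix.mul_assoc]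

theorem matM4inv_symm (hz : z ∈ S.D) (v w : SympIdx n → ℝ) :
    v ⬝ᵥ (matM4inv S.Ω z *ᵥ w) = w ⬝ᵥ (matM4inv S.Ω z *ᵥ v) := by
  rw [Matrix.dotProduct_mulVec, ← Matrix.mulVec_transpose, matM4inv_transpose hz, dotProduct_comm]

/-- Completing the square: with J = Im 𝒩, R = Re 𝒩 and u = Rξ − η, the quadratic form is ξᵀJξ +
uᵀJ⁻¹u, and both J and J⁻¹ are negative definite. -/
theorem matM4inv_neg (hz : z ∈ S.D) {ζ : SympIdx n → ℝ} (hζ : ζ ≠ 0) :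
    ζ ⬝ᵥ (matM4inv S.Ω z *ᵥ ζ) < 0 := by
  obtain ⟨ξ, η, rfl⟩ : ∃ ξ η, ζ = Sum.elim ξ η := ⟨_, _, (Sum.elim_comp_inl_inr ζ).symm⟩
  set J := S.periodIm z with hJ
  set R := S.periodRe z with hR
  set u := R *ᵥ ξ - η with hu
  have key : Sum.elim ξ η ⬝ᵥ (matM4inv S.Ω z *ᵥ Sum.elim ξ η)
      = ξ ⬝ᵥ (J *ᵥ ξ) + u ⬝ᵥ (J⁻¹ *ᵥ u) := by
    have e1 : ξ ⬝ᵥ (R *ᵥ (J⁻¹ *ᵥ u)) = (R *ᵥ ξ) ⬝ᵥ (J⁻¹ *ᵥ u) := by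
      rw [Matrix.dotProduct_mulVec, ← Matrix.mulVec_transpose, hR, periodRe_transpose hz]
    have e2 : (J + R * J⁻¹ * R) *ᵥ ξ + -(R * J⁻¹) *ᵥ η = J *ᵥ ξ + R *ᵥ (J⁻¹ *ᵥ u) := by
      simp only [hu, Matrix.add_mulVec, Matrix.neg_mulVec, Matrix.mulVec_sub, Matrix.mulVec_mulVec,
        ← Matrix.mul_assoc]
      abel
    have e3 : -(J⁻¹ * R) *ᵥ ξ + J⁻¹ *ᵥ η = -(J⁻¹ *ᵥ u) := by
      simp only [hu, Matrix.neg_mulVec, Matrix.mulVec_sub, Matrix.mulVec_mulVec]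
      abel
    rw [matM4inv_eq, Matrix.fromBlocks_mulVec, sumElim_dotProduct_sumElim]
    simp only [Sum.elim_comp_inl, Sum.elim_comp_inr]
    rw [e2, e3, dotProduct_add, e1, hu, dotProduct_neg, sub_dotProduct]
    ring
  rw [key]
  by_cases hξ : ξ = 0
  · have hη : u ≠ 0 := by
      intro h0
      have : η = 0 := by simpa [hu, hξ] using h0
      exact hζ (by rw [hξ, this]; ext (i | i) <;> rfl)
    simpa [hξ] using periodIm_inv_neg hz hη
  · have h1 := periodIm_neg hz hξ
    by_cases h0 : u = 0
    · simpa [h0] using h1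
    · have := periodIm_inv_neg hz h0
      linarith

variable (S) in
theorem contDiffOn_periodBlock (b : Fin (n + 1) → SympIdx n) (i j : Fin (n + 1)) :
    ContDiffOn ℝ ∞ (fun z => periodBlock S.Ω b z i j) S.D := by
  have hY : ContDiffOn ℝ ∞ (fun z => (hermNorm S.Ω z : ℂ)) S.D :=
    Complex.ofRealCLM.contDiff.comp_contDiffOn S.contDiffOn_hermNorm
  simp only [periodBlock, Matrix.of_apply]
  refine Fin.lastCases ?_ (fun k => ?_) j
  · simp only [Fin.lastCases_last]
    exact (S.contDiffOn_secV _).conj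
  · simp only [Fin.lastCases_castSucc]
    refine ContDiffOn.congr ?_ fun z hz => secU_eq hz k (b i)
    exact S.contDiffOn_exp_kahlerPotential.mul ((contDiffOn_pi.1 (S.contDiffOn_dΩ _) _).sub
      ((((S.contDiffOn_dΩ _).herm S.contDiffOn_Ω).div_complex hY fun z hz => hermNorm_ne hz).mul
        (contDiffOn_pi.1 S.contDiffOn_Ω _)))

variable (S) in
theorem contDiffOn_matM4inv (α β : SympIdx n) :
    ContDiffOn ℝ ∞ (fun z => matM4inv S.Ω z α β) S.D := by
  have hN : ∀ i j, ContDiffOn ℝ ∞ (fun z => periodMatrix S.Ω z i j) S.D :=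
    contDiffOn_matrix_mul (S.contDiffOn_periodBlock _)
      (contDiffOn_matrix_inv (S.contDiffOn_periodBlock _) fun z hz => det_periodBlock_ne hz)
  have hR : ∀ i j, ContDiffOn ℝ ∞ (fun z => S.periodRe z i j) S.D :=
    fun i j => Complex.reCLM.contDiff.comp_contDiffOn (hN i j)
  have hJ : ∀ i j, ContDiffOn ℝ ∞ (fun z => S.periodIm z i j) S.D :=
    fun i j => Complex.imCLM.contDiff.comp_contDiffOn (hN i j)
  have hJi := contDiffOn_matrix_inv hJ fun z hz => det_periodIm_ne hz
  simp only [matM4inv_eq]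
  rcases α with i | i <;> rcases β with j | j <;>
    simp only [Matrix.fromBlocks_apply₁₁, Matrix.fromBlocks_apply₁₂, Matrix.fromBlocks_apply₂₁,
      Matrix.fromBlocks_apply₂₂, Matrix.add_apply, Matrix.neg_apply]
  · exact (hJ i j).add (contDiffOn_matrix_mul (contDiffOn_matrix_mul hR hJi) hR i j)
  · exact (contDiffOn_matrix_mul hR hJi i j).neg
  · exact (contDiffOn_matrix_mul hJi hR i j).neg
  · exact hJi i j

end SpecialKahler

end CMap

/-! ### The c-map metric and the existence of a lowering generator -/

namespace CMap

variable {n : ℕ}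

theorem formPhi_add (q v w : QSpace n) : formPhi q (v + w) = formPhi q v + formPhi q w := by
  simp only [formPhi, Prod.snd_add, Prod.fst_add, symp_add_right]; ring

theorem formPhi_smul (q : QSpace n) (c : ℝ) (v : QSpace n) :
    formPhi q (c • v) = c * formPhi q v := by
  simp only [formPhi, Prod.smul_snd, Prod.smul_fst, symp_smul_right, smul_eq_mul]; ring

theorem fderiv_ehlersZero (q v : QSpace n) :
    fderiv ℝ (ehlersZero n) q v = (0, -v.2.1, 0, -(1 / 2 : ℝ) • v.2.2.2) := by
  have hd : DifferentiableAt ℝ (ehlersZero n) q := by unfold ehlersZero; fun_prop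
  refine (hd.hasFDerivAt.hasLineDerivAt v).unique ?_
  have : HasDerivAt (fun t : ℝ => ehlersZero n q + t • ((0, -v.2.1, 0, -(1 / 2 : ℝ) • v.2.2.2) :
      QSpace n)) (0, -v.2.1, 0, -(1 / 2 : ℝ) • v.2.2.2) 0 := by
    simpa using ((hasDerivAt_id (0 : ℝ)).smul_const
      ((0, -v.2.1, 0, -(1 / 2 : ℝ) • v.2.2.2) : QSpace n)).const_add (ehlersZero n q)
  have e : (fun t : ℝ => ehlersZero n (q + t • v)) = fun t : ℝ => ehlersZero n q
      + t • ((0, -v.2.1, 0, -(1 / 2 : ℝ) • v.2.2.2) : QSpace n) := by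
    ext t <;> simp [ehlersZero] <;> ring
  rw [HasLineDerivAt, e]
  exact this

theorem contDiff_ehlersZero : ContDiff ℝ ∞ (ehlersZero n) := by unfold ehlersZero; fun_prop

namespace SpecialKahler

variable {S : SpecialKahler n}

theorem metric_eq (q v w : QSpace n) : S.metric q v w = (1 / 4) * (v.1 * w.1
    + 4 * (S.kahlerForm q.2.2.1 v.2.2.1 w.2.2.1).re
    + Real.exp (-2 * q.1) * (formPhi q v * formPhi q w)
    - 2 * Real.exp (-q.1) * (v.2.2.2 ⬝ᵥ (matM4inv S.Ω q.2.2.1 *ᵥ w.2.2.2))) := rfl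

theorem kahlerForm_add_left (z u v w : Fin n → ℂ) :
    S.kahlerForm z (u + v) w = S.kahlerForm z u w + S.kahlerForm z v w := by
  simp only [kahlerForm, ← Finset.sum_add_distrib, Pi.add_apply]
  exact Finset.sum_congr rfl fun i _ => Finset.sum_congr rfl fun j _ => by ring

theorem kahlerForm_add_right (z u v w : Fin n → ℂ) :
    S.kahlerForm z u (v + w) = S.kahlerForm z u v + S.kahlerForm z u w := by
  simp only [kahlerForm, ← Finset.sum_add_distrib, Pi.add_apply, map_add]
  exact Finset.sum_congr rfl fun i _ => Finset.sum_congr rfl fun j _ => by ring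

theorem kahlerForm_smul_left (z : Fin n → ℂ) (c : ℝ) (v w : Fin n → ℂ) :
    S.kahlerForm z (c • v) w = c * S.kahlerForm z v w := by
  simp only [kahlerForm, Finset.mul_sum, Pi.smul_apply, Complex.real_smul]
  exact Finset.sum_congr rfl fun i _ => Finset.sum_congr rfl fun j _ => by ring

theorem kahlerForm_smul_right (z : Fin n → ℂ) (c : ℝ) (v w : Fin n → ℂ) :
    S.kahlerForm z v (c • w) = c * S.kahlerForm z v w := by
  simp only [kahlerForm, Finset.mul_sum, Pi.smul_apply, Complex.real_smul, map_mul,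
    Complex.conj_ofReal]
  exact Finset.sum_congr rfl fun i _ => Finset.sum_congr rfl fun j _ => by ring

variable (S) in
/-- The metric of the `c`-map image as a bundled bilinear form. -/
noncomputable def metricCLM (q : QSpace n) : QSpace n →L[ℝ] QSpace n →L[ℝ] ℝ :=
  (LinearMap.mk₂ ℝ (S.metric q)
    (fun u v w => by
      simp only [metric_eq, formPhi_add, Prod.fst_add, Prod.snd_add, kahlerForm_add_left,
        Complex.add_re, add_dotProduct]
      ring)
    (fun c v w => by
      simp only [metric_eq, formPhi_smul, Prod.smul_fst, Prod.smul_snd, kahlerForm_smul_left,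
        Complex.re_ofReal_mul, smul_dotProduct, smul_eq_mul]
      ring)
    (fun u v w => by
      simp only [metric_eq, formPhi_add, Prod.fst_add, Prod.snd_add, kahlerForm_add_right,
        Complex.add_re, Matrix.mulVec_add, dotProduct_add]
      ring)
    (fun c v w => by
      simp only [metric_eq, formPhi_smul, Prod.smul_fst, Prod.smul_snd, kahlerForm_smul_right,
        Complex.re_ofReal_mul, Matrix.mulVec_smul, dotProduct_smul, smul_eq_mul]
      ring)).toContinuousBilinearMap

@[simp] theorem metricCLM_apply (q v w : QSpace n) : S.metricCLM q v w = S.metric q v w := rfl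

variable (S) in
theorem isOpen_carrier : IsOpen S.carrier :=
  S.isOpen_D.preimage (by fun_prop : Continuous fun q : QSpace n => q.2.2.1)

variable (S) in
theorem isPreconnected_carrier : IsPreconnected S.carrier := by
  have : S.carrier = Set.univ ×ˢ (Set.univ ×ˢ (S.D ×ˢ Set.univ)) := by
    ext q; simp [carrier]
  rw [this]
  exact isPreconnected_univ.prod (isPreconnected_univ.prod
    (S.isConnected_D.isPreconnected.prod isPreconnected_univ))

theorem _root_.ContDiffOn.comp_base {F : Type*} [NormedAddCommGroup F] [NormedSpace ℝ F]
    {f : (Fin n → ℂ) → F} (hf : ContDiffOn ℝ ∞ f S.D) :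
    ContDiffOn ℝ ∞ (fun q : QSpace n => f q.2.2.1) S.carrier :=
  hf.comp (by fun_prop) fun _ hq => hq

theorem contDiff_formPhi (v : QSpace n) : ContDiff ℝ ∞ (fun q : QSpace n => formPhi q v) := by
  simp only [formPhi, symp_eq]
  fun_prop

variable (S) in
theorem contDiffOn_metric (v w : QSpace n) : ContDiffOn ℝ ∞ (fun q => S.metric q v w) S.carrier := by
  have hM : ContDiffOn ℝ ∞ (fun q : QSpace n => v.2.2.2 ⬝ᵥ (matM4inv S.Ω q.2.2.1 *ᵥ w.2.2.2))
      S.carrier := by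
    simp only [dotProduct, Matrix.mulVec]
    exact ContDiffOn.sum fun i _ => contDiffOn_const.mul (ContDiffOn.sum fun j _ =>
      (S.contDiffOn_matM4inv i j).comp_base.mul contDiffOn_const)
  have hg : ContDiffOn ℝ ∞ (fun q : QSpace n => (S.kahlerForm q.2.2.1 v.2.2.1 w.2.2.1).re)
      S.carrier := Complex.reCLM.contDiff.comp_contDiffOn (S.contDiffOn_kahlerForm _ _).comp_base
  have e1 : ContDiff ℝ ∞ fun q : QSpace n => Real.exp (-2 * q.1) := by fun_prop
  have e2 : ContDiff ℝ ∞ fun q : QSpace n => 2 * Real.exp (-q.1) := by fun_prop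
  simp only [metric_eq]
  exact contDiffOn_const.mul (((contDiffOn_const.add (contDiffOn_const.mul hg)).add
    (e1.mul ((contDiff_formPhi v).mul (contDiff_formPhi w))).contDiffOn).sub
    (e2.contDiffOn.mul hM))

theorem metric_symm {q : QSpace n} (hq : q ∈ S.carrier) (v w : QSpace n) :
    S.metric q v w = S.metric q w v := by
  rw [metric_eq, metric_eq, matM4inv_symm hq v.2.2.2, ← kahlerForm_conj hq w.2.2.1, Complex.conj_re]
  ring

theorem metric_pos' {q : QSpace n} (hq : q ∈ S.carrier) {v : QSpace n} (hv : v ≠ 0) :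
    0 < S.metric q v v := by
  have hg : 0 ≤ (S.kahlerForm q.2.2.1 v.2.2.1 v.2.2.1).re := by
    by_cases h : v.2.2.1 = 0
    · simp [kahlerForm, h]
    · exact (S.metric_pos _ hq _ h).le
  have hM : v.2.2.2 ⬝ᵥ (matM4inv S.Ω q.2.2.1 *ᵥ v.2.2.2) ≤ 0 := by
    by_cases h : v.2.2.2 = 0
    · simp [h]
    · exact (matM4inv_neg hq h).le
  have e1 := Real.exp_pos (-2 * q.1)
  have e2 := Real.exp_pos (-q.1)
  rw [metric_eq]
  by_contra! hle
  have t1 : 0 ≤ v.1 * v.1 := mul_self_nonneg _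
  have t2 : 0 ≤ formPhi q v * formPhi q v := mul_self_nonneg _
  have t3 := mul_nonneg e1.le t2
  have t4 := mul_nonneg e2.le (neg_nonneg.2 hM)
  have a1 : v.1 = 0 := mul_self_eq_zero.1 (by linarith)
  have a2 : v.2.2.1 = 0 := by
    by_contra h
    have := S.metric_pos _ hq _ h
    rw [← kahlerForm] at this
    linarith
  have a3 : v.2.2.2 = 0 := by
    by_contra h
    have := mul_pos e2 (neg_pos.2 (matM4inv_neg hq h))
    linarith
  have a4 : formPhi q v = 0 := by
    have : Real.exp (-2 * q.1) * (formPhi q v * formPhi q v) = 0 := by linarith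
    exact mul_self_eq_zero.1 ((mul_eq_zero.1 this).resolve_left e1.ne')
  have a5 : v.2.1 = 0 := by simpa [formPhi, a3] using a4
  exact hv (Prod.ext a1 (Prod.ext a5 (Prod.ext a2 a3)))

variable (S) in
theorem riemannianOn_metricCLM : RiemannianOn S.metricCLM S.carrier where
  isOpen := S.isOpen_carrier
  contDiffOn := contDiffOn_clm_apply.2 fun v => contDiffOn_clm_apply.2 fun w =>
    S.contDiffOn_metric v w
  symm _ hx v w := metric_symm hx v w
  pos _ hx _ hv := metric_pos' hx hv

theorem fderiv_metricCLM {q : QSpace n} (hq : q ∈ S.carrier) (u v w : QSpace n) :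
    fderiv ℝ S.metricCLM q u v w = fderiv ℝ (fun x => S.metric x v w) q u := by
  have h := S.riemannianOn_metricCLM.contDiffOn.hasFDerivAt_of_isOpen S.isOpen_carrier hq
  have := ((h.clm_apply (hasFDerivAt_const v q)).clm_apply (hasFDerivAt_const w q)).fderiv
  simp only [metricCLM_apply] at this
  rw [this]
  simp

theorem isKilling_iff {X : QSpace n → QSpace n} :
    S.IsKilling X ↔ KillingOn S.metricCLM S.carrier X := by
  refine and_congr_right fun _ => forall₂_congr fun q hq => forall₂_congr fun v w => ?_
  rw [fderiv_metricCLM hq, metricCLM_apply, metricCLM_apply]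

/-- Without a base component in `u`, the Kähler metric and ℳ₄⁻¹ stay constant and Φ is affine in 𝐙,
so only exponentials and Φ are differentiated. -/
theorem hasLineDerivAt_metric (q v w : QSpace n) {u : QSpace n} (hu : u.2.2.1 = 0) :
    HasLineDerivAt ℝ (fun x => S.metric x v w) ((1 / 4) *
      (Real.exp (-2 * q.1) * (-2 * u.1 * (formPhi q v * formPhi q w)
        + (symp u.2.2.2 v.2.2.2 * formPhi q w + formPhi q v * symp u.2.2.2 w.2.2.2))
      + 2 * u.1 * Real.exp (-q.1) * (v.2.2.2 ⬝ᵥ (matM4inv S.Ω q.2.2.1 *ᵥ w.2.2.2)))) q u := by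
  have hφ : ∀ v : QSpace n, HasDerivAt (fun t : ℝ => formPhi q v + t * symp u.2.2.2 v.2.2.2)
      (symp u.2.2.2 v.2.2.2) 0 := fun v => by
    simpa using ((hasDerivAt_id (0 : ℝ)).mul_const (symp u.2.2.2 v.2.2.2)).const_add (formPhi q v)
  have hU : HasDerivAt (fun t : ℝ => q.1 + t * u.1) u.1 0 := by
    simpa using ((hasDerivAt_id (0 : ℝ)).mul_const u.1).const_add q.1
  have h1 := (hU.const_mul (-2)).exp.mul ((hφ v).mul (hφ w))
  have h2 := (hU.neg.exp.const_mul 2).mul_const (v.2.2.2 ⬝ᵥ (matM4inv S.Ω q.2.2.1 *ᵥ w.2.2.2))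
  have h3 := ((h1.const_add (v.1 * w.1
    + 4 * (S.kahlerForm q.2.2.1 v.2.2.1 w.2.2.1).re)).sub h2).const_mul (1 / 4)
  have e : (fun t : ℝ => S.metric (q + t • u) v w) = fun t => (1 / 4) * ((v.1 * w.1
      + 4 * (S.kahlerForm q.2.2.1 v.2.2.1 w.2.2.1).re
      + Real.exp (-2 * (q.1 + t * u.1)) * ((formPhi q v + t * symp u.2.2.2 v.2.2.2)
        * (formPhi q w + t * symp u.2.2.2 w.2.2.2)))
      - 2 * Real.exp (-(q.1 + t * u.1)) * (v.2.2.2 ⬝ᵥ (matM4inv S.Ω q.2.2.1 *ᵥ w.2.2.2))) := by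
    ext t
    simp only [metric_eq, formPhi, Prod.fst_add, Prod.snd_add, Prod.smul_fst, Prod.smul_snd, hu,
      smul_zero, add_zero, symp_add_left, symp_smul_left, smul_eq_mul]
    ring
  rw [HasLineDerivAt, e]
  refine h3.congr_deriv ?_
  simp
  ring

theorem fderiv_metric {q : QSpace n} (hq : q ∈ S.carrier) (v w : QSpace n) {u : QSpace n}
    (hu : u.2.2.1 = 0) : fderiv ℝ (fun x => S.metric x v w) q u = (1 / 4) *
      (Real.exp (-2 * q.1) * (-2 * u.1 * (formPhi q v * formPhi q w)
        + (symp u.2.2.2 v.2.2.2 * formPhi q w + formPhi q v * symp u.2.2.2 w.2.2.2))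
      + 2 * u.1 * Real.exp (-q.1) * (v.2.2.2 ⬝ᵥ (matM4inv S.Ω q.2.2.1 *ᵥ w.2.2.2))) :=
  fderiv_apply_eq_of_hasLineDerivAt (S.contDiffOn_metric v w) S.isOpen_carrier hq
    (hasLineDerivAt_metric q v w hu)

variable (S) in
theorem isKilling_ehlersZero : S.IsKilling (ehlersZero n) := by
  refine ⟨contDiff_ehlersZero.contDiffOn, fun q hq v w => ?_⟩
  rw [fderiv_metric hq v w rfl, fderiv_ehlersZero, fderiv_ehlersZero]
  simp only [metric_eq, ehlersZero, formPhi, symp_smul_left, symp_smul_right, smul_dotProduct,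
    Matrix.mulVec_smul, dotProduct_smul, smul_eq_mul]
  simp [kahlerForm]
  ring

/-- The lowering generator of the Ehlers algebra exists on a symmetric `c`-map image. -/
theorem IsSymmetric.exists_isEhlersMinus (hS : S.IsSymmetric) :
    ∃ L : QSpace n → QSpace n, S.IsEhlersMinus L := by
  obtain ⟨z₀, hz₀⟩ := S.isConnected_D.nonempty
  -- At this point L₀ = −∂_U, DL₀ is symmetric for h, and h(∂_U, ·) has constant coefficients, so
  -- h(L₀, ·) is closed there. Moreover L₀ is half the gradient of h(L₊, L₊) = ¼ e^{-2U}.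
  set p : QSpace n := (0, 0, z₀, 0) with hp_def
  have hp : p ∈ S.carrier := hz₀
  obtain ⟨σ, h1, h2, h3, h4, h5, h6⟩ := hS p hp
  have I : IsometricInvolutionOn S.metricCLM S.carrier σ := ⟨h1, h2, h3, h6⟩
  obtain ⟨L, hL, hL0, hLp⟩ := I.exists_lowering S.riemannianOn_metricCLM S.isPreconnected_carrier hp
    h4 h5 (e := (0, -1, 0, 0))
    (fun x hx => by
      ext v w <;>
      · simp only [fderiv_metricCLM hx, ContinuousLinearMap.comp_apply]
        rw [fderiv_metric hx _ _ rfl]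
        simp)
    (isKilling_iff.1 S.isKilling_ehlersZero)
    (fun v w => by
      have e : ∀ v w : QSpace n, fderiv ℝ S.metricCLM p v (ehlersZero n p) w = 0 := by
        intro v w
        rw [fderiv_metricCLM hp]
        have : (fun x => S.metric x (ehlersZero n p) w) = fun _ => -(1 / 4) * w.1 := by
          ext x
          simp [metric_eq, ehlersZero, hp_def, formPhi, kahlerForm]
        simp [this]
      have hs := matM4inv_symm hz₀ v.2.2.2 w.2.2.2
      rw [e, e, fderiv_ehlersZero, fderiv_ehlersZero]
      simp only [metricCLM_apply, metric_eq, formPhi, hp_def, smul_dotProduct,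
        Matrix.mulVec_smul, dotProduct_smul, smul_eq_mul, hs]
      simp [kahlerForm])
    (fun x _ => by
      simp [VectorField.lieBracket_eq, fderiv_ehlersZero])
    (fun w => by
      rw [fderiv_metricCLM hp]
      have e : (fun x : QSpace n => S.metric x (0, -1, 0, 0) (0, -1, 0, 0))
          = fun x => (1 / 4) * Real.exp (-2 * x.1) := by
        ext x
        simp [metric_eq, formPhi, kahlerForm]
      have h : HasFDerivAt (fun x : QSpace n => (1 / 4) * Real.exp (-2 * x.1))
          ((1 / 4 : ℝ) • (Real.exp (-2 * p.1) • ((-2 : ℝ) • ContinuousLinearMap.fst ℝ ℝ _))) p :=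
        ((hasFDerivAt_fst.const_mul (-2)).exp).const_mul (1 / 4)
      rw [e, h.fderiv]
      simp [metric_eq, ehlersZero, hp_def, formPhi, kahlerForm]
      ring)
  exact ⟨L, isKilling_iff.2 hL, hL0, hLp⟩

end SpecialKahler

end CMap

namespace CMap

variable {n : ℕ}

/-! ### The lowering generator along the locus `𝐙 = 0` -/

/-- The coordinate direction `∂_U`. -/
abbrev dirU (n : ℕ) : QSpace n := (1, 0, 0, 0)

/-- The coordinate direction `∂_a`. -/
abbrev dirA (n : ℕ) : QSpace n := (0, 1, 0, 0)

/-- The direction `ζ^α ∂_α`. -/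
abbrev dirZ (ζ : SympIdx n → ℝ) : QSpace n := (0, 0, 0, ζ)

/-- At 𝐙 = 0 the second derivative in the product rule is evaluated on the zero vector and
disappears. This linearizes the Euler terms coming from ½ 𝐙^α ∂_α. -/
theorem hasLineDerivAt_fderiv_dirZ {F : Type*} [NormedAddCommGroup F] [NormedSpace ℝ F]
    {f : QSpace n → F} {s : Set (QSpace n)} (hs : IsOpen s) (hf : ContDiffOn ℝ ∞ f s)
    {q : QSpace n} (hq : q ∈ s) (hZ : q.2.2.2 = 0) (w : QSpace n) :
    HasLineDerivAt ℝ (fun x => fderiv ℝ f x (dirZ x.2.2.2)) (fderiv ℝ f q (dirZ w.2.2.2)) q w := by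
  have h1 := (hf.fderiv_infty hs).hasLineDerivAt hs hq w
  have h2 : HasDerivAt (fun t : ℝ => dirZ (q + t • w).2.2.2) (dirZ w.2.2.2) 0 := by
    have : HasDerivAt (fun t : ℝ => t • dirZ w.2.2.2) (dirZ w.2.2.2) 0 := by
      simpa using (hasDerivAt_id (0 : ℝ)).smul_const (dirZ w.2.2.2)
    refine this.congr_of_eventuallyEq (Filter.Eventually.of_forall fun t => ?_)
    simp [hZ]
  refine (HasDerivAt.clm_apply h1 h2).congr_deriv ?_
  have e : dirZ (0 : SympIdx n → ℝ) = 0 := rfl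
  simp [hZ, e]

namespace SpecialKahler

variable {S : SpecialKahler n} {L : QSpace n → QSpace n}

theorem mem_carrier {U a : ℝ} {z : Fin n → ℂ} {ζ : SympIdx n → ℝ} :
    ((U, a, z, ζ) : QSpace n) ∈ S.carrier ↔ z ∈ S.D := Iff.rfl

namespace IsEhlersMinus

theorem fderiv_dirA (hL : S.IsEhlersMinus L) {q : QSpace n} (hq : q ∈ S.carrier) :
    fderiv ℝ L q (dirA n) = (2, 2 * q.2.1, 0, q.2.2.2) := by
  have h := hL.2.2 q hq
  rw [VectorField.lieBracket_eq] at h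
  have e : ehlersPlus n = fun _ => -dirA n := by
    ext x <;> simp [ehlersPlus]
  rw [e] at h
  simp only [fderiv_fun_const, map_neg, Pi.zero_apply, _root_.zero_apply, sub_zero] at h
  rw [neg_eq_iff_eq_neg] at h
  rw [h]
  ext <;> simp [ehlersZero]

/-- The relation [L₀, L₋] = −L₋ solved for ∂_U L₋, with ∂_a L₋ inserted from the other bracket. The
Euler term in 𝐙 remains and drops out on the locus. -/
theorem fderiv_dirU (hL : S.IsEhlersMinus L) {q : QSpace n} (hq : q ∈ S.carrier) :
    fderiv ℝ L q (dirU n) = L q + (0, (L q).2.1, 0, (1 / 2 : ℝ) • (L q).2.2.2)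
      - q.2.1 • ((2, 2 * q.2.1, 0, q.2.2.2) : QSpace n)
      - (1 / 2 : ℝ) • fderiv ℝ L q (dirZ q.2.2.2) := by
  have h := hL.2.1 q hq
  rw [VectorField.lieBracket_eq] at h
  simp only [fderiv_ehlersZero] at h
  have e : ehlersZero n q = -dirU n - q.2.1 • dirA n - (1 / 2 : ℝ) • dirZ q.2.2.2 := by
    ext <;> simp [ehlersZero]
  rw [e, map_sub, map_sub, map_neg, map_smul, map_smul, hL.fderiv_dirA hq] at h
  have h2 : fderiv ℝ L q (dirU n) = -(-fderiv ℝ L q (dirU n)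
      - q.2.1 • ((2, 2 * q.2.1, 0, q.2.2.2) : QSpace n)
      - (1 / 2 : ℝ) • fderiv ℝ L q (dirZ q.2.2.2)
      - (0, -(L q).2.1, 0, -(1 / 2 : ℝ) • (L q).2.2.2))
      - q.2.1 • ((2, 2 * q.2.1, 0, q.2.2.2) : QSpace n)
      - (1 / 2 : ℝ) • fderiv ℝ L q (dirZ q.2.2.2)
      - (0, -(L q).2.1, 0, -(1 / 2 : ℝ) • (L q).2.2.2) := by abel
  rw [h2, h]
  ext <;> simp <;> ring

/-- The Killing equation in the direction `∂_U`. -/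
theorem metric_fderiv_dirU (hL : S.IsEhlersMinus L) {q : QSpace n} (hq : q ∈ S.carrier)
    (w : QSpace n) : S.metric q (fderiv ℝ L q (dirU n)) w + (1 / 4) * (fderiv ℝ L q w).1 = 0 := by
  have e : ∀ (x w : QSpace n), S.metric x (dirU n) w = (1 / 4) * w.1 := by
    intro x w
    simp [metric_eq, formPhi, kahlerForm]
  have h := hL.1.2 q hq (dirU n) w
  simp only [e] at h
  simpa using h

theorem fderiv_dirU_fst (hL : S.IsEhlersMinus L) {q : QSpace n} (hq : q ∈ S.carrier) :
    (fderiv ℝ L q (dirU n)).1 = 0 := by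
  have h := hL.metric_fderiv_dirU hq (dirU n)
  rw [metric_symm hq] at h
  simp [metric_eq, formPhi, kahlerForm] at h
  linarith

theorem fst_eq (hL : S.IsEhlersMinus L) {q : QSpace n} (hq : q ∈ S.carrier) :
    (L q).1 = 2 * q.2.1 + (1 / 2) * (fderiv ℝ L q (dirZ q.2.2.2)).1 := by
  have h := hL.fderiv_dirU_fst hq
  rw [hL.fderiv_dirU hq] at h
  simp at h
  linarith

/-- Linearizing L^U = 2a + ½ 𝐙^α ∂_α L^U at 𝐙 = 0 along ζ gives D_ζ L^U = ½ D_ζ L^U, hence zero; the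
base derivatives then vanish too. -/
theorem fderiv_fst (hL : S.IsEhlersMinus L) {q : QSpace n} (hq : q ∈ S.carrier)
    (hZ : q.2.2.2 = 0) (v : Fin n → ℂ) (ζ : SympIdx n → ℝ) :
    (fderiv ℝ L q ((0, 0, v, ζ) : QSpace n)).1 = 0 := by
  have key : ∀ w : QSpace n, (fderiv ℝ L q w).1
      = 2 * w.2.1 + (1 / 2) * (fderiv ℝ L q (dirZ w.2.2.2)).1 := by
    intro w
    have h1 := hasLineDerivAt_fderiv_dirZ S.isOpen_carrier hL.1.1 hq hZ w
    have h2 := hL.1.1.hasLineDerivAt S.isOpen_carrier hq w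
    have f1 := (ContinuousLinearMap.fst ℝ ℝ (ℝ × (Fin n → ℂ) × (SympIdx n → ℝ))).hasFDerivAt
      |>.comp_hasDerivAt _ h1
    have f2 := (ContinuousLinearMap.fst ℝ ℝ (ℝ × (Fin n → ℂ) × (SympIdx n → ℝ))).hasFDerivAt
      |>.comp_hasDerivAt _ h2
    have f3 : HasDerivAt (fun t : ℝ => 2 * (q + t • w).2.1) (2 * w.2.1) 0 := by
      have : HasDerivAt (fun t : ℝ => 2 * (q.2.1 + t * w.2.1)) (2 * w.2.1) 0 := by
        simpa using (((hasDerivAt_id (0 : ℝ)).mul_const w.2.1).const_add q.2.1).const_mul 2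
      exact this
    exact HasLineDerivAt.eq_of_eqOn S.isOpen_carrier hq (fun x hx => hL.fst_eq hx) f2
      (f3.add (f1.const_mul (1 / 2)))
  have k1 := key (dirZ ζ)
  have k2 := key (0, 0, v, ζ)
  simp only at k1 k2
  rw [k2]
  linarith

/-- The Killing equations along `𝐙 = 0` in the direction `∂_U`. -/
theorem fderiv_dirU_of_locus (hL : S.IsEhlersMinus L) {q : QSpace n} (hq : q ∈ S.carrier)
    (hZ : q.2.2.2 = 0) : fderiv ℝ L q (dirU n) = (0, -2 * Real.exp (2 * q.1), 0, 0) := by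
  set X := fderiv ℝ L q (dirU n) with hX
  have h0 : X.1 = 0 := hL.fderiv_dirU_fst hq
  have h1 := hL.metric_fderiv_dirU hq (dirA n)
  rw [← hX, hL.fderiv_dirA hq] at h1
  have ee : Real.exp (-2 * q.1) * Real.exp (2 * q.1) = 1 := by
    rw [← Real.exp_add]; simp
  have h1' : X.2.1 = -2 * Real.exp (2 * q.1) := by
    simp [metric_eq, formPhi, hZ, kahlerForm] at h1
    have : Real.exp (-2 * q.1) * X.2.1 = -2 := by rw [neg_mul]; linarith
    calc X.2.1 = (Real.exp (-2 * q.1) * Real.exp (2 * q.1)) * X.2.1 := by rw [ee, one_mul]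
      _ = (Real.exp (-2 * q.1) * X.2.1) * Real.exp (2 * q.1) := by ring
      _ = _ := by rw [this]
  -- The remaining components are paired with themselves: the Killing equation makes their norm
  -- zero, and h is positive definite.
  set Y : QSpace n := (0, 0, X.2.2.1, X.2.2.2) with hY
  have h2 := hL.metric_fderiv_dirU hq Y
  rw [← hX, hL.fderiv_fst hq hZ] at h2
  have h3 : S.metric q Y Y = 0 := by
    have : S.metric q X Y = S.metric q Y Y := by
      simp [metric_eq, formPhi, hZ, hY]
    linarith
  have h4 : Y = 0 := by
    by_contra hne
    exact (metric_pos' hq hne).ne' h3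
  have h5 : X.2.2.1 = 0 := congrArg (fun y : QSpace n => y.2.2.1) h4
  have h6 : X.2.2.2 = 0 := congrArg (fun y : QSpace n => y.2.2.2) h4
  exact Prod.ext h0 (Prod.ext h1' (Prod.ext h5 h6))

/-- Every lowering generator agrees with that of `SL(2)/U(1)` along `𝐙 = 0`. -/
theorem eq_of_locus (hL : S.IsEhlersMinus L) {q : QSpace n} (hq : q ∈ S.carrier)
    (hZ : q.2.2.2 = 0) : L q = (2 * q.2.1, q.2.1 ^ 2 - Real.exp (2 * q.1), 0, 0) := by
  -- With ∂_U L₋ known and 𝐙 = 0, the weight relation is an algebraic equation for the components of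
  -- L₋.
  have h := hL.fderiv_dirU hq
  have e : dirZ (0 : SympIdx n → ℝ) = 0 := rfl
  rw [hL.fderiv_dirU_of_locus hq hZ, hZ, e, map_zero, smul_zero, sub_zero] at h
  have h1 := congrArg (fun y : QSpace n => y.1) h
  have h2 := congrArg (fun y : QSpace n => y.2.1) h
  have h3 := congrArg (fun y : QSpace n => y.2.2.1) h
  have h4 := congrArg (fun y : QSpace n => y.2.2.2) h
  simp at h1 h2 h3 h4
  refine Prod.ext ?_ (Prod.ext ?_ (Prod.ext ?_ ?_))
  · simp only; linarith
  · simp only; linarith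
  · exact h3.symm
  · have : (3 / 2 : ℝ) • (L q).2.2.2 = 0 := by
      rw [show (3 / 2 : ℝ) = 1 + 2⁻¹ by norm_num, add_smul, one_smul]
      exact h4.symm
    exact (smul_eq_zero.1 this).resolve_left (by norm_num)

/-- Write G for the 𝐙-component of D_ζ L₋. Differentiating the 𝐙-component of the weight relation
along ζ at 𝐙 = 0 gives (3/2) G − aζ − ½ G. -/
theorem hasDerivAt_fderiv_dirZ (hL : S.IsEhlersMinus L) (U a : ℝ) {z : Fin n → ℂ} (hz : z ∈ S.D)
    (ζ : SympIdx n → ℝ) :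
    HasDerivAt (fun u : ℝ => (fderiv ℝ L ((u, a, z, 0) : QSpace n) (dirZ ζ)).2.2.2)
      ((fderiv ℝ L ((U, a, z, 0) : QSpace n) (dirZ ζ)).2.2.2 - a • ζ) U := by
  set q : QSpace n := (U, a, z, 0) with hq_def
  have hq : q ∈ S.carrier := hz
  have hs := S.isOpen_carrier
  set π : QSpace n →L[ℝ] (SympIdx n → ℝ) := (ContinuousLinearMap.snd ℝ _ _).comp
    ((ContinuousLinearMap.snd ℝ _ _).comp (ContinuousLinearMap.snd ℝ _ _)) with hπ
  have hL2 := (hL.1.1.fderiv_infty hs).hasFDerivAt_of_isOpen hs hq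
  have a1 := ((hL2.clm_apply (hasFDerivAt_const (dirU n) q)).hasLineDerivAt (dirZ ζ))
  have b1 := π.hasFDerivAt.comp_hasDerivAt _ a1
  have a2 := hL.1.1.hasLineDerivAt hs hq (dirZ ζ)
  have b2 := π.hasFDerivAt.comp_hasDerivAt _ a2
  have a3 := hasLineDerivAt_fderiv_dirZ hs hL.1.1 hq rfl (dirZ ζ)
  have b3 := π.hasFDerivAt.comp_hasDerivAt _ a3
  have b4 : HasDerivAt (fun t : ℝ => (q + t • dirZ ζ).2.1 • (q + t • dirZ ζ).2.2.2) (a • ζ) 0 := by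
    have : HasDerivAt (fun t : ℝ => t • (a • ζ)) (a • ζ) 0 := by
      simpa using (hasDerivAt_id (0 : ℝ)).smul_const (a • ζ)
    refine this.congr_of_eventuallyEq (Filter.Eventually.of_forall fun t => ?_)
    simp [hq_def, smul_comm t a]
  have key := HasLineDerivAt.eq_of_eqOn hs hq (f := fun x => π (fderiv ℝ L x (dirU n)))
    (g := fun x => (3 / 2 : ℝ) • π (L x) - x.2.1 • x.2.2.2
      - (1 / 2 : ℝ) • π (fderiv ℝ L x (dirZ x.2.2.2)))
    (fun x hx => by
      rw [hL.fderiv_dirU hx]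
      ext α
      simp [hπ]
      ring) b1 (((b2.const_smul (3 / 2 : ℝ)).sub b4).sub (b3.const_smul (1 / 2 : ℝ)))
  have a5 := (hL2.clm_apply (hasFDerivAt_const (dirZ ζ) q)).hasLineDerivAt (dirU n)
  have b5 := π.hasFDerivAt.comp_hasDerivAt _ a5
  have e5 : HasDerivAt (fun t : ℝ => (fderiv ℝ L ((U + t, a, z, 0) : QSpace n) (dirZ ζ)).2.2.2)
      ((fderiv ℝ L q (dirZ ζ)).2.2.2 - a • ζ) 0 := by
    refine (b5.congr_deriv ?_).congr_of_eventuallyEq (Filter.Eventually.of_forall fun t => ?_)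
    · simp only [_root_.add_apply, ContinuousLinearMap.comp_apply, _root_.zero_apply, map_zero,
        ContinuousLinearMap.flip_apply, zero_add] at key ⊢
      rw [hL.1.1.fderiv_fderiv_comm hs hq, key]
      ext α
      simp [hπ]
      ring
    · simp [hπ, hq_def]
  have := HasDerivAt.comp_sub_const (f := fun t : ℝ =>
    (fderiv ℝ L ((U + t, a, z, 0) : QSpace n) (dirZ ζ)).2.2.2) U U (by simpa using e5)
  simpa using this

/-- The solution of G' = G − aζ. The vector `η` is left unknown; its factor e^U will suffice to
eliminate it. -/
theorem fderiv_dirZ_of_locus (hL : S.IsEhlersMinus L) (a : ℝ) {z : Fin n → ℂ} (hz : z ∈ S.D)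
    (ζ : SympIdx n → ℝ) : ∃ η : SympIdx n → ℝ, ∀ U : ℝ,
      (fderiv ℝ L ((U, a, z, 0) : QSpace n) (dirZ ζ)).2.2.2 = a • ζ + Real.exp U • η := by
  set G : ℝ → SympIdx n → ℝ := fun U => (fderiv ℝ L ((U, a, z, 0) : QSpace n) (dirZ ζ)).2.2.2
  have hG : ∀ U, HasDerivAt G (G U - a • ζ) U := fun U => hL.hasDerivAt_fderiv_dirZ U a hz ζ
  have hH : ∀ U, HasDerivAt (fun U => Real.exp (-U) • (G U - a • ζ)) 0 U := by
    intro U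
    refine ((hasDerivAt_id U).neg.exp.smul ((hG U).sub_const (a • ζ))).congr_deriv ?_
    simp
  refine ⟨G 0 - a • ζ, fun U => ?_⟩
  have := is_const_of_deriv_eq_zero (fun U => (hH U).differentiableAt) (fun U => (hH U).deriv) U 0
  simp only [neg_zero, Real.exp_zero, one_smul] at this
  rw [← this, smul_smul, ← Real.exp_add, add_neg_cancel, Real.exp_zero, one_smul]
  simp [G]

end IsEhlersMinus

end SpecialKahler

end CMap

namespace CMap

variable {n : ℕ}

namespace SpecialKahler

variable {S : SpecialKahler n}

/-! ### The `su(2)` connection and its curvature -/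

variable (S) in
/-- The diagonal entry of the `su(2)` connection. -/
noncomputable def omegaDiag (q v : QSpace n) : ℂ :=
  -(Complex.I / 2) * (connQ S.Ω q.2.2.1 v.2.2.1 : ℂ)
    - (Complex.I / 4) * ((Real.exp (-q.1) * formPhi q v : ℝ) : ℂ)

variable (S) in
/-- The pairing `Vᵀ ℂ ζ`. -/
noncomputable def pairV (z : Fin n → ℂ) (ζ : SympIdx n → ℝ) : ℂ :=
  symp (secV S.Ω z) (fun α => (ζ α : ℂ))

variable (S) in
/-- The off-diagonal entry of the `su(2)` connection. -/
noncomputable def omegaOff (q v : QSpace n) : ℂ :=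
  (Real.exp (-q.1 / 2) : ℂ) * S.pairV q.2.2.1 v.2.2.2

theorem omega_eq (q v : QSpace n) : S.omega q v
    = !![S.omegaDiag q v, S.omegaOff q v; -(conj (S.omegaOff q v)), -S.omegaDiag q v] := rfl

theorem pairV_add (z : Fin n → ℂ) (ζ η : SympIdx n → ℝ) :
    S.pairV z (ζ + η) = S.pairV z ζ + S.pairV z η := by
  rw [pairV, pairV, pairV, ← symp_add_right]
  congr 1
  ext α
  simp

theorem pairV_smul (z : Fin n → ℂ) (c : ℝ) (ζ : SympIdx n → ℝ) :
    S.pairV z (c • ζ) = c * S.pairV z ζ := by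
  rw [pairV, pairV, ← symp_smul_right]
  congr 1
  ext α
  simp

@[simp] theorem pairV_zero (z : Fin n → ℂ) : S.pairV z 0 = 0 := by
  simpa using S.pairV_smul z 0 0

theorem connQ_eq {z : Fin n → ℂ} (hz : z ∈ S.D) (v : Fin n → ℂ) :
    connQ S.Ω z v = (S.dY z v / hermNorm S.Ω z).im := by
  rw [connQ, sum_dKahler_mul hz, Complex.neg_im, neg_neg]

@[simp] theorem connQ_zero (z : Fin n → ℂ) : connQ S.Ω z 0 = 0 := by
  simp [connQ]

variable (S) in
theorem contDiffOn_omegaDiag (v : QSpace n) :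
    ContDiffOn ℝ ∞ (fun q => S.omegaDiag q v) S.carrier := by
  have hY : ContDiffOn ℝ ∞ (fun z => (hermNorm S.Ω z : ℂ)) S.D :=
    Complex.ofRealCLM.contDiff.comp_contDiffOn S.contDiffOn_hermNorm
  have hQ : ContDiffOn ℝ ∞ (fun z => (connQ S.Ω z v.2.2.1 : ℂ)) S.D := by
    refine Complex.ofRealCLM.contDiff.comp_contDiffOn (ContDiffOn.congr ?_ fun z hz =>
      connQ_eq hz v.2.2.1)
    exact Complex.imCLM.contDiff.comp_contDiffOn
      (((S.contDiffOn_dΩ _).herm S.contDiffOn_Ω).div_complex hY fun z hz => hermNorm_ne hz)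
  have he : ContDiff ℝ ∞ (fun q : QSpace n => Real.exp (-q.1)) := by fun_prop
  have hφ : ContDiff ℝ ∞ (fun q : QSpace n => ((Real.exp (-q.1) * formPhi q v : ℝ) : ℂ)) :=
    Complex.ofRealCLM.contDiff.comp (he.mul (contDiff_formPhi v))
  exact (contDiffOn_const.mul hQ.comp_base).sub (contDiff_const.mul hφ).contDiffOn

variable (S) in
theorem contDiffOn_omegaOff (v : QSpace n) :
    ContDiffOn ℝ ∞ (fun q => S.omegaOff q v) S.carrier := by
  have he : ContDiff ℝ ∞ (fun q : QSpace n => (Real.exp (-q.1 / 2) : ℂ)) :=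
    Complex.ofRealCLM.contDiff.comp (by fun_prop : ContDiff ℝ ∞ fun q : QSpace n =>
      Real.exp (-q.1 / 2))
  have hV : ContDiffOn ℝ ∞ (fun z => S.pairV z v.2.2.2) S.D :=
    (contDiffOn_pi.2 fun α => S.contDiffOn_secV α).symp contDiffOn_const
  exact he.contDiffOn.mul hV.comp_base

/-- Under either alternative the 𝒬-term is constant along `u`, so only the Φ-term contributes. -/
theorem fderiv_omegaDiag {q : QSpace n} (hq : q ∈ S.carrier) {u w : QSpace n}
    (h : u.2.2.1 = 0 ∨ w.2.2.1 = 0) :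
    fderiv ℝ (fun x => S.omegaDiag x w) q u = -(Complex.I / 4) *
      ((Real.exp (-q.1) * (-u.1 * formPhi q w + symp u.2.2.2 w.2.2.2) : ℝ) : ℂ) := by
  refine fderiv_apply_eq_of_hasLineDerivAt (S.contDiffOn_omegaDiag w) S.isOpen_carrier hq ?_
  have hφ : HasDerivAt (fun t : ℝ => formPhi q w + t * symp u.2.2.2 w.2.2.2)
      (symp u.2.2.2 w.2.2.2) 0 := by
    simpa using ((hasDerivAt_id (0 : ℝ)).mul_const (symp u.2.2.2 w.2.2.2)).const_add (formPhi q w)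
  have hU : HasDerivAt (fun t : ℝ => q.1 + t * u.1) u.1 0 := by
    simpa using ((hasDerivAt_id (0 : ℝ)).mul_const u.1).const_add q.1
  have h1 := (((hU.neg.exp.mul hφ).ofReal_comp).const_mul (Complex.I / 4)).const_sub
    (-(Complex.I / 2) * (connQ S.Ω q.2.2.1 w.2.2.1 : ℂ))
  have e : (fun t : ℝ => S.omegaDiag (q + t • u) w) = fun t =>
      -(Complex.I / 2) * (connQ S.Ω q.2.2.1 w.2.2.1 : ℂ) - (Complex.I / 4) *
      ((Real.exp (-(q.1 + t * u.1)) * (formPhi q w + t * symp u.2.2.2 w.2.2.2) : ℝ) : ℂ) := by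
    ext t
    have hc : connQ S.Ω (q + t • u).2.2.1 w.2.2.1 = connQ S.Ω q.2.2.1 w.2.2.1 := by
      rcases h with h | h
      · simp [h]
      · simp [h]
    rw [omegaDiag, hc]
    simp only [formPhi, Prod.fst_add, Prod.snd_add, Prod.smul_fst, Prod.smul_snd, symp_add_left,
      symp_smul_left, smul_eq_mul, add_assoc]
  rw [HasLineDerivAt, e]
  refine h1.congr_deriv ?_
  simp
  ring

theorem fderiv_omegaOff {q : QSpace n} (hq : q ∈ S.carrier) (u w : QSpace n) :
    fderiv ℝ (fun x => S.omegaOff x w) q u = (Real.exp (-q.1 / 2) : ℂ) *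
      (-(u.1 / 2 : ℂ) * S.pairV q.2.2.1 w.2.2.2
        + symp ((Real.exp (kahlerPotential S.Ω q.2.2.1 / 2) : ℂ) • (S.dΩ q.2.2.1 u.2.2.1
          - ((S.dY q.2.2.1 u.2.2.1).re / hermNorm S.Ω q.2.2.1 : ℂ) • S.Ω q.2.2.1))
          (fun α => (w.2.2.2 α : ℂ))) := by
  refine fderiv_apply_eq_of_hasLineDerivAt (S.contDiffOn_omegaOff w) S.isOpen_carrier hq ?_
  have hU : HasDerivAt (fun t : ℝ => -(q.1 + t * u.1) / 2) (-u.1 / 2) 0 := by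
    have := (((hasDerivAt_id (0 : ℝ)).mul_const u.1).const_add q.1).neg.div_const 2
    simpa using this
  have hV := (hasLineDerivAt_secV (S := S) hq u.2.2.1).symp
    ((hasFDerivAt_const (fun α => (w.2.2.2 α : ℂ)) q.2.2.1).hasLineDerivAt u.2.2.1)
  have h1 := HasDerivAt.mul hU.exp.ofReal_comp hV
  refine h1.congr_deriv ?_
  simp [pairV]
  ring

theorem curvature_diag (q v w : QSpace n) : S.curvature q v w 0 0
    = fderiv ℝ (fun x => S.omegaDiag x w) q v - fderiv ℝ (fun x => S.omegaDiag x v) q w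
      + (S.omegaOff q w * conj (S.omegaOff q v) - S.omegaOff q v * conj (S.omegaOff q w)) := by
  simp only [curvature, matDeriv, omega_eq, Matrix.add_apply, Matrix.sub_apply, Matrix.of_apply,
    Matrix.mul_apply, Fin.sum_univ_two]
  simp
  ring

theorem curvature_off (q v w : QSpace n) : S.curvature q v w 0 1
    = fderiv ℝ (fun x => S.omegaOff x w) q v - fderiv ℝ (fun x => S.omegaOff x v) q w
      + 2 * (S.omegaDiag q v * S.omegaOff q w - S.omegaDiag q w * S.omegaOff q v) := by
  simp only [curvature, matDeriv, omega_eq, Matrix.add_apply, Matrix.sub_apply, Matrix.of_apply,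
    Matrix.mul_apply, Fin.sum_univ_two]
  simp
  ring

namespace IsMomentMap

variable {X : QSpace n → QSpace n} {𝔓 : QSpace n → Matrix (Fin 2) (Fin 2) ℂ} {q : QSpace n}

theorem apply_one_zero (h : S.IsMomentMap X 𝔓) (hq : q ∈ S.carrier) :
    𝔓 q 1 0 = -conj (𝔓 q 0 1) := by
  have := congrFun (congrFun (h.2.1 q hq).1 1) 0
  simp only [Matrix.conjTranspose_apply, Matrix.neg_apply, Complex.star_def] at this
  rw [this, neg_neg]

theorem apply_one_one (h : S.IsMomentMap X 𝔓) (hq : q ∈ S.carrier) : 𝔓 q 1 1 = -𝔓 q 0 0 := by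
  have := (h.2.1 q hq).2
  rw [Matrix.trace_fin_two] at this
  linear_combination this

theorem conj_diag (h : S.IsMomentMap X 𝔓) (hq : q ∈ S.carrier) :
    conj (𝔓 q 0 0) = -𝔓 q 0 0 := by
  have := congrFun (congrFun (h.2.1 q hq).1 0) 0
  simpa only [Matrix.conjTranspose_apply, Matrix.neg_apply, Complex.star_def] using this

theorem eq_off (h : S.IsMomentMap X 𝔓) (hq : q ∈ S.carrier) (v : QSpace n) :
    fderiv ℝ (fun x => 𝔓 x 0 1) q v
      + (2 * S.omegaDiag q v * 𝔓 q 0 1 - 2 * S.omegaOff q v * 𝔓 q 0 0)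
      = S.curvature q (X q) v 0 1 := by
  rw [h.2.2 q hq v]
  simp only [matDeriv, omega_eq, Matrix.add_apply, Matrix.sub_apply, Matrix.of_apply,
    Matrix.mul_apply, Fin.sum_univ_two, h.apply_one_one hq]
  simp
  ring

theorem eq_diag (h : S.IsMomentMap X 𝔓) (hq : q ∈ S.carrier) (v : QSpace n) :
    fderiv ℝ (fun x => 𝔓 x 0 0) q v
      + (𝔓 q 0 1 * conj (S.omegaOff q v) - S.omegaOff q v * conj (𝔓 q 0 1))
      = S.curvature q (X q) v 0 0 := by
  rw [h.2.2 q hq v]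
  simp only [matDeriv, omega_eq, Matrix.add_apply, Matrix.sub_apply, Matrix.of_apply,
    Matrix.mul_apply, Fin.sum_univ_two, h.apply_one_zero hq]
  simp
  ring

@[simp] theorem _root_.CMap.SpecialKahler.omegaOff_of_zero {v : QSpace n} (hv : v.2.2.2 = 0) :
    S.omegaOff q v = 0 := by simp [omegaOff, hv]

/-- No condition on 𝐙 is imposed, so that the identity can be differentiated transversally to the
locus. -/
theorem fderiv_off_dirU (h : S.IsMomentMap X 𝔓) (hq : q ∈ S.carrier) :
    fderiv ℝ (fun x => 𝔓 x 0 1) q (dirU n)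
      = (1 / 2) * (Real.exp (-q.1 / 2) : ℂ) * S.pairV q.2.2.1 (X q).2.2.2 := by
  have := h.eq_off hq (dirU n)
  rw [curvature_off, fderiv_omegaOff hq, fderiv_omegaOff hq] at this
  have e2 : S.omegaDiag q (dirU n) = 0 := by simp [omegaDiag, formPhi]
  have e3 : ∀ A : SympIdx n → ℂ, symp A (fun _ => (0 : ℂ)) = 0 := symp_zero_right
  simp [e2, e3, dΩ, dY, herm] at this
  rw [this]
  push_cast
  ring

/-- With no 𝐙-component in X the curvature term has no off-diagonal entry here; what remains is the
rotation of 𝔓₀₁ by the connection −(i/4) e^{-U} Φ. -/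
theorem fderiv_off_dirA (h : S.IsMomentMap X 𝔓) (hq : q ∈ S.carrier)
    (hX : (X q).2.2.2 = 0) :
    fderiv ℝ (fun x => 𝔓 x 0 1) q (dirA n)
      = (Complex.I / 2) * (Real.exp (-q.1) : ℂ) * 𝔓 q 0 1 := by
  have := h.eq_off hq (dirA n)
  rw [curvature_off, fderiv_omegaOff hq, fderiv_omegaOff hq] at this
  have e2 : S.omegaDiag q (dirA n) = -(Complex.I / 4) * (Real.exp (-q.1) : ℂ) := by
    simp [omegaDiag, formPhi]
  have e3 : ∀ A : SympIdx n → ℂ, symp A (fun _ => (0 : ℂ)) = 0 := symp_zero_right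
  simp [e2, e3, hX] at this
  push_cast
  linear_combination this

theorem fderiv_diag_dirU (h : S.IsMomentMap X 𝔓) (hq : q ∈ S.carrier)
    (hX : (X q).2.2.2 = 0) (hZ : q.2.2.2 = 0) :
    fderiv ℝ (fun x => 𝔓 x 0 0) q (dirU n)
      = -(Complex.I / 4) * ((Real.exp (-q.1) * (X q).2.1 : ℝ) : ℂ) := by
  have := h.eq_diag hq (dirU n)
  have e1 : S.omegaOff q (dirU n) = 0 := omegaOff_of_zero rfl
  rw [curvature_diag, fderiv_omegaDiag hq (Or.inr rfl), fderiv_omegaDiag hq (Or.inl rfl), e1] at this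
  simp [formPhi, hZ, hX] at this
  push_cast
  linear_combination this

theorem fderiv_diag_dirZ (h : S.IsMomentMap X 𝔓) (hq : q ∈ S.carrier)
    (hX : (X q).2.2.2 = 0) (hZ : q.2.2.2 = 0) (h0 : 𝔓 q 0 1 = 0)
    (ζ : SympIdx n → ℝ) : fderiv ℝ (fun x => 𝔓 x 0 0) q (dirZ ζ) = 0 := by
  have := h.eq_diag hq (dirZ ζ)
  have e1 : S.omegaOff q (X q) = 0 := omegaOff_of_zero hX
  rw [curvature_diag, fderiv_omegaDiag hq (Or.inr rfl), fderiv_omegaDiag hq (Or.inl rfl), e1,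
    h0] at this
  simpa [formPhi, hZ, hX] using this

/-- The right side contains 𝔓₀₀ undifferentiated, which is what later fixes its integration
constant. -/
theorem fderiv_off_dirZ (h : S.IsMomentMap X 𝔓) (hq : q ∈ S.carrier)
    (hX : (X q).2.2.2 = 0) (h0 : 𝔓 q 0 1 = 0)
    (ζ : SympIdx n → ℝ) : fderiv ℝ (fun x => 𝔓 x 0 1) q (dirZ ζ)
      = (Real.exp (-q.1 / 2) : ℂ) * ((2 * 𝔓 q 0 0 - (X q).1 / 2 + 2 * S.omegaDiag q (X q))
          * S.pairV q.2.2.1 ζ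
        + symp ((Real.exp (kahlerPotential S.Ω q.2.2.1 / 2) : ℂ) • (S.dΩ q.2.2.1 (X q).2.2.1
          - ((S.dY q.2.2.1 (X q).2.2.1).re / hermNorm S.Ω q.2.2.1 : ℂ) • S.Ω q.2.2.1))
          (fun α => (ζ α : ℂ))) := by
  have := h.eq_off hq (dirZ ζ)
  have e1 : S.omegaOff q (X q) = 0 := omegaOff_of_zero hX
  have e2 : S.omegaOff q (dirZ ζ) = (Real.exp (-q.1 / 2) : ℂ) * S.pairV q.2.2.1 ζ := rfl
  have e3 : ∀ A : SympIdx n → ℂ, symp A (fun _ => (0 : ℂ)) = 0 := symp_zero_right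
  rw [curvature_off, fderiv_omegaOff hq, fderiv_omegaOff hq, e1, e2, h0] at this
  simp only [hX, pairV_zero, Pi.zero_apply, Complex.ofReal_zero, e3] at this
  linear_combination this

end IsMomentMap

end SpecialKahler

end CMap

/-! ### The moment map along 𝐙 = 0 -/

namespace CMap

variable {n : ℕ}

theorem hasDerivAt_coordU (U a : ℝ) (z : Fin n → ℂ) (ζ : SympIdx n → ℝ) :
    HasDerivAt (fun u : ℝ => ((u, a, z, ζ) : QSpace n)) (dirU n) U :=
  (hasDerivAt_id U).prodMk (hasDerivAt_const U (a, z, ζ))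

theorem hasDerivAt_coordA (U a : ℝ) (z : Fin n → ℂ) (ζ : SympIdx n → ℝ) :
    HasDerivAt (fun b : ℝ => ((U, b, z, ζ) : QSpace n)) (dirA n) a :=
  (hasDerivAt_const a U).prodMk ((hasDerivAt_id a).prodMk (hasDerivAt_const a (z, ζ)))

theorem symp_mulVec_of_symplectic {T : Matrix (SympIdx n) (SympIdx n) ℝ}
    (hT : Tᵀ * sympC n ℝ + sympC n ℝ * T = 0) (A B : SympIdx n → ℂ) :
    symp A (T.map Complex.ofReal *ᵥ B) = -symp (T.map Complex.ofReal *ᵥ A) B := by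
  have hC : (sympC n ℝ).map Complex.ofReal = sympC n ℂ := by
    ext (i | i) (j | j) <;> simp [sympC, Matrix.one_apply, apply_ite]
  have h : (T.map Complex.ofReal)ᵀ * sympC n ℂ + sympC n ℂ * T.map Complex.ofReal = 0 := by
    have := congrArg (Complex.ofRealHom.mapMatrix) hT
    simp only [map_add, map_mul, map_zero] at this
    simp only [RingHom.mapMatrix_apply] at this
    change Tᵀ.map Complex.ofReal * (sympC n ℝ).map Complex.ofReal
      + (sympC n ℝ).map Complex.ofReal * T.map Complex.ofReal = 0 at this
    rw [hC] at this
    exact this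
  have e := congrArg (fun M => A ⬝ᵥ (M *ᵥ B)) h
  simp only [Matrix.add_mulVec, dotProduct_add, Matrix.zero_mulVec, dotProduct_zero,
    ← Matrix.mulVec_mulVec] at e
  rw [Matrix.dotProduct_mulVec A, Matrix.vecMul_transpose] at e
  rw [symp, symp]
  linear_combination e

theorem ofReal_mulVec (T : Matrix (SympIdx n) (SympIdx n) ℝ) (ζ : SympIdx n → ℝ) :
    (fun α => ((T *ᵥ ζ) α : ℂ)) = T.map Complex.ofReal *ᵥ fun α => (ζ α : ℂ) := by
  ext α
  simp [Matrix.mulVec, dotProduct]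

namespace SpecialKahler

variable {S : SpecialKahler n} {N : S.NilpotentIsometry} {κ : ℝ} {L : QSpace n → QSpace n}
  {𝔓 : QSpace n → Matrix (Fin 2) (Fin 2) ℂ}

/-- V has Hermitian norm 1, so it cannot pair to zero with every real vector. -/
theorem exists_pairV_ne {z : Fin n → ℂ} (hz : z ∈ S.D) : ∃ ζ, S.pairV z ζ ≠ 0 := by
  by_contra! h
  have h1 : ∀ i, secV S.Ω z (Sum.inl i) = 0 := fun i => by
    have := h (Pi.single (Sum.inr i) 1)
    simpa [pairV, symp_eq, Pi.single_apply, apply_ite Complex.ofReal] using this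
  have := herm_secV_secV hz
  simp [herm, symp_eq, h1] at this

theorem _root_.HasDerivAt.pairV {A : ℝ → SympIdx n → ℝ} {A' : SympIdx n → ℝ} {t : ℝ}
    (z : Fin n → ℂ) (hA : HasDerivAt A A' t) :
    HasDerivAt (fun t => S.pairV z (A t)) (S.pairV z A') t := by
  let P : (SympIdx n → ℝ) →ₗ[ℝ] ℂ :=
    { toFun := S.pairV z
      map_add' := pairV_add z
      map_smul' := fun c ζ => by rw [pairV_smul]; rfl }
  exact (LinearMap.toContinuousLinearMap P).hasFDerivAt.comp_hasDerivAt t hA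

theorem NilpotentIsometry.gauged_Z (q : QSpace n) :
    (N.gauged κ L q).2.2.2 = N.T *ᵥ q.2.2.2 - κ • (L q).2.2.2 := by
  simp [gauged, lift, ehlersPlus, sub_eq_add_neg]

theorem IsEhlersMinus.gauged_of_locus (hL : S.IsEhlersMinus L) {q : QSpace n} (hq : q ∈ S.carrier)
    (hZ : q.2.2.2 = 0) : N.gauged κ L q
      = (-(2 * κ * q.2.1), κ * (Real.exp (2 * q.1) - 1 - q.2.1 ^ 2), N.k q.2.2.1, 0) := by
  rw [NilpotentIsometry.gauged, hL.eq_of_locus hq hZ]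
  refine Prod.ext ?_ (Prod.ext ?_ (Prod.ext ?_ ?_))
  · simp [NilpotentIsometry.lift, ehlersPlus]
    ring
  · simp only [NilpotentIsometry.lift, ehlersPlus, Prod.snd_add, Prod.fst_add, Prod.smul_snd,
      Prod.smul_fst, Prod.snd_sub, Prod.fst_sub, smul_eq_mul]
    ring
  · simp [NilpotentIsometry.lift, ehlersPlus]
  · simp [NilpotentIsometry.lift, ehlersPlus, hZ]

namespace IsMomentMap

/-- The off-diagonal part of the moment map vanishes along `𝐙 = 0`. -/
theorem off_eq_zero (hL : S.IsEhlersMinus L) (h : S.IsMomentMap (N.gauged κ L) 𝔓) {z : Fin n → ℂ}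
    (hz : z ∈ S.D) (U a : ℝ) : 𝔓 (U, a, z, 0) 0 1 = 0 := by
  set o : ℝ → ℝ → ℂ := fun U a => 𝔓 (U, a, z, 0) 0 1 with ho
  have hX : ∀ U a : ℝ, (N.gauged κ L (U, a, z, 0)).2.2.2 = 0 := fun U a => by
    rw [hL.gauged_of_locus (q := (U, a, z, 0)) hz rfl]
  have hd : ∀ U a : ℝ, HasFDerivAt (fun x => 𝔓 x 0 1)
      (fderiv ℝ (fun x => 𝔓 x 0 1) ((U, a, z, 0) : QSpace n)) ((U, a, z, 0) : QSpace n) :=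
    fun U a => (h.1 0 1).hasFDerivAt_of_isOpen S.isOpen_carrier hz
  have hU : ∀ U a : ℝ, HasDerivAt (fun u => o u a) 0 U := fun U a => by
    refine ((hd U a).comp_hasDerivAt U (hasDerivAt_coordU U a z 0)).congr_deriv ?_
    rw [h.fderiv_off_dirU (q := (U, a, z, 0)) hz, hX]
    simp
  have hA : ∀ U a : ℝ, HasDerivAt (fun b => o U b)
      ((Complex.I / 2) * (Real.exp (-U) : ℂ) * o U a) a := fun U a => by
    refine ((hd U a).comp_hasDerivAt a (hasDerivAt_coordA U a z 0)).congr_deriv ?_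
    rw [h.fderiv_off_dirA (q := (U, a, z, 0)) hz (hX U a)]
  -- The entry does not depend on U, yet its a-derivative carries the factor e^{-U}. Comparing U = 1
  -- with U = 0 forces it to vanish.
  have hc : ∀ U a, o U a = o 0 a := fun U a =>
    is_const_of_deriv_eq_zero (fun U => (hU U a).differentiableAt) (fun U => (hU U a).deriv) U 0
  have h1 := hA 1 a
  simp only [hc 1] at h1
  have h2 := h1.unique (hA 0 a)
  have h3 : ((Real.exp (-1) : ℂ) - 1) * o 0 a = 0 := by
    simp only [neg_zero, Real.exp_zero, Complex.ofReal_one] at h2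
    linear_combination (-2 * Complex.I) * h2 + ((Real.exp (-1) : ℂ) - 1) * o 0 a * Complex.I_sq
  have h4 : (Real.exp (-1) : ℂ) - 1 ≠ 0 := by
    rw [sub_ne_zero, ← Complex.ofReal_one, Complex.ofReal_injective.ne_iff]
    exact (Real.exp_lt_one_iff.2 (by norm_num)).ne
  rw [← ho] at *
  exact (hc U a).trans ((mul_eq_zero.1 h3).resolve_left h4)

/-- Integration of the ∂_U equation. At this stage `c` may still depend on a and z. -/
theorem exists_diag_eq (hL : S.IsEhlersMinus L) (h : S.IsMomentMap (N.gauged κ L) 𝔓)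
    {z : Fin n → ℂ} (hz : z ∈ S.D) (a : ℝ) : ∃ c : ℂ, ∀ U : ℝ, 𝔓 (U, a, z, 0) 0 0
      = c - Complex.I / 4 * ((κ * (Real.exp (-U) * (1 + a ^ 2) + Real.exp U) : ℝ) : ℂ) := by
  have hX : ∀ U : ℝ, N.gauged κ L (U, a, z, 0)
      = (-(2 * κ * a), κ * (Real.exp (2 * U) - 1 - a ^ 2), N.k z, 0) :=
    fun U => hL.gauged_of_locus (q := (U, a, z, 0)) hz rfl
  have hd : ∀ U : ℝ, HasDerivAt (fun U : ℝ => 𝔓 (U, a, z, 0) 0 0 + Complex.I / 4 *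
      ((κ * (Real.exp (-U) * (1 + a ^ 2) + Real.exp U) : ℝ) : ℂ)) 0 U := by
    intro U
    have h1 := ((h.1 0 0).hasFDerivAt_of_isOpen S.isOpen_carrier (x := (U, a, z, 0))
      hz).comp_hasDerivAt U (hasDerivAt_coordU U a z 0)
    have h2 := (((((hasDerivAt_id U).neg.exp.mul_const (1 + a ^ 2)).add
      (Real.hasDerivAt_exp U)).const_mul κ).ofReal_comp).const_mul (Complex.I / 4)
    refine (h1.add h2).congr_deriv ?_
    rw [h.fderiv_diag_dirU (q := (U, a, z, 0)) hz (by rw [hX]) rfl, hX]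
    have e : Real.exp (2 * U) = Real.exp U * Real.exp U := by rw [← Real.exp_add]; ring_nf
    have e2 : (Real.exp (-U) : ℂ) * Real.exp U = 1 := by
      rw [← Complex.ofReal_mul, ← Real.exp_add]; simp
    simp only [e, id, Pi.neg_apply]
    push_cast at e2 ⊢
    linear_combination (-(Complex.I / 4) * κ * Complex.exp U) * e2
  refine ⟨𝔓 (0, a, z, 0) 0 0 + Complex.I / 4 *
      ((κ * (Real.exp (-0) * (1 + a ^ 2) + Real.exp 0) : ℝ) : ℂ), fun U => ?_⟩
  rw [eq_sub_iff_add_eq]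
  exact is_const_of_deriv_eq_zero (fun U => (hd U).differentiableAt) (fun U => (hd U).deriv) U 0

/-- By symmetry of second derivatives, ∂_U may be taken first, where 𝔓₀₁ has a known derivative off
the locus as well. -/
theorem hasDerivAt_fderiv_off_dirZ (hL : S.IsEhlersMinus L) (h : S.IsMomentMap (N.gauged κ L) 𝔓)
    {z : Fin n → ℂ} (hz : z ∈ S.D) (U a : ℝ) (ζ : SympIdx n → ℝ) :
    HasDerivAt (fun u : ℝ => fderiv ℝ (fun x => 𝔓 x 0 1) ((u, a, z, 0) : QSpace n) (dirZ ζ))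
      ((1 / 2) * (Real.exp (-U / 2) : ℂ) * S.pairV z (N.T *ᵥ ζ
        - κ • (fderiv ℝ L ((U, a, z, 0) : QSpace n) (dirZ ζ)).2.2.2)) U := by
  have hs := S.isOpen_carrier
  set q : QSpace n := (U, a, z, 0) with hq_def
  have hq : q ∈ S.carrier := hz
  have h2 := ((h.1 0 1).fderiv_infty hs).hasFDerivAt_of_isOpen hs hq
  have a1 := (h2.clm_apply (hasFDerivAt_const (dirZ ζ) q)).comp_hasDerivAt U
    (hasDerivAt_coordU U a z 0)
  refine a1.congr_deriv ?_
  simp only [_root_.add_apply, ContinuousLinearMap.comp_apply, _root_.zero_apply, map_zero,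
    ContinuousLinearMap.flip_apply, zero_add]
  rw [(h.1 0 1).fderiv_fderiv_comm hs hq]
  have a2 := (h2.clm_apply (hasFDerivAt_const (dirU n) q)).hasLineDerivAt (dirZ ζ)
  simp only [_root_.add_apply, ContinuousLinearMap.comp_apply, _root_.zero_apply, map_zero,
    ContinuousLinearMap.flip_apply, zero_add] at a2
  set π : QSpace n →L[ℝ] (SympIdx n → ℝ) := (ContinuousLinearMap.snd ℝ _ _).comp
    ((ContinuousLinearMap.snd ℝ _ _).comp (ContinuousLinearMap.snd ℝ _ _)) with hπ
  have a3 := π.hasFDerivAt.comp_hasDerivAt _ (hL.1.1.hasLineDerivAt hs hq (dirZ ζ))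
  have a4 : HasDerivAt (fun t : ℝ => N.T *ᵥ (q + t • dirZ ζ).2.2.2) (N.T *ᵥ ζ) 0 := by
    have : HasDerivAt (fun t : ℝ => t • (N.T *ᵥ ζ)) (N.T *ᵥ ζ) 0 := by
      simpa using (hasDerivAt_id (0 : ℝ)).smul_const (N.T *ᵥ ζ)
    refine this.congr_of_eventuallyEq (Filter.Eventually.of_forall fun t => ?_)
    simp [hq_def, Matrix.mulVec_smul]
  have a5 := ((a4.sub (a3.const_smul κ)).pairV (S := S) z).const_mul
    ((1 / 2) * (Real.exp (-U / 2) : ℂ))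
  refine HasLineDerivAt.unique a2 (HasDerivAt.congr_of_eventuallyEq a5 ?_)
  refine Filter.Eventually.of_forall fun t => ?_
  have hm : q + t • dirZ ζ ∈ S.carrier := by
    simpa [hq_def, mem_carrier, carrier] using hz
  simp only
  rw [h.fderiv_off_dirU hm, NilpotentIsometry.gauged_Z]
  simp [hq_def, hπ]

/-- The diagonal part of the moment map along `𝐙 = 0`. -/
theorem diag_eq (hL : S.IsEhlersMinus L) (h : S.IsMomentMap (N.gauged κ L) 𝔓) {z : Fin n → ℂ}
    (hz : z ∈ S.D) (U a : ℝ) : 𝔓 (U, a, z, 0) 0 0 = -(Complex.I / 2) * ((N.momentMap z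
      + κ / 2 * Real.exp (-U) * (1 + a ^ 2 + Real.exp (2 * U)) : ℝ) : ℂ) := by
  obtain ⟨c, hc⟩ := h.exists_diag_eq hL hz a
  obtain ⟨ζ, hζ⟩ := exists_pairV_ne hz
  obtain ⟨η, hη⟩ := hL.fderiv_dirZ_of_locus a hz ζ
  have hX : ∀ U : ℝ, N.gauged κ L (U, a, z, 0)
      = (-(2 * κ * a), κ * (Real.exp (2 * U) - 1 - a ^ 2), N.k z, 0) :=
    fun U => hL.gauged_of_locus (q := (U, a, z, 0)) hz rfl
  set σ := S.pairV z ζ with hσ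
  set y : ℂ := S.dY z (N.k z) / hermNorm S.Ω z with hy
  set ε : ℂ := (Real.exp (kahlerPotential S.Ω z / 2) : ℂ) with hε
  set b : ℂ := symp (ε • (S.dΩ z (N.k z) - ((S.dY z (N.k z)).re / hermNorm S.Ω z : ℂ) • S.Ω z))
    (fun α => (ζ α : ℂ)) with hb
  have hre : ((S.dY z (N.k z)).re / hermNorm S.Ω z : ℂ) = (y.re : ℂ) := by
    rw [hy, ← Complex.ofReal_div, Complex.div_ofReal_re]
  have hoff : ∀ U : ℝ, fderiv ℝ (fun x => 𝔓 x 0 1) ((U, a, z, 0) : QSpace n) (dirZ ζ)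
      = (Real.exp (-U / 2) : ℂ) * ((2 * c + κ * a - Complex.I * y.im
        - Complex.I * κ * Real.exp U) * σ + b) := by
    intro U
    rw [h.fderiv_off_dirZ (q := (U, a, z, 0)) hz (by rw [hX]) (h.off_eq_zero hL hz U a), hX, hc U,
      omegaDiag, connQ_eq hz]
    have e : Real.exp (-U) * Real.exp (2 * U) = Real.exp U := by rw [← Real.exp_add]; ring_nf
    have e' : (Real.exp (-U) : ℂ) * Real.exp (2 * U) = Real.exp U := by
      rw [← Complex.ofReal_mul, e]
    simp only [formPhi, symp_zero_left, add_zero]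
    simp only [Complex.ofReal_mul, Complex.ofReal_sub, Complex.ofReal_add, Complex.ofReal_neg,
      Complex.ofReal_one, Complex.ofReal_pow, Complex.ofReal_ofNat]
    linear_combination (-(Complex.I / 2) * κ * (Real.exp (-U / 2) : ℂ) * σ) * e'
  have hder : ∀ U : ℝ, HasDerivAt (fun U : ℝ => (Real.exp (-U / 2) : ℂ) *
      ((2 * c + κ * a - Complex.I * y.im - Complex.I * κ * Real.exp U) * σ + b))
      ((Real.exp (-U / 2) : ℂ) * (-(1 / 2) * ((2 * c + κ * a - Complex.I * y.im
        - Complex.I * κ * Real.exp U) * σ + b) - Complex.I * κ * Real.exp U * σ)) U := by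
    intro U
    have h1 : HasDerivAt (fun U : ℝ => (Real.exp (-U / 2) : ℂ))
        ((Real.exp (-U / 2) * (-1 / 2) : ℝ) : ℂ) U :=
      (((hasDerivAt_id U).neg.div_const 2).exp).ofReal_comp
    have h2 := (Real.hasDerivAt_exp U).ofReal_comp
    have h3 := h1.mul ((((h2.const_mul (Complex.I * κ)).const_sub
      (2 * c + κ * a - Complex.I * y.im)).mul_const σ).add_const b)
    refine h3.congr_deriv ?_
    push_cast
    ring
  -- Two values of ∂_U D_ζ 𝔓₀₁ are compared: the derivative of the algebraic expression `hoff`, and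
  -- the mixed second derivative. Sorting by powers of e^U leaves a left side independent of U.
  have hkey : ∀ U : ℝ, (-2 * c + Complex.I * y.im) * σ - b - S.pairV z (N.T *ᵥ ζ)
      = Real.exp U * (Complex.I * κ * σ - κ * S.pairV z η) := by
    intro U
    have h1 := h.hasDerivAt_fderiv_off_dirZ hL hz U a ζ
    simp only [hoff] at h1
    have h2 := h1.unique (hder U)
    have h0 : (Real.exp (-U / 2) : ℂ) ≠ 0 := Complex.ofReal_ne_zero.2 (Real.exp_pos _).ne'
    have e : S.pairV z (N.T *ᵥ ζ - κ • (a • ζ + Real.exp U • η))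
        = S.pairV z (N.T *ᵥ ζ) - κ * (a * σ + Real.exp U * S.pairV z η) := by
      rw [sub_eq_add_neg, ← neg_smul, pairV_add, pairV_smul, pairV_add, pairV_smul, pairV_smul]
      push_cast
      ring
    rw [hη, e] at h2
    have h3 := mul_left_cancel₀ h0 ((by ring : (Real.exp (-U / 2) : ℂ) * ((1 / 2) *
      (S.pairV z (N.T *ᵥ ζ) - κ * (a * σ + Real.exp U * S.pairV z η))) = _).trans h2)
    linear_combination (-2) * h3
  -- The left side takes the same value at U = 0 and U = 1, while the right side gains the factor e.
  -- So both vanish, and `η` is gone.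
  have hzero : (-2 * c + Complex.I * y.im) * σ - b - S.pairV z (N.T *ᵥ ζ) = 0 := by
    have k0 := hkey 0
    have k1 := hkey 1
    rw [Real.exp_zero, Complex.ofReal_one, one_mul] at k0
    rw [← k0] at k1
    have hne : (Real.exp 1 : ℂ) - 1 ≠ 0 := by
      rw [sub_ne_zero, ← Complex.ofReal_one, Complex.ofReal_injective.ne_iff]
      exact (Real.one_lt_exp_iff.2 one_pos).ne'
    refine (mul_eq_zero.1 (?_ : ((Real.exp 1 : ℂ) - 1) * _ = 0)).resolve_left hne
    linear_combination -k1
  have hT : S.pairV z (N.T *ᵥ ζ)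
      = -symp (ε • (N.T.map Complex.ofReal *ᵥ S.Ω z)) (fun α => (ζ α : ℂ)) := by
    rw [pairV, ofReal_mulVec, symp_mulVec_of_symplectic N.symplectic_T, secV_eq,
      Matrix.mulVec_smul]
  -- Once 𝔗 is moved from ζ onto Ω by symplecticity, the equivariance of Ω cancels the 𝔗Ω terms and
  -- leaves the compensator f.
  have hbT : b + S.pairV z (N.T *ᵥ ζ) = (N.f z - y.re) * σ := by
    have hact : S.dΩ z (N.k z) = N.T.map Complex.ofReal *ᵥ S.Ω z + N.f z • S.Ω z := N.action z hz
    rw [hT, hb, hact, hσ, pairV, secV_eq, hre, sub_eq_add_neg_smul]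
    simp only [symp_smul_left, symp_add_left]
    ring
  have h2c : 2 * c = Complex.I * y.im - N.f z + y.re := by
    refine mul_right_cancel₀ hζ ?_
    linear_combination -hzero - hbT
  -- Values in su(2) make `c` imaginary, so only the imaginary part of `h2c` counts: it is minus the
  -- Kähler moment map.
  have hconj : conj c = -c := by
    have h1 := h.conj_diag (q := (0, a, z, 0)) hz
    rw [hc 0] at h1
    simp only [map_sub, map_mul, map_div₀, Complex.conj_I, Complex.conj_ofReal, map_ofNat] at h1
    linear_combination h1
  have hm : N.momentMap z = -y.im + (N.f z).im := by
    rw [NilpotentIsometry.momentMap]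
    congr 1
    rw [← Complex.neg_im, hy, ← sum_dKahler_mul hz]
    exact congrArg _ (Finset.sum_congr rfl fun i _ => mul_comm _ _)
  have hc' : c = -(Complex.I / 2) * (N.momentMap z : ℂ) := by
    have h1 := congrArg conj h2c
    simp only [map_add, map_sub, map_mul, Complex.conj_I, Complex.conj_ofReal, hconj,
      map_ofNat] at h1
    have h3 : N.f z - conj (N.f z) = 2 * (N.f z).im * Complex.I := by
      rw [Complex.sub_conj]; push_cast; ring
    rw [hm]
    push_cast
    linear_combination (1 / 4 : ℂ) * h2c - (1 / 4 : ℂ) * h1 - (1 / 4 : ℂ) * h3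
  rw [hc U, hc']
  have e : Real.exp (-U) * Real.exp (2 * U) = Real.exp U := by rw [← Real.exp_add]; ring_nf
  rw [← e]
  push_cast
  ring

end IsMomentMap

end SpecialKahler

end CMap

namespace CMap

variable {n : ℕ}

namespace SpecialKahler

variable {S : SpecialKahler n} {N : S.NilpotentIsometry} {κ : ℝ} {L : QSpace n → QSpace n}
  {𝔓 : QSpace n → Matrix (Fin 2) (Fin 2) ℂ}

namespace IsMomentMap

variable {X : QSpace n → QSpace n} {q : QSpace n}

/-! ### The potential along the truncation loci -/

theorem trace_sq (h : S.IsMomentMap X 𝔓) (hq : q ∈ S.carrier) :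
    (𝔓 q * 𝔓 q).trace = 2 * (𝔓 q 0 0) ^ 2 - 2 * (𝔓 q 0 1 * conj (𝔓 q 0 1)) := by
  rw [Matrix.trace_fin_two, Matrix.mul_apply, Matrix.mul_apply, Fin.sum_univ_two, Fin.sum_univ_two,
    h.apply_one_one hq, h.apply_one_zero hq]
  ring

/-- Where 𝔓₀₁ vanishes, |𝔓₀₁|² is stationary, so only 𝔓₀₀ contributes to the gradient. -/
theorem hasLineDerivAt_gaugingPotential (h : S.IsMomentMap X 𝔓) (hq : q ∈ S.carrier)
    (h0 : 𝔓 q 0 1 = 0) (c : ℝ) (v : QSpace n) : HasLineDerivAt ℝ (gaugingPotential c 𝔓)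
      (c * (4 * 𝔓 q 0 0 * fderiv ℝ (fun x => 𝔓 x 0 0) q v).re) q v := by
  have hs := S.isOpen_carrier
  have hp := (h.1 0 0).hasFDerivAt_of_isOpen hs hq
  have ho := (h.1 0 1).hasFDerivAt_of_isOpen hs hq
  have hb : HasFDerivAt (fun x => conj (𝔓 x 0 1)) _ q :=
    (Complex.conjCLE : ℂ →L[ℝ] ℂ).hasFDerivAt.comp q ho
  have hd := ((hp.mul hp).const_mul (2 : ℂ)).sub ((ho.mul hb).const_mul (2 : ℂ))
  have hf := (Complex.reCLM.hasFDerivAt.comp q hd).const_mul c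
  have hl := (hf.congr_of_eventuallyEq (f₁ := gaugingPotential c 𝔓)
    (Filter.eventuallyEq_of_mem (hs.mem_nhds hq) fun x hx => by
      rw [gaugingPotential, h.trace_sq hx]
      simp [pow_two])).hasLineDerivAt v
  refine HasDerivAt.congr_deriv hl ?_
  simp [h0]
  ring

theorem fderiv_diag_dirZ_of_locus (hL : S.IsEhlersMinus L) (h : S.IsMomentMap (N.gauged κ L) 𝔓)
    {z : Fin n → ℂ} (hz : z ∈ S.D) (U a : ℝ) (ζ : SympIdx n → ℝ) :
    fderiv ℝ (fun x => 𝔓 x 0 0) ((U, a, z, 0) : QSpace n) (dirZ ζ) = 0 := by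
  refine h.fderiv_diag_dirZ (q := (U, a, z, 0)) hz ?_ rfl (h.off_eq_zero hL hz U a) ζ
  rw [hL.gauged_of_locus (q := (U, a, z, 0)) hz rfl]

/-- The a-component κ(e^{2U} − 1 − a²) of the gauged field vanishes at U = a = 0. -/
theorem fderiv_diag_dirU_of_locus (hL : S.IsEhlersMinus L) (h : S.IsMomentMap (N.gauged κ L) 𝔓)
    {z : Fin n → ℂ} (hz : z ∈ S.D) :
    fderiv ℝ (fun x => 𝔓 x 0 0) ((0, 0, z, 0) : QSpace n) (dirU n) = 0 := by
  have hX := hL.gauged_of_locus (κ := κ) (N := N) (q := (0, 0, z, 0)) hz rfl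
  rw [h.fderiv_diag_dirU (q := (0, 0, z, 0)) hz (by rw [hX]) rfl, hX]
  simp

theorem fderiv_diag_dirA_of_locus (hL : S.IsEhlersMinus L) (h : S.IsMomentMap (N.gauged κ L) 𝔓)
    {z : Fin n → ℂ} (hz : z ∈ S.D) :
    fderiv ℝ (fun x => 𝔓 x 0 0) ((0, 0, z, 0) : QSpace n) (dirA n) = 0 := by
  have h1 := ((h.1 0 0).hasFDerivAt_of_isOpen S.isOpen_carrier (x := (0, 0, z, 0))
    hz).comp_hasDerivAt 0 (hasDerivAt_coordA 0 0 z 0)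
  refine h1.unique ?_
  have h2 : HasDerivAt (fun a : ℝ => N.momentMap z
      + κ / 2 * Real.exp (-0) * (1 + a ^ 2 + Real.exp (2 * 0))) 0 0 := by
    refine (((((hasDerivAt_pow 2 (0 : ℝ)).const_add 1).add_const
      (Real.exp (2 * 0))).const_mul (κ / 2 * Real.exp (-0))).const_add (N.momentMap z)).congr_deriv ?_
    simp
  have h3 := h2.ofReal_comp.const_mul (-(Complex.I / 2))
  refine (h3.congr_of_eventuallyEq (Filter.Eventually.of_forall fun a =>
    h.diag_eq hL hz 0 a)).congr_deriv ?_
  simp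

theorem gaugingPotential_locus (hL : S.IsEhlersMinus L) (h : S.IsMomentMap (N.gauged κ L) 𝔓)
    {z : Fin n → ℂ} (hz : z ∈ S.D) (c U a : ℝ) : gaugingPotential c 𝔓 (U, a, z, 0)
      = -c / 2 * (N.momentMap z + κ / 2 * Real.exp (-U) * (1 + a ^ 2 + Real.exp (2 * U))) ^ 2 := by
  rw [gaugingPotential, h.trace_sq (q := (U, a, z, 0)) hz, h.off_eq_zero hL hz, h.diag_eq hL hz]
  set r := N.momentMap z + κ / 2 * Real.exp (-U) * (1 + a ^ 2 + Real.exp (2 * U))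
  have e : 2 * (-(Complex.I / 2) * (r : ℂ)) ^ 2 - 2 * (0 * conj (0 : ℂ))
      = ((-(1 / 2) * r ^ 2 : ℝ) : ℂ) := by
    push_cast
    linear_combination (1 / 2 : ℂ) * (r : ℂ) ^ 2 * Complex.I_sq
  rw [e, Complex.ofReal_re]
  ring

theorem hasLineDerivAt_gaugingPotential_dirZ (hL : S.IsEhlersMinus L)
    (h : S.IsMomentMap (N.gauged κ L) 𝔓) {z : Fin n → ℂ} (hz : z ∈ S.D) (c U a : ℝ)
    (ζ : SympIdx n → ℝ) :
    HasLineDerivAt ℝ (gaugingPotential c 𝔓) 0 (U, a, z, 0) (dirZ ζ) := by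
  have := h.hasLineDerivAt_gaugingPotential (q := (U, a, z, 0)) hz (h.off_eq_zero hL hz U a) c
    (dirZ ζ)
  rwa [h.fderiv_diag_dirZ_of_locus hL hz, mul_zero, Complex.zero_re, mul_zero] at this

theorem hasLineDerivAt_gaugingPotential_normal (hL : S.IsEhlersMinus L)
    (h : S.IsMomentMap (N.gauged κ L) 𝔓) {z : Fin n → ℂ} (hz : z ∈ S.D) (c u b : ℝ)
    (ζ : SympIdx n → ℝ) :
    HasLineDerivAt ℝ (gaugingPotential c 𝔓) 0 (0, 0, z, 0) (u, b, 0, ζ) := by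
  have := h.hasLineDerivAt_gaugingPotential (q := (0, 0, z, 0)) hz (h.off_eq_zero hL hz 0 0) c
    (u, b, 0, ζ)
  have e : ((u, b, 0, ζ) : QSpace n) = u • dirU n + b • dirA n + dirZ ζ := by simp [dirZ]
  have e0 : fderiv ℝ (fun x => 𝔓 x 0 0) ((0, 0, z, 0) : QSpace n) (u, b, 0, ζ) = 0 := by
    rw [e, map_add, map_add, map_smul, map_smul, h.fderiv_diag_dirZ_of_locus hL hz,
      h.fderiv_diag_dirU_of_locus hL hz, h.fderiv_diag_dirA_of_locus hL hz]
    simp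
  rwa [e0, mul_zero, Complex.zero_re, mul_zero] at this

end IsMomentMap

/-! ### Consistent truncations -/

theorem kahlerForm_zero_right (z v : Fin n → ℂ) : S.kahlerForm z v 0 = 0 := by
  simp [kahlerForm]

/-- At 𝐙 = 0 the metric has no mixed (U, a, z)–𝐙 components, so normal vectors are pure
𝐙-directions. For tangent v the form Φ(v) does not involve 𝐙, so neither does h(v, v), and the locus
is totally geodesic. -/
theorem isConsistentTruncation_locusZ {V : QSpace n → ℝ}
    (hV : ∀ (U a : ℝ), ∀ z ∈ S.D, ∀ ζ, HasLineDerivAt ℝ V 0 (U, a, z, 0) (dirZ ζ)) :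
    S.IsConsistentTruncation V (locusZ n) := by
  rintro ⟨U, a, z, Z⟩ hq hqL ⟨wU, wa, wz, ζ⟩ hw
  obtain rfl : Z = 0 := hqL
  have hu : ((wU, wa, wz, 0) : QSpace n) = 0 := by
    by_contra hne
    refine (metric_pos' hq hne).ne' (Eq.trans ?_ (hw (wU, wa, wz, 0) rfl))
    simp [metric_eq, formPhi]
  obtain ⟨rfl, rfl, rfl⟩ : wU = 0 ∧ wa = 0 ∧ wz = 0 := by simpa using hu
  refine ⟨hV U a z hq ζ, ?_⟩
  rintro ⟨vU, va, vz, vZ⟩ hv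
  obtain rfl : vZ = 0 := hv
  have h1 : fderiv ℝ (fun x => S.metric x (vU, va, vz, 0) (0, 0, 0, ζ)) (U, a, z, 0)
      (vU, va, vz, 0) = 0 := by
    refine fderiv_apply_eq_of_hasLineDerivAt (S.contDiffOn_metric _ _) S.isOpen_carrier hq ?_
    have e : (fun t : ℝ => S.metric ((U, a, z, 0) + t • (vU, va, vz, 0)) (vU, va, vz, 0)
        (0, 0, 0, ζ)) = fun _ => 0 := by
      ext t
      simp [metric_eq, formPhi, kahlerForm_zero_right]
    rw [HasLineDerivAt, e]
    exact hasDerivAt_const _ _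
  rw [h1, fderiv_metric hq _ _ rfl]
  simp

/-- For v along the base, h(v, v) is the Kähler metric, independent of U, a and 𝐙, and the mixed
component with a normal vector vanishes identically. -/
theorem isConsistentTruncation_locusUaZ {V : QSpace n → ℝ}
    (hV : ∀ (u b : ℝ), ∀ z ∈ S.D, ∀ ζ, HasLineDerivAt ℝ V 0 (0, 0, z, 0) (u, b, 0, ζ)) :
    S.IsConsistentTruncation V (locusUaZ n) := by
  rintro ⟨U, a, z, Z⟩ hq ⟨hU, ha, hZ⟩ ⟨wU, wa, wz, ζ⟩ hw
  obtain rfl : U = 0 := hU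
  obtain rfl : a = 0 := ha
  obtain rfl : Z = 0 := hZ
  have hu : ((0, 0, wz, 0) : QSpace n) = 0 := by
    by_contra hne
    refine (metric_pos' hq hne).ne' (Eq.trans ?_ (hw (0, 0, wz, 0) ⟨rfl, rfl, rfl⟩))
    simp [metric_eq, formPhi]
  obtain rfl : wz = 0 := by simpa using hu
  refine ⟨hV wU wa z hq ζ, ?_⟩
  rintro ⟨vU, va, vz, vZ⟩ ⟨hvU, hva, hvZ⟩
  obtain rfl : vU = 0 := hvU
  obtain rfl : va = 0 := hva
  obtain rfl : vZ = 0 := hvZ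
  have e : (fun x => S.metric x (0, 0, vz, 0) (wU, wa, 0, ζ)) = fun _ => 0 := by
    ext x
    simp [metric_eq, formPhi, kahlerForm_zero_right]
  rw [e, fderiv_metric hq _ _ rfl]
  simp [formPhi]

end SpecialKahler

end CMap

namespace CMap

/-! ### The minimal coupling special geometry -/

/-- The unit disc. -/
def unitDisc : Set (Fin 1 → ℂ) := {w | Complex.normSq (w 0) < 1}

theorem isOpen_unitDisc : IsOpen unitDisc :=
  isOpen_lt (Complex.continuous_normSq.comp (continuous_apply 0)) continuous_const

section minimalSection

variable {w : Fin 1 → ℂ}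

theorem hermNorm_minimalSection (w : Fin 1 → ℂ) :
    hermNorm minimalSection w = 2 * (1 - Complex.normSq (w 0)) := by
  simp [hermNorm, symp_eq, minimalSection, Complex.normSq_apply]
  ring

theorem kahlerPotential_minimalSection (w : Fin 1 → ℂ) :
    kahlerPotential minimalSection w = -Real.log (2 * (1 - Complex.normSq (w 0))) := by
  rw [kahlerPotential, hermNorm_minimalSection]

theorem exists_hasFDerivAt_normSq (w : Fin 1 → ℂ) : ∃ φ : (Fin 1 → ℂ) →L[ℝ] ℝ,
    HasFDerivAt (fun w : Fin 1 → ℂ => Complex.normSq (w 0)) φ w ∧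
    ∀ v, (φ v : ℂ) = conj (w 0) * v 0 + w 0 * conj (v 0) := by
  let π : (Fin 1 → ℂ) →L[ℝ] ℂ := ContinuousLinearMap.proj 0
  have h1 := Complex.reCLM.hasFDerivAt.comp w π.hasFDerivAt
  have h2 := Complex.imCLM.hasFDerivAt.comp w π.hasFDerivAt
  refine ⟨_, (((h1.mul h1).add (h2.mul h2)).congr_of_eventuallyEq
    (Filter.Eventually.of_forall fun x => ?_)), fun v => ?_⟩
  · simp [Complex.normSq_apply, π]
  · apply Complex.ext <;> simp [π] <;> ring

theorem one_sub_normSq_pos (hw : w ∈ unitDisc) : 0 < 1 - Complex.normSq (w 0) := sub_pos.2 hw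

theorem hasFDerivAt_kahlerPotential_minimalSection (hw : w ∈ unitDisc)
    {φ : (Fin 1 → ℂ) →L[ℝ] ℝ}
    (hφ : HasFDerivAt (fun w : Fin 1 → ℂ => Complex.normSq (w 0)) φ w) :
    HasFDerivAt (kahlerPotential minimalSection) ((1 - Complex.normSq (w 0))⁻¹ • φ) w := by
  have hpos := one_sub_normSq_pos hw
  have h := (((hφ.const_sub 1).const_mul 2).log (by positivity)).neg
  rw [show kahlerPotential minimalSection = _ from funext kahlerPotential_minimalSection]
  refine h.congr_fderiv ?_
  ext v
  simp
  field_simp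

theorem fderiv_kahlerPotential_minimalSection (hw : w ∈ unitDisc) (v : Fin 1 → ℂ) :
    fderiv ℝ (fun w => (kahlerPotential minimalSection w : ℂ)) w v
      = conj (w 0) * v 0 / (1 - Complex.normSq (w 0) : ℂ)
        + w 0 * conj (v 0) / (1 - Complex.normSq (w 0) : ℂ) := by
  obtain ⟨φ, hφ, hv⟩ := exists_hasFDerivAt_normSq w
  have h := Complex.ofRealCLM.hasFDerivAt.comp w
    (hasFDerivAt_kahlerPotential_minimalSection hw hφ)
  rw [show (fun w => (kahlerPotential minimalSection w : ℂ))
    = Complex.ofRealCLM ∘ kahlerPotential minimalSection from rfl, h.fderiv]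
  simp [hv]
  ring

theorem dKahler_minimalSection (hw : w ∈ unitDisc) (i : Fin 1) :
    dKahler minimalSection i w = conj (w 0) / (1 - Complex.normSq (w 0) : ℂ) := by
  rw [dKahler, wirtinger_eq (fderiv_kahlerPotential_minimalSection hw), Subsingleton.elim i 0]
  · simp
  · intro v; simp; ring
  · intro v; simp; ring

theorem wirtingerBar_kahlerPotential_minimalSection (hw : w ∈ unitDisc) (i : Fin 1) :
    wirtingerBar (fun w => (kahlerPotential minimalSection w : ℂ)) i w
      = w 0 / (1 - Complex.normSq (w 0) : ℂ) := by
  rw [wirtingerBar_eq (fderiv_kahlerPotential_minimalSection hw), Subsingleton.elim i 0]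
  · simp
  · intro v; simp; ring
  · intro v; simp; ring

theorem one_sub_normSq_ne (hw : w ∈ unitDisc) : (1 - Complex.normSq (w 0) : ℂ) ≠ 0 := by
  exact_mod_cast (one_sub_normSq_pos hw).ne'

theorem kahlerMetric_minimalSection (hw : w ∈ unitDisc) (i j : Fin 1) :
    kahlerMetric minimalSection w i j = 1 / (1 - Complex.normSq (w 0) : ℂ) ^ 2 := by
  have hne := one_sub_normSq_ne hw
  rw [kahlerMetric, Matrix.of_apply, wirtinger_congr isOpen_unitDisc hw
    fun x hx => wirtingerBar_kahlerPotential_minimalSection hx j]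
  obtain ⟨φ, hφ, hv⟩ := exists_hasFDerivAt_normSq w
  let π : (Fin 1 → ℂ) →L[ℝ] ℂ := ContinuousLinearMap.proj 0
  have h1 := (Complex.ofRealCLM.hasFDerivAt.comp w hφ).const_sub 1
  have h2 := π.hasFDerivAt.mul ((hasDerivAt_inv hne).hasFDerivAt.restrictScalars ℝ |>.comp w h1)
  have h3 : ∀ v, fderiv ℝ (fun w : Fin 1 → ℂ => w 0 / (1 - Complex.normSq (w 0) : ℂ)) w v
      = v 0 / (1 - Complex.normSq (w 0) : ℂ) ^ 2
        + (w 0) ^ 2 * conj (v 0) / (1 - Complex.normSq (w 0) : ℂ) ^ 2 := by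
    intro v
    have h4 : HasFDerivAt (𝕜 := ℝ) (fun w : Fin 1 → ℂ => w 0 / (1 - Complex.normSq (w 0) : ℂ)) _ w :=
      h2.congr_of_eventuallyEq (Filter.Eventually.of_forall fun x => by
        simp [π, div_eq_mul_inv])
    rw [h4.fderiv]
    have e := Complex.mul_conj (w 0)
    simp [π, hv]
    field_simp
    linear_combination v 0 * e
  rw [wirtinger_eq h3, Subsingleton.elim i 0]
  · simp
  · intro v; simp; ring
  · intro v; simp; ring

theorem secU_minimalSection (hw : w ∈ unitDisc) (i : Fin 1) :
    secU minimalSection i w (Sum.inl 1) = (Real.exp (kahlerPotential minimalSection w / 2) : ℂ)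
      / (1 - Complex.normSq (w 0) : ℂ) := by
  have hne := one_sub_normSq_ne hw
  set E : ℂ := (Real.exp (kahlerPotential minimalSection w / 2) : ℂ) with hE
  obtain ⟨φ, hφ, hv⟩ := exists_hasFDerivAt_normSq w
  let π : (Fin 1 → ℂ) →L[ℝ] ℂ := ContinuousLinearMap.proj 0
  have h1 := Complex.ofRealCLM.hasFDerivAt.comp w
    ((hasFDerivAt_kahlerPotential_minimalSection hw hφ).mul_const (1 / 2)).exp
  have h2 := h1.mul π.hasFDerivAt
  have e := Complex.mul_conj (w 0)
  have h3 : ∀ v, fderiv ℝ (fun x => secV minimalSection x (Sum.inl 1)) w v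
      = E * (v 0 * (1 - Complex.normSq (w 0) / 2) / (1 - Complex.normSq (w 0) : ℂ))
        + E * ((w 0) ^ 2 * conj (v 0) / (2 * (1 - Complex.normSq (w 0)) : ℂ)) := by
    intro v
    have h4 : HasFDerivAt (𝕜 := ℝ) (fun x => secV minimalSection x (Sum.inl 1)) _ w :=
      h2.congr_of_eventuallyEq (Filter.Eventually.of_forall fun x => by
        simp [π, secV, minimalSection, div_eq_mul_inv])
    rw [h4.fderiv]
    simp [π, hv, hE, ← div_eq_mul_inv]
    field_simp
    linear_combination v 0 * e
  rw [secU, wirtinger_eq h3, dKahler_minimalSection hw, Subsingleton.elim i 0]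
  · have e2 : secV minimalSection w (Sum.inl 1) = E * w 0 := by simp [secV, minimalSection, hE]
    rw [e2]
    simp only [Pi.single_eq_same]
    field_simp
    linear_combination E * e
  · intro v; simp; ring
  · intro v; simp; ring

theorem exp_kahlerPotential_minimalSection (hw : w ∈ unitDisc) :
    Real.exp (kahlerPotential minimalSection w / 2) ^ 2
      = 1 / (2 * (1 - Complex.normSq (w 0))) := by
  have hpos := one_sub_normSq_pos hw
  rw [← Real.exp_nat_mul, kahlerPotential_minimalSection, Nat.cast_ofNat,
    mul_div_cancel₀ _ two_ne_zero, Real.exp_neg, Real.exp_log (by positivity), one_div]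

theorem normSq_secV_minimalSection (hw : w ∈ unitDisc) :
    Complex.normSq (secV minimalSection w (Sum.inl 1))
      = Complex.normSq (w 0) / (2 * (1 - Complex.normSq (w 0))) := by
  have e2 : secV minimalSection w (Sum.inl 1)
      = (Real.exp (kahlerPotential minimalSection w / 2) : ℂ) * w 0 := by
    simp [secV, minimalSection]
  rw [e2, Complex.normSq_mul, Complex.normSq_ofReal, ← pow_two,
    exp_kahlerPotential_minimalSection hw]
  ring

/-- The inverse metric (1 − |w|²)² cancels the denominators of the two covariant derivatives,
leaving the exponential of the Kähler potential. -/
theorem sum_secU_minimalSection (hw : w ∈ unitDisc) :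
    (∑ i, ∑ j, (kahlerMetric minimalSection w)⁻¹ i j * secU minimalSection i w (Sum.inl 1)
      * conj (secU minimalSection j w (Sum.inl 1))).re = 1 / (2 * (1 - Complex.normSq (w 0))) := by
  have hne := one_sub_normSq_ne hw
  rw [← exp_kahlerPotential_minimalSection hw, ← Complex.ofReal_re (_ ^ 2)]
  congr 1
  rw [Matrix.inv_subsingleton]
  simp only [Fin.sum_univ_one, Matrix.diagonal_apply_eq, kahlerMetric_minimalSection hw,
    secU_minimalSection hw, Ring.inverse_eq_inv', map_div₀, map_sub, map_one, Complex.conj_ofReal]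
  push_cast
  field_simp

end minimalSection

/-- Here 𝔓 = (i/2) Σ 𝒫^x σ_x up to the ordering of the Pauli matrices, and Tr(σ_x σ_y) = 2δ_xy, so
Tr 𝔓² = −½ Σ (𝒫^x)². -/
theorem sum_triplet_sq {P : Matrix (Fin 2) (Fin 2) ℂ} (hP : Pᴴ = -P) (htr : P.trace = 0) :
    ∑ x, triplet P x ^ 2 = -2 * (P * P).trace.re := by
  have h00 := congrFun (congrFun hP 0) 0
  have h10 := congrFun (congrFun hP 1) 0
  have h11 : P 1 1 = -P 0 0 := by
    rw [Matrix.trace_fin_two] at htr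
    linear_combination htr
  simp only [Matrix.conjTranspose_apply, Matrix.neg_apply, Complex.star_def] at h00 h10
  have e10 : P 1 0 = -conj (P 0 1) := by rw [h10, neg_neg]
  have hr : (P 0 0).re = 0 := by
    have := congrArg Complex.re h00
    simp only [Complex.conj_re, Complex.neg_re] at this
    linarith
  have hs : (Real.sqrt 2 : ℂ) * ((1 / Real.sqrt 2 : ℝ) : ℂ) = 1 := by
    rw [← Complex.ofReal_mul, mul_one_div_cancel (by positivity), Complex.ofReal_one]
  have ht : ∀ x, triplet P x = (-Complex.I * ((![!![1, 0; 0, -1], !![0, -Complex.I; Complex.I, 0],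
      !![0, 1; 1, 0]] x : Matrix (Fin 2) (Fin 2) ℂ) * P).trace).re := fun x => by
    rw [triplet, gammaMat, Matrix.smul_mul, Matrix.trace_smul, smul_eq_mul]
    congr 1
    linear_combination (-Complex.I * ((![!![1, 0; 0, -1], !![0, -Complex.I; Complex.I, 0],
      !![0, 1; 1, 0]] x : Matrix (Fin 2) (Fin 2) ℂ) * P).trace) * hs
  simp only [ht, Fin.sum_univ_three, Matrix.trace_fin_two, Matrix.mul_apply, Fin.sum_univ_two]
  simp [h11, e10, hr]
  ring

/-! ### The scalar potential at the origin of the disc -/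

namespace SpecialKahler

variable {n : ℕ} {S : SpecialKahler n}

/-- In the disc the potential depends on w only through |w|², which makes the origin stationary. -/
theorem scalarPotential_eq (X : QSpace n → QSpace n) (𝔓 : QSpace n → Matrix (Fin 2) (Fin 2) ℂ)
    {w : Fin 1 → ℂ} (hw : w ∈ unitDisc) (q : QSpace n) : S.scalarPotential X 𝔓 w q
      = 4 * S.metric q (X q) (X q)
          * (Complex.normSq (w 0) / (2 * (1 - Complex.normSq (w 0))))
        + (1 / (2 * (1 - Complex.normSq (w 0)))
            - 3 * (Complex.normSq (w 0) / (2 * (1 - Complex.normSq (w 0)))))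
          * ∑ x, triplet (𝔓 q) x ^ 2 := by
  rw [scalarPotential, sum_secU_minimalSection hw, normSq_secV_minimalSection hw]

theorem zero_mem_unitDisc : (0 : Fin 1 → ℂ) ∈ unitDisc := by simp [unitDisc]

theorem hasLineDerivAt_scalarPotential (X : QSpace n → QSpace n)
    (𝔓 : QSpace n → Matrix (Fin 2) (Fin 2) ℂ) (q : QSpace n) (v : Fin 1 → ℂ) :
    HasLineDerivAt ℝ (fun w => S.scalarPotential X 𝔓 w q) 0 0 v := by
  obtain ⟨φ, hφ, hv⟩ := exists_hasFDerivAt_normSq 0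
  have h0 : HasLineDerivAt ℝ (fun w : Fin 1 → ℂ => Complex.normSq (w 0)) 0 0 v := by
    have e : φ v = 0 := by simpa using hv v
    simpa only [e] using hφ.hasLineDerivAt v
  have h1 : HasDerivAt (fun t : ℝ => Complex.normSq ((0 + t • v) 0)) 0 0 := h0
  have h2 := (h1.const_sub 1).const_mul 2
  have hne : 2 * (1 - Complex.normSq (((0 : Fin 1 → ℂ) + (0 : ℝ) • v) 0)) ≠ 0 := by simp
  have h3 := ((h1.div h2 hne).const_mul (4 * S.metric q (X q) (X q))).add
    ((((hasDerivAt_const (0 : ℝ) (1 : ℝ)).div h2 hne).sub ((h1.div h2 hne).const_mul 3)).mul_const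
      (∑ x, triplet (𝔓 q) x ^ 2))
  refine (h3.congr_of_eventuallyEq ?_).congr_deriv (by simp)
  have hc : Continuous fun t : ℝ => (0 : Fin 1 → ℂ) + t • v := by fun_prop
  filter_upwards [hc.continuousAt.preimage_mem_nhds (isOpen_unitDisc.mem_nhds
    (by simpa using zero_mem_unitDisc : (0 : Fin 1 → ℂ) + (0 : ℝ) • v ∈ unitDisc))] with t ht
  exact scalarPotential_eq X 𝔓 ht q

theorem scalarPotential_zero {X : QSpace n → QSpace n}
    {𝔓 : QSpace n → Matrix (Fin 2) (Fin 2) ℂ} (h : S.IsMomentMap X 𝔓) {q : QSpace n}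
    (hq : q ∈ S.carrier) : S.scalarPotential X 𝔓 0 q = gaugingPotential (-1) 𝔓 q := by
  rw [scalarPotential_eq X 𝔓 zero_mem_unitDisc, sum_triplet_sq (h.2.1 q hq).1 (h.2.1 q hq).2,
    gaugingPotential]
  simp

end SpecialKahler

end CMap

theorem mainTheorem2 (n : ℕ) (S : CMap.SpecialKahler n) (hS : S.IsSymmetric)
    (N : S.NilpotentIsometry) (κ : ℝ) :
    (∃ Lm : CMap.QSpace n → CMap.QSpace n, S.IsEhlersMinus Lm) ∧
    ∀ (Lm : CMap.QSpace n → CMap.QSpace n), S.IsEhlersMinus Lm →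
    ∀ (𝔓 : CMap.QSpace n → Matrix (Fin 2) (Fin 2) ℂ), S.IsMomentMap (N.gauged κ Lm) 𝔓 →
      -- the vector multiplet scalar is stabilized at the origin, leaving `- Tr (𝔓 · 𝔓)`
      (∀ q ∈ S.carrier,
        (∀ v : Fin 1 → ℂ,
          HasLineDerivAt ℝ (fun w => S.scalarPotential (N.gauged κ Lm) 𝔓 w q) 0 0 v) ∧
        S.scalarPotential (N.gauged κ Lm) 𝔓 0 q = CMap.gaugingPotential (-1) 𝔓 q) ∧
      ∀ c : ℝ,
        -- vanishing `𝐙`-gradient at `𝐙 = 0`, and consistent truncation of the Heisenberg fields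
        (∀ (U a : ℝ), ∀ z ∈ S.D, ∀ ζ : CMap.SympIdx n → ℝ,
          HasLineDerivAt ℝ (CMap.gaugingPotential c 𝔓) 0 (U, a, z, 0) (0, 0, 0, ζ)) ∧
        S.IsConsistentTruncation (CMap.gaugingPotential c 𝔓) (CMap.locusZ n) ∧
        -- the effective potential
        (∀ (U a : ℝ), ∀ z ∈ S.D,
          CMap.gaugingPotential c 𝔓 (U, a, z, 0) =
            -c / 2 * (N.momentMap z
              + κ / 2 * Real.exp (-U) * (1 + a ^ 2 + Real.exp (2 * U))) ^ 2) ∧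
        -- further truncation at `U = a = 0`
        (∀ z ∈ S.D,
          HasLineDerivAt ℝ (CMap.gaugingPotential c 𝔓) 0 (0, 0, z, 0) (1, 0, 0, 0) ∧
          HasLineDerivAt ℝ (CMap.gaugingPotential c 𝔓) 0 (0, 0, z, 0) (0, 1, 0, 0)) ∧
        S.IsConsistentTruncation (CMap.gaugingPotential c 𝔓) (CMap.locusUaZ n) ∧
        (∀ z ∈ S.D,
          CMap.gaugingPotential c 𝔓 (0, 0, z, 0) = -c / 2 * (N.momentMap z + κ) ^ 2) := by
  refine ⟨hS.exists_isEhlersMinus, fun Lm hL 𝔓 h => ⟨fun q hq =>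
    ⟨CMap.SpecialKahler.hasLineDerivAt_scalarPotential _ 𝔓 q,
      CMap.SpecialKahler.scalarPotential_zero h hq⟩, fun c => ?_⟩⟩
  have hZ := fun (U a : ℝ) z (hz : z ∈ S.D) ζ =>
    h.hasLineDerivAt_gaugingPotential_dirZ hL hz c U a ζ
  have hN := fun (u b : ℝ) z (hz : z ∈ S.D) ζ =>
    h.hasLineDerivAt_gaugingPotential_normal hL hz c u b ζ
  refine ⟨hZ, CMap.SpecialKahler.isConsistentTruncation_locusZ hZ,
    fun U a z hz => h.gaugingPotential_locus hL hz c U a,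
    fun z hz => ⟨hN 1 0 z hz 0, hN 0 1 z hz 0⟩,
    CMap.SpecialKahler.isConsistentTruncation_locusUaZ hN, fun z hz => ?_⟩
  rw [h.gaugingPotential_locus hL hz]
  simp only [neg_zero, mul_zero, Real.exp_zero]
  ring
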